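/- Let $\Omega\subset\mathbb R^3$ be a bounded domain (non-empty, open, connected) with Lipschitz boundary $\partial\Omega$ and unit outward normal $\nu$, and write $x\cdot y=\sum_j x_jy_j$ for $x,y\in\mathbb C^3$. All function spaces are complex valued; $\boldsymbol L^2(\Omega)=[L^2(\Omega)]^3$, $\boldsymbol H^1(\Omega)=[H^1(\Omega)]^3$ and $H(\mathrm{curl},\Omega)=\{w\in\boldsymbol L^2(\Omega):\mathrm{curl}\,w\in\boldsymbol L^2(\Omega)\}$ carry their usual norms. Let $\boldsymbol H^{1/2}(\partial\Omega)$ be the space of traces of $\boldsymbol H^1(\Omega)$, i.e. the quotient $\boldsymbol H^1(\Omega)/\boldsymbol H^1_0(\Omega)$ with the quotient norm, and $\boldsymbol H^{-1/2}(\partial\Omega)$ its dual space (with bilinear duality $\langle\cdot,\cdot\rangle$). For $w\in H(\mathrm{curl},\Omega)$ the tangential trace $\nu\times w\in\boldsymbol H^{-1/2}(\partial\Omega)$ is defined by $$\langle\nu\times w,v\rangle=\int_\Omega(\mathrm{curl}\,w\cdot v-w\cdot\mathrm{curl}\,v)\,dx,\qquad v\in\boldsymbol H^1(\Omega),$$ and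 $H^{-1/2}_{\mathrm{Div}}(\partial\Omega)=\{\nu\times w:w\in H(\mathrm{curl},\Omega)\}$ with the norm $\|h\|=\inf\{\|w\|_{H(\mathrm{curl},\Omega)}:\nu\times w=h\}$. Let $\hat{\mathcal C}=(\hat C_{ijkl})_{i,j,k,l=1}^3$ with real-valued $\hat C_{ijkl}\in L^\infty(\Omega)$ satisfy, almost everywhere in $\Omega$, $\hat C_{ijkl}=\hat C_{klij}=\hat C_{jikl}=\hat C_{ijlk}$ and, for some constant $c_0>0$, $$\sum_{i,j,k,l}\hat C_{ijkl}(x)a_{ij}a_{kl}\ge c_0\sum_{i,j}|a_{ij}|^2\qquad\text{for all real } a_{ij}=a_{ji}.$$ Put $(\hat{\mathcal C}:\nabla u)_{ij}=\sum_{k,l}\hat C_{ijkl}\,\partial u_k/\partial x_l$ and let the divergence of a matrix field be taken row by row. If $u\in\boldsymbol H^1(\Omega)$ and $\nabla\cdot(\hat{\mathcal C}:\nabla u)\in\boldsymbol L^2(\Omega)$, then $Tu=(\hat{\mathcal C}:\nabla u)\nu\in\boldsymbol H^{-1/2}(\partial\Omega)$ is defined by $$\langle Tu,v\rangle=\int_\Omega\Big(\sum_{i,j}(\hat{\mathcal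 C}:\nabla u)_{ij}\frac{\partial v_i}{\partial x_j}+\big(\nabla\cdot(\hat{\mathcal C}:\nabla u)\big)\cdot v\Big)dx,\qquad v\in\boldsymbol H^1(\Omega).$$ Let $\kappa>0$ and $\hat b_1,\hat b_2\in\mathbb C$ with $\mathrm{Im}(\hat b_1\overline{\hat b_2})<0$. Then there is a constant $C>0$ such that for all $\xi_1,\xi_2\in\boldsymbol L^2(\Omega)$, $\boldsymbol h_1\in\boldsymbol H^{-1/2}(\partial\Omega)$ and $\boldsymbol h_2\in H^{-1/2}_{\mathrm{Div}}(\partial\Omega)$ the problem $$\begin{cases}\mathrm{curl}\,\mathrm{curl}\,\boldsymbol H+\boldsymbol H=\xi_1&\text{in }\Omega,\\ \nabla\cdot(\hat{\mathcal C}:\nabla\boldsymbol u)-\boldsymbol u=\xi_2&\text{in }\Omega,\\ T\boldsymbol u-\hat b_1\,\nu\times\boldsymbol H=\boldsymbol h_1&\text{on }\partial\Omega,\\ \nu\times\mathrm{curl}\,\boldsymbol H+\dfrac{\mathrm i\kappa}{\hat b_2}\,\nu\times\boldsymbol u=\boldsymbol h_2&\text{on }\partial\Omega\end{cases}$$ (differential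 equations in the weak sense, boundary conditions in $\boldsymbol H^{-1/2}(\partial\Omega)$) has a unique solution $(\boldsymbol H,\boldsymbol u)\in H(\mathrm{curl},\Omega)\times\boldsymbol H^1(\Omega)$, and this solution satisfies $$\|\boldsymbol H\|_{H(\mathrm{curl},\Omega)}+\|\boldsymbol u\|_{\boldsymbol H^1(\Omega)}\le C\left[\|\xi_1\|_{\boldsymbol L^2(\Omega)}+\|\xi_2\|_{\boldsymbol L^2(\Omega)}+\|\boldsymbol h_1\|_{\boldsymbol H^{-1/2}(\partial\Omega)}+\|\boldsymbol h_2\|_{H^{-1/2}_{\mathrm{Div}}(\partial\Omega)}\right].$$ -/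

import Mathlib

open MeasureTheory Set Filter Topology
open scoped ENNReal NNReal ContDiff ComplexConjugate

noncomputable section

namespace MaxwellNavier

/-! ### Domains -/

/-- Physical space `ℝ³` with its Euclidean norm. -/
abbrev E3 : Type := EuclideanSpace ℝ (Fin 3)

/-- `∂Ω` is Lipschitz: near every boundary point, after a rotation or reflection of the coordinates,
`Ω` is the region strictly below the graph of a Lipschitz function of two variables. -/
def HasLipschitzBoundary (Ω : Set E3) : Prop :=
  ∀ x ∈ frontier Ω, ∃ U ∈ 𝓝 x, ∃ (A : E3 ≃ₗᵢ[ℝ] E3) (ζ : EuclideanSpace ℝ (Fin 2) → ℝ) (K : ℝ≥0),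
    LipschitzWith K ζ ∧ ∀ y ∈ U, (y ∈ Ω ↔ A y 2 < ζ !₂[A y 0, A y 1])

/-- A bounded domain (nonempty, open, connected) with Lipschitz boundary. -/
structure IsBoundedLipschitzDomain (Ω : Set E3) : Prop where
  isOpen : IsOpen Ω
  isConnected : IsConnected Ω
  isBounded : Bornology.IsBounded Ω
  lipschitz : HasLipschitzBoundary Ω

/-! ### Test functions -/

/-- The classical partial derivative `∂φ/∂x_j`. -/
def pd (j : Fin 3) (φ : E3 → ℂ) (x : E3) : ℂ := fderiv ℝ φ x (EuclideanSpace.single j 1)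

/-- `φ ∈ C_c^∞(Ω)`. -/
structure IsTest (Ω : Set E3) (φ : E3 → ℂ) : Prop where
  smooth : ContDiff ℝ ∞ φ
  compact : HasCompactSupport φ
  support : tsupport φ ⊆ Ω

/-- The classical curl; the indices are cyclic, i.e. taken in `Fin 3`. -/
def curlFun (Φ : Fin 3 → E3 → ℂ) (i : Fin 3) (x : E3) : ℂ :=
  pd (i + 1) (Φ (i + 2)) x - pd (i + 2) (Φ (i + 1)) x

/-! ### `L²` spaces -/

/-- `L²(Ω)`, complex valued. -/
abbrev L2 (Ω : Set E3) : Type := Lp ℂ 2 (volume.restrict Ω)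

/-- `𝐋²(Ω) = [L²(Ω)]³`, with norm `(∑ ‖f_i‖²)^(1/2)`. -/
abbrev L2V (Ω : Set E3) : Type := PiLp 2 (fun _ : Fin 3 => L2 Ω)

/-- Square integrable `3 × 3` matrix fields, `(i, j)` being row and column. -/
abbrev L2M (Ω : Set E3) : Type := PiLp 2 (fun _ : Fin 3 => L2V Ω)

/-- The bilinear pairing `∫_Ω f g dx` on `L²(Ω)` (no conjugation). -/
def pairing (Ω : Set E3) : L2 Ω →L[ℂ] L2 Ω →L[ℂ] ℂ :=
  (ContinuousLinearMap.mul ℂ ℂ).lpPairing (volume.restrict Ω) 2 2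

theorem pairing_eq (Ω : Set E3) (f g : L2 Ω) : pairing Ω f g = ∫ x in Ω, f x * g x := by
  simp [pairing, ContinuousLinearMap.lpPairing_eq_integral]

theorem IsTest.pd {Ω : Set E3} {φ : E3 → ℂ} (h : IsTest Ω φ) (j : Fin 3) :
    IsTest Ω (pd j φ) where
  smooth := by
    have : ContDiff ℝ ∞ (fderiv ℝ φ) := h.smooth.fderiv_right (by simp)
    exact this.clm_apply contDiff_const
  compact := h.compact.fderiv_apply (𝕜 := ℝ) _
  support := (tsupport_fderiv_apply_subset ℝ _).trans h.support

theorem IsTest.memLp {Ω : Set E3} {φ : E3 → ℂ} (h : IsTest Ω φ) :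
    MemLp φ 2 (volume.restrict Ω) :=
  (h.smooth.continuous.memLp_of_hasCompactSupport h.compact).restrict Ω

theorem pairing_toLp {Ω : Set E3} {φ : E3 → ℂ} (f : L2 Ω) (h : IsTest Ω φ) :
    pairing Ω f h.memLp.toLp = ∫ x in Ω, f x * φ x := by
  rw [pairing_eq]
  refine integral_congr_ae ?_
  filter_upwards [h.memLp.coeFn_toLp] with x hx
  rw [hx]

theorem integral_add_test {Ω : Set E3} {φ : E3 → ℂ} (f g : L2 Ω) (h : IsTest Ω φ) :
    ∫ x in Ω, (f + g) x * φ x = (∫ x in Ω, f x * φ x) + ∫ x in Ω, g x * φ x := by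
  rw [← pairing_toLp _ h, ← pairing_toLp _ h, ← pairing_toLp _ h]
  simp

theorem integral_smul_test {Ω : Set E3} {φ : E3 → ℂ} (c : ℂ) (f : L2 Ω) (h : IsTest Ω φ) :
    ∫ x in Ω, (c • f) x * φ x = c * ∫ x in Ω, f x * φ x := by
  rw [← pairing_toLp _ h, ← pairing_toLp _ h]
  simp

theorem integral_sub_test {Ω : Set E3} {φ : E3 → ℂ} (f g : L2 Ω) (h : IsTest Ω φ) :
    ∫ x in Ω, (f - g) x * φ x = (∫ x in Ω, f x * φ x) - ∫ x in Ω, g x * φ x := by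
  rw [← pairing_toLp _ h, ← pairing_toLp _ h, ← pairing_toLp _ h]
  simp

theorem integral_zero_test {Ω : Set E3} {φ : E3 → ℂ} (h : IsTest Ω φ) :
    ∫ x in Ω, (0 : L2 Ω) x * φ x = 0 := by
  rw [← pairing_toLp _ h]
  simp

/-! ### Weak derivatives -/

/-- `∂f/∂x_j = g` in the weak sense in `Ω`. -/
def HasWeakPartial (Ω : Set E3) (j : Fin 3) (f g : L2 Ω) : Prop :=
  ∀ φ : E3 → ℂ, IsTest Ω φ → ∫ x in Ω, f x * pd j φ x = -∫ x in Ω, g x * φ x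

/-- `curl w = c` in the weak sense in `Ω`. -/
def HasWeakCurl (Ω : Set E3) (w c : L2V Ω) : Prop :=
  ∀ Φ : Fin 3 → E3 → ℂ, (∀ i, IsTest Ω (Φ i)) →
    ∑ i, ∫ x in Ω, w i x * curlFun Φ i x = ∑ i, ∫ x in Ω, c i x * Φ i x

/-- `∇ · σ = f` in the weak sense in `Ω`, the divergence being taken row by row,
`(∇ · σ)_i = ∑_j ∂σ_ij/∂x_j`. -/
def HasWeakDiv (Ω : Set E3) (σ : L2M Ω) (f : L2V Ω) : Prop :=
  ∀ Φ : Fin 3 → E3 → ℂ, (∀ i, IsTest Ω (Φ i)) →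
    ∑ i, ∑ j, ∫ x in Ω, σ i j x * pd j (Φ i) x = -∑ i, ∫ x in Ω, f i x * Φ i x

theorem IsTest.sub {Ω : Set E3} {φ ψ : E3 → ℂ} (h : IsTest Ω φ) (k : IsTest Ω ψ) :
    IsTest Ω (fun x => φ x - ψ x) where
  smooth := h.smooth.sub k.smooth
  compact := h.compact.sub k.compact
  support := (tsupport_sub φ ψ).trans (union_subset h.support k.support)

theorem isTest_curlFun {Ω : Set E3} {Φ : Fin 3 → E3 → ℂ} (h : ∀ i, IsTest Ω (Φ i)) (i : Fin 3) :
    IsTest Ω (curlFun Φ i) :=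
  ((h _).pd _).sub ((h _).pd _)

/-! ### `𝐇¹(Ω)`, `H(curl, Ω)` and the tensor fields with square integrable divergence

Each space is given as the space of pairs (field, weak derivative); the weak derivative is
determined by the field, and the norm is the graph norm. -/

/-- `𝐇¹(Ω) = [H¹(Ω)]³`: pairs `(u, ∇u)` with `(∇u)_ij = ∂u_i/∂x_j`, with norm
`(‖u‖² + ∑ ‖∂u_i/∂x_j‖²)^(1/2)`. -/
def H1 (Ω : Set E3) : Submodule ℂ (WithLp 2 (L2V Ω × L2M Ω)) where
  carrier := {p | ∀ i j, HasWeakPartial Ω j (p.fst i) (p.snd i j)}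
  zero_mem' := by
    intro i j φ h
    simp only [WithLp.zero_fst, WithLp.zero_snd, PiLp.zero_apply]
    rw [integral_zero_test h, integral_zero_test (h.pd j), neg_zero]
  add_mem' := by
    intro p q hp hq i j φ h
    have h1 := hp i j φ h
    have h2 := hq i j φ h
    simp only [WithLp.add_fst, WithLp.add_snd, PiLp.add_apply]
    rw [integral_add_test _ _ h, integral_add_test _ _ (h.pd j), h1, h2]
    ring
  smul_mem' := by
    intro c p hp i j φ h
    have h1 := hp i j φ h
    simp only [WithLp.smul_fst, WithLp.smul_snd, PiLp.smul_apply]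
    rw [integral_smul_test _ _ h, integral_smul_test _ _ (h.pd j), h1]
    ring

/-- `H(curl, Ω)`: pairs `(w, curl w)`, with norm `(‖w‖² + ‖curl w‖²)^(1/2)`. -/
def HCurl (Ω : Set E3) : Submodule ℂ (WithLp 2 (L2V Ω × L2V Ω)) where
  carrier := {p | HasWeakCurl Ω p.fst p.snd}
  zero_mem' := by
    intro Φ h
    simp only [WithLp.zero_fst, WithLp.zero_snd, PiLp.zero_apply]
    refine Finset.sum_congr rfl fun i _ => ?_
    rw [integral_zero_test (h i), integral_zero_test (isTest_curlFun h i)]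
  add_mem' := by
    intro p q hp hq Φ h
    have h1 := hp Φ h
    have h2 := hq Φ h
    simp only [WithLp.add_fst, WithLp.add_snd, PiLp.add_apply]
    simp only [fun i => integral_add_test (p.fst i) (q.fst i) (isTest_curlFun h i),
      fun i => integral_add_test (p.snd i) (q.snd i) (h i), Finset.sum_add_distrib, h1, h2]
  smul_mem' := by
    intro c p hp Φ h
    have h1 := hp Φ h
    simp only [WithLp.smul_fst, WithLp.smul_snd, PiLp.smul_apply]
    simp only [fun i => integral_smul_test c (p.fst i) (isTest_curlFun h i),
      fun i => integral_smul_test c (p.snd i) (h i), ← Finset.mul_sum, h1]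

/-- Matrix fields `σ ∈ L²` with `∇ · σ ∈ 𝐋²(Ω)`: pairs `(σ, ∇ · σ)`. -/
def HDiv (Ω : Set E3) : Set (L2M Ω × L2V Ω) := {p | HasWeakDiv Ω p.1 p.2}

namespace H1

variable {Ω : Set E3}

/-- The field `u` itself. -/
def field (u : H1 Ω) : L2V Ω := u.1.fst

/-- The weak gradient, `(∇u)_ij = ∂u_i/∂x_j`. -/
def grad (u : H1 Ω) : L2M Ω := u.1.snd

/-- The curl of a field in `𝐇¹(Ω)`, `(curl u)_i = ∂u_{i+2}/∂x_{i+1} - ∂u_{i+1}/∂x_{i+2}`. -/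
def curl (u : H1 Ω) : L2V Ω :=
  WithLp.toLp 2 fun i => (grad u) (i + 2) (i + 1) - (grad u) (i + 1) (i + 2)

theorem hasWeakCurl (u : H1 Ω) : HasWeakCurl Ω (field u) (curl u) := by
  intro Φ h
  have key : ∀ i j k, ∫ x in Ω, (field u) i x * MaxwellNavier.pd j (Φ k) x
      = -∫ x in Ω, (grad u) i j x * Φ k x := fun i j k => u.2 i j (Φ k) (h k)
  have e1 : ∀ i, ∫ x in Ω, (field u) i x * curlFun Φ i x
      = (∫ x in Ω, (field u) i x * MaxwellNavier.pd (i + 1) (Φ (i + 2)) x)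
        - ∫ x in Ω, (field u) i x * MaxwellNavier.pd (i + 2) (Φ (i + 1)) x := by
    intro i
    rw [← pairing_toLp _ (isTest_curlFun h i), ← pairing_toLp _ ((h (i + 2)).pd (i + 1)),
      ← pairing_toLp _ ((h (i + 1)).pd (i + 2)), ← map_sub]
    rfl
  have e2 : ∀ i, ∫ x in Ω, (curl u) i x * Φ i x
      = (∫ x in Ω, (grad u) (i + 2) (i + 1) x * Φ i x)
        - ∫ x in Ω, (grad u) (i + 1) (i + 2) x * Φ i x := fun i => integral_sub_test _ _ (h i)
  simp only [e1, e2, key, Fin.sum_univ_three]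
  simp only [Fin.isValue, show (0 : Fin 3) + 1 = 1 from rfl, show (0 : Fin 3) + 2 = 2 from rfl,
    show (1 : Fin 3) + 1 = 2 from rfl, show (1 : Fin 3) + 2 = 0 from rfl,
    show (2 : Fin 3) + 1 = 0 from rfl, show (2 : Fin 3) + 2 = 1 from rfl]
  ring

/-- The inclusion `𝐇¹(Ω) ⊆ H(curl, Ω)`. -/
def toHCurl (u : H1 Ω) : HCurl Ω := ⟨WithLp.toLp 2 (field u, curl u), hasWeakCurl u⟩

end H1

namespace HCurl

variable {Ω : Set E3}

/-- The field `w` itself. -/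
def field (w : HCurl Ω) : L2V Ω := w.1.fst

/-- The weak curl. -/
def curl (w : HCurl Ω) : L2V Ω := w.1.snd

end HCurl

/-! ### Trace spaces -/

/-- `𝐇¹_0(Ω)`, the closure of `[C_c^∞(Ω)]³` in `𝐇¹(Ω)`; for a bounded Lipschitz domain this is the
kernel of the trace. -/
def H10 (Ω : Set E3) : Submodule ℂ (H1 Ω) :=
  (Submodule.span ℂ {u : H1 Ω | ∃ Φ : Fin 3 → E3 → ℂ, (∀ i, IsTest Ω (Φ i)) ∧
    (∀ i, H1.field u i =ᵐ[volume.restrict Ω] Φ i) ∧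
    ∀ i j, H1.grad u i j =ᵐ[volume.restrict Ω] pd j (Φ i)}).topologicalClosure

/-- `𝐇^{1/2}(∂Ω)`, the space of traces of fields in `𝐇¹(Ω)`, with norm
`‖g‖ = inf {‖u‖_{𝐇¹(Ω)} : u has trace g}`. -/
abbrev HHalf (Ω : Set E3) : Type := H1 Ω ⧸ H10 Ω

/-- The trace operator `𝐇¹(Ω) → 𝐇^{1/2}(∂Ω)`. -/
def trace (Ω : Set E3) : H1 Ω →L[ℂ] HHalf Ω := (H10 Ω).mkQL

/-- `𝐇^{-1/2}(∂Ω)`, the dual space of `𝐇^{1/2}(∂Ω)` with the dual norm; the duality is bilinear. -/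
abbrev HNegHalf (Ω : Set E3) : Type := StrongDual ℂ (HHalf Ω)

/-- A continuous functional on `𝐇¹(Ω)` that vanishes on `[C_c^∞(Ω)]³` is a functional of the
trace. -/
theorem H10_le_ker {Ω : Set E3} (F : H1 Ω →L[ℂ] ℂ)
    (hF : ∀ (u : H1 Ω) (Φ : Fin 3 → E3 → ℂ), (∀ i, IsTest Ω (Φ i)) →
      (∀ i, H1.field u i =ᵐ[volume.restrict Ω] Φ i) →
      (∀ i j, H1.grad u i j =ᵐ[volume.restrict Ω] pd j (Φ i)) → F u = 0) :
    H10 Ω ≤ F.ker := by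
  refine Submodule.topologicalClosure_minimal _ (Submodule.span_le.2 ?_) F.isClosed_ker
  rintro u ⟨Φ, h1, h2, h3⟩
  exact hF u Φ h1 h2 h3

/-- `u ↦ u_i` as a continuous linear map. -/
def fieldL (Ω : Set E3) (i : Fin 3) : H1 Ω →L[ℂ] L2 Ω :=
  (PiLp.proj 2 (fun _ : Fin 3 => L2 Ω) i).comp
    ((WithLp.fstL 2 ℂ (L2V Ω) (L2M Ω)).comp (H1 Ω).subtypeL)

/-- `u ↦ ∂u_i/∂x_j` as a continuous linear map. -/
def gradL (Ω : Set E3) (i j : Fin 3) : H1 Ω →L[ℂ] L2 Ω :=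
  (PiLp.proj 2 (fun _ : Fin 3 => L2 Ω) j).comp
    ((PiLp.proj 2 (fun _ : Fin 3 => L2V Ω) i).comp
      ((WithLp.sndL 2 ℂ (L2V Ω) (L2M Ω)).comp (H1 Ω).subtypeL))

/-- `u ↦ (curl u)_i` as a continuous linear map. -/
def curlL (Ω : Set E3) (i : Fin 3) : H1 Ω →L[ℂ] L2 Ω :=
  gradL Ω (i + 2) (i + 1) - gradL Ω (i + 1) (i + 2)

/-- The functional `v ↦ ∫_Ω (curl w · v - w · curl v) dx` on `𝐇¹(Ω)`. -/
def tangentialFunctional {Ω : Set E3} (w : HCurl Ω) : H1 Ω →L[ℂ] ℂ :=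
  ∑ i, ((pairing Ω (HCurl.curl w i)).comp (fieldL Ω i)
    - (pairing Ω (HCurl.field w i)).comp (curlL Ω i))

theorem tangentialFunctional_apply {Ω : Set E3} (w : HCurl Ω) (v : H1 Ω) :
    tangentialFunctional w v = ∑ i, ((∫ x in Ω, HCurl.curl w i x * H1.field v i x)
      - ∫ x in Ω, HCurl.field w i x * H1.curl v i x) := by
  simp only [← pairing_eq, tangentialFunctional, sum_apply]
  rfl

/-- The functional `v ↦ ∫_Ω (σ : ∇v + (∇ · σ) · v) dx` on `𝐇¹(Ω)`. -/
def normalFunctional {Ω : Set E3} (S : HDiv Ω) : H1 Ω →L[ℂ] ℂ :=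
  (∑ i, ∑ j, (pairing Ω (S.1.1 i j)).comp (gradL Ω i j))
    + ∑ i, (pairing Ω (S.1.2 i)).comp (fieldL Ω i)

theorem normalFunctional_apply {Ω : Set E3} (S : HDiv Ω) (v : H1 Ω) :
    normalFunctional S v = (∑ i, ∑ j, ∫ x in Ω, S.1.1 i j x * H1.grad v i j x)
      + ∑ i, ∫ x in Ω, S.1.2 i x * H1.field v i x := by
  simp only [← pairing_eq, normalFunctional, add_apply,
    sum_apply]
  rfl

theorem H10_le_ker_tangential {Ω : Set E3} (w : HCurl Ω) :
    H10 Ω ≤ (tangentialFunctional w).ker := by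
  refine H10_le_ker _ fun v Φ h h1 h2 => ?_
  rw [tangentialFunctional_apply, Finset.sum_sub_distrib, sub_eq_zero]
  have e1 : ∀ i, ∫ x in Ω, HCurl.curl w i x * H1.field v i x
      = ∫ x in Ω, HCurl.curl w i x * Φ i x := by
    intro i
    refine integral_congr_ae ?_
    filter_upwards [h1 i] with x hx
    rw [hx]
  have e2 : ∀ i, ∫ x in Ω, HCurl.field w i x * H1.curl v i x
      = ∫ x in Ω, HCurl.field w i x * curlFun Φ i x := by
    intro i
    refine integral_congr_ae ?_
    have h3 : H1.curl v i =ᵐ[volume.restrict Ω]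
        ⇑(H1.grad v (i + 2) (i + 1)) - ⇑(H1.grad v (i + 1) (i + 2)) := Lp.coeFn_sub _ _
    filter_upwards [h2 (i + 2) (i + 1), h2 (i + 1) (i + 2), h3] with x hx hy hz
    rw [hz, Pi.sub_apply, hx, hy, curlFun]
  simp only [e1, e2]
  exact (w.2 Φ h).symm

theorem H10_le_ker_normal {Ω : Set E3} (S : HDiv Ω) :
    H10 Ω ≤ (normalFunctional S).ker := by
  refine H10_le_ker _ fun v Φ h h1 h2 => ?_
  rw [normalFunctional_apply]
  have e1 : ∀ i, ∫ x in Ω, S.1.2 i x * H1.field v i x = ∫ x in Ω, S.1.2 i x * Φ i x := by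
    intro i
    refine integral_congr_ae ?_
    filter_upwards [h1 i] with x hx
    rw [hx]
  have e2 : ∀ i j, ∫ x in Ω, S.1.1 i j x * H1.grad v i j x
      = ∫ x in Ω, S.1.1 i j x * pd j (Φ i) x := by
    intro i j
    refine integral_congr_ae ?_
    filter_upwards [h2 i j] with x hx
    rw [hx]
  simp only [e1, e2]
  rw [S.2 Φ h, neg_add_cancel]

/-- The tangential trace `γ_t w = ν × w ∈ 𝐇^{-1/2}(∂Ω)` of `w ∈ H(curl, Ω)`, given by Green's formula
`⟨ν × w, v⟩ = ∫_Ω (curl w · v - w · curl v) dx` for `v ∈ 𝐇¹(Ω)`. -/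
def tangentialTrace {Ω : Set E3} (w : HCurl Ω) : HNegHalf Ω :=
  (H10 Ω).liftQL (tangentialFunctional w) (H10_le_ker_tangential w)

/-- The normal trace `σ ν ∈ 𝐇^{-1/2}(∂Ω)` of a matrix field with divergence in `𝐋²(Ω)`, given by
Green's formula `⟨σ ν, v⟩ = ∫_Ω (σ : ∇v + (∇ · σ) · v) dx` for `v ∈ 𝐇¹(Ω)`. -/
def normalTrace {Ω : Set E3} (S : HDiv Ω) : HNegHalf Ω :=
  (H10 Ω).liftQL (normalFunctional S) (H10_le_ker_normal S)

theorem tangentialTrace_apply {Ω : Set E3} (w : HCurl Ω) (v : H1 Ω) :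
    tangentialTrace w (trace Ω v) = ∑ i, ((∫ x in Ω, HCurl.curl w i x * H1.field v i x)
      - ∫ x in Ω, HCurl.field w i x * H1.curl v i x) :=
  tangentialFunctional_apply w v

theorem normalTrace_apply {Ω : Set E3} (S : HDiv Ω) (v : H1 Ω) :
    normalTrace S (trace Ω v) = (∑ i, ∑ j, ∫ x in Ω, S.1.1 i j x * H1.grad v i j x)
      + ∑ i, ∫ x in Ω, S.1.2 i x * H1.field v i x :=
  normalFunctional_apply S v

/-- `H^{-1/2}_Div(∂Ω)`, the tangential trace space of `H(curl, Ω)`, as a subset of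
`𝐇^{-1/2}(∂Ω)`. -/
def HNegHalfDiv (Ω : Set E3) : Set (HNegHalf Ω) := Set.range tangentialTrace

/-- The norm of `H^{-1/2}_Div(∂Ω)`: `‖h‖ = inf {‖w‖_{H(curl, Ω)} : ν × w = h}`. -/
def normDiv {Ω : Set E3} (h : HNegHalf Ω) : ℝ :=
  sInf {r : ℝ | ∃ w : HCurl Ω, tangentialTrace w = h ∧ ‖w‖ = r}

/-! ### The elastic tensor -/

/-- A fourth order tensor field `Ĉ = (Ĉ_ijkl)` with real entries in `L^∞(Ω)`. -/
abbrev Tensor4 (Ω : Set E3) : Type :=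
  Fin 3 → Fin 3 → Fin 3 → Fin 3 → Lp ℝ ∞ (volume.restrict Ω)

/-- The symmetry condition `C_ijkl = C_klij = C_jikl = C_ijlk`. -/
def IsSymmetric {Ω : Set E3} (C : Tensor4 Ω) : Prop :=
  ∀ i j k l, C i j k l = C k l i j ∧ C i j k l = C j i k l ∧ C i j k l = C i j l k

/-- The Legendre ellipticity condition, uniformly on `Ω` and for symmetric matrices only. -/
def IsLegendreElliptic {Ω : Set E3} (C : Tensor4 Ω) : Prop :=
  ∃ c₀ : ℝ, 0 < c₀ ∧ ∀ᵐ x ∂(volume.restrict Ω), ∀ a : Fin 3 → Fin 3 → ℝ, (∀ i j, a i j = a j i) →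
    c₀ * ∑ i, ∑ j, |a i j| ^ 2 ≤ ∑ i, ∑ j, ∑ k, ∑ l, C i j k l x * a i j * a k l

/-- The stress `C : ∇u`, `(C : ∇u)_ij = ∑_{k,l} C_ijkl ∂u_k/∂x_l`. -/
def stress {Ω : Set E3} (C : Tensor4 Ω) (u : H1 Ω) : L2M Ω :=
  WithLp.toLp 2 fun i => WithLp.toLp 2 fun j =>
    ∑ k, ∑ l, (C i j k l • H1.grad u k l : L2 Ω)

/-! ### The boundary value problem -/

/-- `(H, u)` solves
`curl curl H + H = ξ₁` and `∇ · (C : ∇u) - u = ξ₂` in `Ω`,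
`T u - b₁ ν × H = h₁` and `ν × curl H + (iκ / b₂) ν × u = h₂` on `∂Ω`,
with `T u = (C : ∇u) ν`.

The differential equations hold in the weak sense. By them `curl H ∈ H(curl, Ω)` and `C : ∇u` has its
divergence in `𝐋²(Ω)`; these are `E` and `S`, and the boundary conditions hold in
`𝐇^{-1/2}(∂Ω)`. -/
def IsSolution {Ω : Set E3} (C : Tensor4 Ω) (κ : ℝ) (b₁ b₂ : ℂ) (ξ₁ ξ₂ : L2V Ω)
    (h₁ h₂ : HNegHalf Ω) (H : HCurl Ω) (u : H1 Ω) : Prop :=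
  ∃ (E : HCurl Ω) (S : HDiv Ω),
    HCurl.field E = HCurl.curl H ∧ S.1.1 = stress C u ∧
    HCurl.curl E + HCurl.field H = ξ₁ ∧
    S.1.2 - H1.field u = ξ₂ ∧
    normalTrace S - b₁ • tangentialTrace H = h₁ ∧
    tangentialTrace E + (Complex.I * κ / b₂) • tangentialTrace (H1.toHCurl u) = h₂

end MaxwellNavier

end

open MaxwellNavier

noncomputable section

namespace MaxwellNavier

open scoped FourierTransform SchwartzMap

/-! The problem is equivalent to a variational equation on `H(curl, Ω) × 𝐇¹(Ω)` that is coercive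
outright, so Lax–Milgram suffices and no compactness or Fredholm argument enters. Green's formulas
turn the system into a magnetic and an elastic identity, coupled only through the boundary terms
with coefficients `β = iκ/b₂` and `b₁`. Multiply the magnetic identity by `a = -i conj(b₁) b₂ / κ`,
add the elastic one, and test with the complex conjugate of the solution. Since `a β = conj b₁`, the
coupling terms become `conj (b₁ X) - b₁ X`, which is purely imaginary. The real part that remains is
`Re a ‖H‖²` plus the elastic energy plus `‖u‖²`, and `Re a = -Im(b₁ conj b₂)/κ > 0` is exactly the
sign hypothesis (`re_coupledForm_conj`). The elastic energy controls only the symmetrized gradient,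
so coercivity needs Korn's second inequality (`IsBoundedLipschitzDomain.korn`).

Korn's inequality is proved by mollification. Near each point of the closure, a cone condition gives
a kernel `k` such that convolution with its contractions `k_s` uses only values inside `Ω`. The
difference `k_a - k_b` is the divergence of an explicit compactly supported field `Φ`. The identity
`2 ∂_l ∂_j u_i = ∂_l ε_ij + ∂_j ε_li - ∂_i ε_lj`, with `ε_ij = ∂_j u_i + ∂_i u_j` and the outer
derivatives moved onto `Φ_l`, writes the mollified gradient through the strain, up to a smoothing of
`u` at the fixed scale `b`. The operators `f ↦ f * ∂_m Φ_l` are bounded on `L²` uniformly in `a`,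
because `|ξ| |Φ̂_l(ξ)|` is bounded independently of `a`. Letting `a → -∞` gives the local estimate;
a finite cover of the compact closure makes it global.

The boundary condition for `curl H` is tested only against `𝐇¹(Ω)`, whereas coercivity needs test
fields in `H(curl, Ω)`. Density of the former space in the latter
(`IsBoundedLipschitzDomain.denseRange_toHCurl`) closes this gap; the same inward kernels prove it
after a partition of unity. The datum `h₂` enters through any lift `w` with `ν × w = h₂`, and the
infimum over lifts yields its norm. -/

/-! ### Convolution on `L²(ℝ³)` -/

/-- The convolution `∫ g(y) k(x - y) dy`. -/
def conv (g k : E3 → ℂ) (x : E3) : ℂ := ∫ y, g y * k (x - y)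

/-- By Plancherel, convolution is multiplication by `𝓕 k` on the Fourier side. -/
theorem eLpNorm_conv_schwartz_le (g k : 𝓢(E3, ℂ)) {M : ℝ} (hM : ∀ ξ, ‖𝓕 k ξ‖ ≤ M) :
    eLpNorm (conv g k) 2 volume ≤ ENNReal.ofReal M * eLpNorm g 2 volume := by
  have key : ∀ s : 𝓢(E3, ℂ), eLpNorm (𝓕 s : 𝓢(E3, ℂ)) 2 volume = eLpNorm s 2 volume := by
    intro s
    have h := SchwartzMap.norm_fourier_toL2_eq s
    rw [SchwartzMap.norm_toLp, SchwartzMap.norm_toLp] at h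
    exact (ENNReal.toReal_eq_toReal_iff' ((𝓕 s).memLp 2 volume).2.ne (s.memLp 2 volume).2.ne).1 h
  have h1 : conv g k = SchwartzMap.convolution (ContinuousLinearMap.mul ℂ ℂ) g k := by
    ext x
    rw [SchwartzMap.convolution_apply]
    rfl
  rw [h1, ← key, ← key g]
  refine eLpNorm_le_mul_eLpNorm_of_ae_le_mul (ae_of_all _ fun ξ => ?_) 2
  rw [SchwartzMap.fourier_convolution, SchwartzMap.pairing_apply_apply]
  simp only [ContinuousLinearMap.mul_apply', norm_mul]
  rw [mul_comm]
  exact mul_le_mul_of_nonneg_right (hM ξ) (norm_nonneg _)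

/-- Convolution with a Schwartz kernel is bounded on `L²` by the supremum of the Fourier transform
of the kernel. -/
theorem eLpNorm_conv_le {g : E3 → ℂ} (hg : MemLp g 2 volume) (k : 𝓢(E3, ℂ)) {M : ℝ}
    (hM : ∀ ξ, ‖𝓕 k ξ‖ ≤ M) :
    eLpNorm (conv g k) 2 volume ≤ ENNReal.ofReal M * eLpNorm g 2 volume := by
  obtain ⟨s, hs⟩ : ∃ s : ℕ → 𝓢(E3, ℂ), Tendsto (fun n => (s n).toLp 2 volume) atTop (𝓝 hg.toLp) := by
    have hd := SchwartzMap.denseRange_toLpCLM (E := E3) (F := ℂ) (μ := volume)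
      (p := 2) ENNReal.ofNat_ne_top
    obtain ⟨f, hf, hlim⟩ := mem_closure_iff_seq_limit.1 (hd (hg.toLp))
    choose s hs using hf
    refine ⟨s, ?_⟩
    have : (fun n => (s n).toLp 2 volume) = f := funext fun n => hs n
    rwa [this]
  have hkx : ∀ x, MemLp (fun y => k (x - y)) 2 volume := fun x =>
    (k.memLp 2 volume).comp_measurePreserving (Measure.measurePreserving_sub_left volume x)
  have hP : ∀ (f : E3 → ℂ) (hf : MemLp f 2 volume) x, conv f k x
      = (ContinuousLinearMap.mul ℂ ℂ).lpPairing volume 2 2 hf.toLp (hkx x).toLp := by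
    intro f hf x
    rw [ContinuousLinearMap.lpPairing_eq_integral]
    refine integral_congr_ae ?_
    filter_upwards [hf.coeFn_toLp, (hkx x).coeFn_toLp] with y h1 h2
    simp [h1, h2]
  -- For fixed `x` the convolution pairs its first factor with a fixed `L²` function, so `L²`
  -- convergence of `s n` gives pointwise convergence. Fatou's lemma then passes the Schwartz bound
  -- to the limit.
  have hlim : ∀ x, Tendsto (fun n => conv (s n) k x) atTop (𝓝 (conv g k x)) := by
    intro x
    rw [hP g hg x]
    have h2 := ((((ContinuousLinearMap.mul ℂ ℂ).lpPairing (volume : Measure E3) 2 2).flip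
      (hkx x).toLp).continuous.tendsto hg.toLp).comp hs
    refine h2.congr fun n => ?_
    rw [hP (s n) ((s n).memLp 2 volume) x]
    rfl
  have hmeas : ∀ n, AEStronglyMeasurable (conv (s n) k) volume := by
    intro n
    have h1 : conv (s n) k = SchwartzMap.convolution (ContinuousLinearMap.mul ℂ ℂ) (s n) k := by
      ext x
      rw [SchwartzMap.convolution_apply]
      rfl
    rw [h1]
    exact (SchwartzMap.continuous _).aestronglyMeasurable
  refine (Lp.eLpNorm_lim_le_liminf_eLpNorm hmeas _ (ae_of_all _ hlim)).trans ?_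
  have hn : Tendsto (fun n => eLpNorm (s n) 2 volume) atTop (𝓝 (eLpNorm g 2 volume)) := by
    have h1 := (continuous_enorm.tendsto hg.toLp).comp hs
    rw [Lp.enorm_toLp] at h1
    refine h1.congr fun n => ?_
    simp only [Function.comp]
    exact Lp.enorm_toLp _
  have h4 : Tendsto (fun n => ENNReal.ofReal M * eLpNorm (s n) 2 volume) atTop
      (𝓝 (ENNReal.ofReal M * eLpNorm g 2 volume)) :=
    ENNReal.Tendsto.const_mul hn (Or.inr ENNReal.ofReal_ne_top)
  rw [← h4.liminf_eq]
  exact liminf_le_liminf (Eventually.of_forall fun n => eLpNorm_conv_schwartz_le (s n) k hM)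

theorem norm_fourier_le_integral (k : 𝓢(E3, ℂ)) (ξ : E3) : ‖𝓕 k ξ‖ ≤ ∫ x, ‖k x‖ := by
  rw [SchwartzMap.fourier_coe]
  exact VectorFourier.norm_fourierIntegral_le_integral_norm Real.fourierChar volume (innerₗ E3) k ξ

/-- Young's inequality for a smooth compactly supported kernel. -/
theorem eLpNorm_conv_le_integral {g k : E3 → ℂ} (hg : MemLp g 2 volume)
    (hk : ContDiff ℝ ∞ k) (hc : HasCompactSupport k) :
    eLpNorm (conv g k) 2 volume ≤ ENNReal.ofReal (∫ x, ‖k x‖) * eLpNorm g 2 volume :=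
  eLpNorm_conv_le hg (hc.toSchwartzMap hk) (norm_fourier_le_integral _)

theorem contDiff_conv {g k : E3 → ℂ} (hg : MemLp g 2 volume)
    (hk : ContDiff ℝ ∞ k) (hc : HasCompactSupport k) : ContDiff ℝ ∞ (conv g k) := by
  change ContDiff ℝ ∞ (convolution g k (ContinuousLinearMap.mul ℝ ℂ) volume)
  exact hc.contDiff_convolution_right _ (hg.locallyIntegrable (by norm_num)) hk

theorem pd_conv {g k : E3 → ℂ} (hg : MemLp g 2 volume)
    (hk : ContDiff ℝ ∞ k) (hc : HasCompactSupport k) (j : Fin 3) :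
    pd j (conv g k) = conv g (pd j k) := by
  ext x
  have h := hc.hasFDerivAt_convolution_right (ContinuousLinearMap.mul ℝ ℂ)
    (hg.locallyIntegrable (by norm_num)) (hk.of_le (by simp)) x
  have h' : HasFDerivAt (conv g k) _ x := h
  rw [pd, h'.fderiv, convolution_precompR_apply]
  · rfl
  · exact hg.locallyIntegrable (by norm_num)
  · exact hc.fderiv ℝ
  · exact (hk.continuous_fderiv (by simp))

/-! ### Dilations and approximate identities -/

/-- The dilation `e^{-3s} k(e^{-s} z)` of a kernel, which preserves its integral. -/
def dil (s : ℝ) (k : E3 → ℂ) (z : E3) : ℂ := (Real.exp (-s) ^ 3 : ℝ) * k (Real.exp (-s) • z)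

theorem contDiff_dil {k : E3 → ℂ} (hk : ContDiff ℝ ∞ k) (s : ℝ) : ContDiff ℝ ∞ (dil s k) :=
  contDiff_const.mul (hk.comp (contDiff_const_smul _))

theorem hasCompactSupport_dil {k : E3 → ℂ} (hk : HasCompactSupport k) (s : ℝ) :
    HasCompactSupport (dil s k) :=
  (hk.comp_smul (Real.exp_pos (-s)).ne').mul_left

theorem integral_dil (s : ℝ) (k : E3 → ℂ) : ∫ z, dil s k z = ∫ z, k z := by
  simp only [dil]
  rw [integral_const_mul, Measure.integral_comp_smul]
  have h : (0 : ℝ) < Real.exp (-s) ^ 3 := by positivity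
  simp only [finrank_euclideanSpace, Fintype.card_fin]
  rw [abs_of_pos (inv_pos.2 h), Complex.real_smul, ← mul_assoc, ← Complex.ofReal_mul,
    mul_inv_cancel₀ h.ne', Complex.ofReal_one, one_mul]

theorem integral_norm_dil (s : ℝ) (k : E3 → ℂ) : ∫ z, ‖dil s k z‖ = ∫ z, ‖k z‖ := by
  simp only [dil, norm_mul, Complex.norm_real]
  rw [integral_const_mul, Measure.integral_comp_smul volume (fun z => ‖k z‖)]
  have h : (0 : ℝ) < Real.exp (-s) ^ 3 := by positivity
  simp only [finrank_euclideanSpace, Fintype.card_fin]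
  rw [abs_of_pos (inv_pos.2 h), Real.norm_of_nonneg h.le, smul_eq_mul, ← mul_assoc,
    mul_inv_cancel₀ h.ne', one_mul]

/-- A smooth compactly supported kernel, nonnegative and of integral one. -/
structure IsMollifier (k : E3 → ℂ) : Prop where
  smooth : ContDiff ℝ ∞ k
  compact : HasCompactSupport k
  integral : ∫ z, k z = 1
  integral_norm : ∫ z, ‖k z‖ = 1

theorem integrable_mul_sub_left {g k : E3 → ℂ} (hg : MemLp g 2 volume) (hk : Continuous k)
    (hc : HasCompactSupport k) (x : E3) : Integrable fun y => g y * k (x - y) := by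
  have h := (hk.memLp_of_hasCompactSupport (p := 2) (μ := volume) hc).comp_measurePreserving
    (Measure.measurePreserving_sub_left volume x)
  exact hg.integrable_mul h

theorem norm_conv_sub_le {h k : E3 → ℂ} (hk : IsMollifier k) (hh : Continuous h)
    (hhc : HasCompactSupport h) {R η : ℝ} (hR : ∀ z, k z ≠ 0 → ‖z‖ ≤ R)
    (hη : ∀ x y, dist x y ≤ R → dist (h x) (h y) ≤ η) (x : E3) : ‖conv h k x - h x‖ ≤ η := by
  have e1 : conv h k x = ∫ z, h (x - z) * k z := by
    rw [conv, ← integral_sub_left_eq_self _ volume x]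
    simp
  have hki : Integrable k := hk.smooth.continuous.integrable_of_hasCompactSupport hk.compact
  have i1 : Integrable fun z => h (x - z) * k z := by
    have := integrable_mul_sub_left
      (hk.smooth.continuous.memLp_of_hasCompactSupport (p := 2) (μ := volume) hk.compact) hh hhc x
    simpa only [mul_comm] using this
  have e2 : h x = ∫ z, h x * k z := by rw [integral_const_mul, hk.integral, mul_one]
  rw [e1, e2, ← integral_sub i1 (hki.const_mul _)]
  calc ‖∫ z, (h (x - z) * k z - h x * k z)‖ ≤ ∫ z, η * ‖k z‖ := by
        refine norm_integral_le_of_norm_le (hki.norm.const_mul _) (ae_of_all _ fun z => ?_)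
        rw [← sub_mul, norm_mul]
        rcases eq_or_ne (k z) 0 with hz | hz
        · simp [hz]
        · refine mul_le_mul_of_nonneg_right ?_ (norm_nonneg _)
          rw [← dist_eq_norm]
          exact hη _ _ (by simpa [dist_eq_norm] using hR z hz)
    _ = η := by rw [integral_const_mul, hk.integral_norm, mul_one]

theorem IsMollifier.dil {k : E3 → ℂ} (hk : IsMollifier k) (s : ℝ) : IsMollifier (dil s k) where
  smooth := contDiff_dil hk.smooth s
  compact := hasCompactSupport_dil hk.compact s
  integral := by rw [integral_dil, hk.integral]
  integral_norm := by rw [integral_norm_dil, hk.integral_norm]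

theorem norm_le_of_dil_ne_zero {k : E3 → ℂ} {R : ℝ} (hR : ∀ z, k z ≠ 0 → ‖z‖ ≤ R) (s : ℝ) (z : E3)
    (hz : dil s k z ≠ 0) : ‖z‖ ≤ Real.exp s * R := by
  have h1 := hR _ (right_ne_zero_of_mul hz)
  rw [norm_smul, Real.norm_of_nonneg (Real.exp_pos _).le, Real.exp_neg] at h1
  rwa [inv_mul_le_iff₀ (Real.exp_pos s)] at h1

/-- As `s → -∞` the kernels shrink to the origin. Uniform continuity makes the error uniformly
small, and for `s ≤ 0` it vanishes outside one fixed ball, so the uniform bound becomes an `L²`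
bound. -/
theorem tendsto_conv_dil_of_continuous {h k : E3 → ℂ} (hk : IsMollifier k) (hh : Continuous h)
    (hhc : HasCompactSupport h) :
    Tendsto (fun s => eLpNorm (fun x => conv h (dil s k) x - h x) 2 volume) atBot (𝓝 0) := by
  obtain ⟨R, hR0, hR⟩ : ∃ R, 0 < R ∧ ∀ z, k z ≠ 0 → ‖z‖ ≤ R := by
    obtain ⟨R, hR, h⟩ := hk.compact.isCompact.isBounded.exists_pos_norm_le
    exact ⟨R, hR, fun z hz => h z (subset_tsupport _ hz)⟩
  obtain ⟨ρ, hρ0, hρ⟩ : ∃ R, 0 < R ∧ ∀ z, h z ≠ 0 → ‖z‖ ≤ R := by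
    obtain ⟨R, hR, h'⟩ := hhc.isCompact.isBounded.exists_pos_norm_le
    exact ⟨R, hR, fun z hz => h' z (subset_tsupport _ hz)⟩
  have huc : UniformContinuous h := hhc.uniformContinuous_of_continuous hh
  set B : Set E3 := Metric.closedBall 0 (ρ + R) with hB
  have hBfin : volume B ≠ ⊤ := (isCompact_closedBall _ _).measure_lt_top.ne
  have hzero : ∀ s ≤ 0, ∀ x ∉ B, conv h (dil s k) x - h x = 0 := by
    intro s hs x hx
    have hx' : ρ + R < ‖x‖ := by simpa [hB] using hx
    have h1 : h x = 0 := by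
      by_contra hne
      linarith [hρ x hne]
    have h2 : conv h (dil s k) x = 0 := by
      refine integral_eq_zero_of_ae (ae_of_all _ fun y => ?_)
      by_contra hne
      have ha := hρ y (left_ne_zero_of_mul hne)
      have hb := norm_le_of_dil_ne_zero hR s _ (right_ne_zero_of_mul hne)
      have hc : Real.exp s * R ≤ 1 * R :=
        mul_le_mul_of_nonneg_right (Real.exp_le_one_iff.2 hs) hR0.le
      have hd : ‖x‖ ≤ ‖x - y‖ + ‖y‖ := by simpa using norm_add_le (x - y) y
      linarith
    rw [h1, h2, sub_zero]
  have hbound : ∀ η : ℝ≥0, 0 < η → ∀ᶠ s in atBot,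
      eLpNorm (fun x => conv h (dil s k) x - h x) 2 volume
        ≤ volume B ^ (1 / (2 : ℝ≥0∞).toReal) * η := by
    intro η hη
    obtain ⟨δ, hδ, hd⟩ := Metric.uniformContinuous_iff.1 huc η hη
    have hlim : Tendsto (fun s => Real.exp s * R) atBot (𝓝 0) := by
      simpa using Real.tendsto_exp_atBot.mul_const R
    filter_upwards [hlim.eventually_lt_const hδ, eventually_le_atBot 0] with s hs hs0
    rw [← eLpNorm_restrict_eq_of_support_subset (s := B)]
    · refine (eLpNorm_le_of_ae_bound (C := η) (ae_of_all _ fun x => ?_)).trans ?_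
      · refine norm_conv_sub_le (hk.dil s) hh hhc (norm_le_of_dil_ne_zero hR s) ?_ x
        intro x y hxy
        exact (hd (hxy.trans_lt hs)).le
      · rw [Measure.restrict_apply_univ, one_div, ENNReal.ofReal_coe_nnreal]
    · intro x hx
      by_contra hxB
      exact hx (hzero s hs0 x hxB)
  set V := volume B ^ (1 / (2 : ℝ≥0∞).toReal) with hV
  have hVfin : V ≠ ⊤ := ENNReal.rpow_ne_top_of_nonneg (by positivity) hBfin
  rw [ENNReal.tendsto_nhds_zero]
  intro ε hε
  rcases eq_or_ne ε ⊤ with rfl | hεt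
  · simp
  obtain ⟨η, hη, hηε⟩ : ∃ η : ℝ≥0, 0 < η ∧ V * η ≤ ε := by
    have h0 : ε / (V + 1) ≠ 0 := (ENNReal.div_pos hε.ne' (by simp [hVfin])).ne'
    obtain ⟨η, hη, hlt⟩ := ENNReal.lt_iff_exists_nnreal_btwn.1 (pos_iff_ne_zero.2 h0)
    refine ⟨η, by exact_mod_cast hη, ?_⟩
    calc V * η ≤ (V + 1) * (ε / (V + 1)) := by
          gcongr
          exact le_self_add
      _ ≤ ε := ENNReal.mul_div_le
  filter_upwards [hbound η hη] with s hs using hs.trans hηε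

/-- Mollification converges in `L²`. -/
theorem tendsto_conv_dil {g k : E3 → ℂ} (hk : IsMollifier k) (hg : MemLp g 2 volume) :
    Tendsto (fun s => eLpNorm (fun x => conv g (dil s k) x - g x) 2 volume) atBot (𝓝 0) := by
  rw [ENNReal.tendsto_nhds_zero]
  intro ε hε
  obtain ⟨δ, hδ, hδε⟩ := ENNReal.exists_pos_sum_of_countable' hε.ne' (Fin 3)
  have hδ' : δ 0 + δ 1 + δ 2 ≤ ε := by
    rw [tsum_fintype, Fin.sum_univ_three] at hδε
    exact hδε.le
  set d := min (δ 0) (δ 2) with hd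
  have hd0 : d ≠ 0 := (lt_min (hδ 0) (hδ 2)).ne'
  obtain ⟨h, hhc, hle, hh, hhm⟩ := hg.exists_hasCompactSupport_eLpNorm_sub_le (by simp) hd0
  have hmid := (ENNReal.tendsto_nhds_zero.1 (tendsto_conv_dil_of_continuous hk hh hhc)) _ (hδ 1)
  filter_upwards [hmid] with s hs
  have hks := hk.dil s
  -- Three-part splitting. The approximation `h` is within both `δ 0` and `δ 2`, since `g - h`
  -- appears once mollified, at no cost in norm, and once as it stands.
  have e : (fun x => conv g (dil s k) x - g x) = (fun x => conv (g - h) (dil s k) x)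
      + (fun x => conv h (dil s k) x - h x) + (h - g) := by
    ext x
    have : conv (g - h) (dil s k) x = conv g (dil s k) x - conv h (dil s k) x := by
      simp only [conv, Pi.sub_apply, sub_mul]
      exact integral_sub
        (integrable_mul_sub_left hg hks.smooth.continuous hks.compact x)
        (integrable_mul_sub_left hhm hks.smooth.continuous hks.compact x)
    simp only [Pi.add_apply, Pi.sub_apply, this]
    ring
  have m1 : AEStronglyMeasurable (fun x => conv (g - h) (dil s k) x) volume :=
    (contDiff_conv (hg.sub hhm) hks.smooth hks.compact).continuous.aestronglyMeasurable
  have m2 : AEStronglyMeasurable (fun x => conv h (dil s k) x - h x) volume :=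
    ((contDiff_conv hhm hks.smooth hks.compact).continuous.sub hh).aestronglyMeasurable
  rw [e]
  refine (eLpNorm_add_le (m1.add m2) (hhm.1.sub hg.1) (by norm_num)).trans ?_
  refine (add_le_add_left (eLpNorm_add_le m1 m2 (by norm_num)) _).trans ?_
  refine le_trans (add_le_add (add_le_add ?_ hs) ?_) hδ'
  · refine (eLpNorm_conv_le_integral (hg.sub hhm) hks.smooth hks.compact).trans ?_
    rw [hks.integral_norm, ENNReal.ofReal_one, one_mul]
    exact hle.trans (min_le_left _ _)
  · rw [eLpNorm_sub_comm]
    exact hle.trans (min_le_right _ _)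

/-- A mollifier supported in a given ball. -/
theorem exists_isMollifier (p : E3) {r : ℝ} (hr : 0 < r) :
    ∃ k, IsMollifier k ∧ tsupport k ⊆ Metric.closedBall p r := by
  let f : ContDiffBump p := ⟨r / 2, r, by linarith, by linarith⟩
  refine ⟨fun z => (f.normed volume z : ℂ), ⟨?_, ?_, ?_, ?_⟩, ?_⟩
  · exact Complex.ofRealCLM.contDiff.comp f.contDiff_normed
  · exact f.hasCompactSupport_normed.comp_left Complex.ofReal_zero
  · rw [integral_complex_ofReal, f.integral_normed, Complex.ofReal_one]
  · simp only [Complex.norm_real, Real.norm_of_nonneg (f.nonneg_normed _)]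
    exact f.integral_normed
  · refine (closure_mono ?_).trans (f.tsupport_normed_eq (μ := volume)).subset
    intro z hz
    simpa using hz

/-! ### Integrals depending smoothly on a parameter -/

/-- The integral is the value at `0` of a convolution in `t` of an interval indicator with the
reflected integrand, which reduces the claim to smoothness of convolutions with a parameter. The
cutoff `χ`, equal to one on the interval, supplies the compact support required there. -/
theorem contDiff_intervalIntegral {G : E3 → ℝ → ℂ} (hG : ContDiff ℝ ∞ (fun p : E3 × ℝ => G p.1 p.2))
    (a b : ℝ) : ContDiff ℝ ∞ fun z => ∫ t in a..b, G z t := by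
  let χ : ContDiffBump ((0 : ℝ)) :=
    ⟨max |a| |b| + 1, max |a| |b| + 2, by positivity, by linarith⟩
  have hχ : ∀ t ∈ uIoc a b, χ t = 1 := by
    intro t ht
    refine χ.one_of_mem_closedBall ?_
    rw [mem_closedBall_zero_iff, Real.norm_eq_abs]
    have h1 : t ∈ uIcc a b := uIoc_subset_uIcc ht
    have := abs_le_max_abs_abs (show min a b ≤ t from h1.1) (show t ≤ max a b from h1.2)
    change |t| ≤ max |a| |b| + 1
    have h2 : |min a b| ≤ max |a| |b| := by
      rcases min_choice a b with h | h <;> rw [h] <;> simp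
    have h3 : |max a b| ≤ max |a| |b| := by
      rcases max_choice a b with h | h <;> rw [h] <;> simp
    linarith [max_le h2 h3]
  let L : ℝ →L[ℝ] ℂ →L[ℝ] ℂ := ContinuousLinearMap.lsmul ℝ ℝ
  let f : ℝ → ℝ := (uIoc a b).indicator fun _ => 1
  let g : E3 → ℝ → ℂ := fun z t => (χ (-t) : ℂ) * G z (-t)
  have key : ContDiffOn ℝ ∞ (fun q : E3 × ℝ => convolution f (g q.1) L volume q.2)
      (univ ×ˢ univ) := contDiffOn_convolution_right_with_param (n := ⊤) L
    (k := Metric.closedBall 0 χ.rOut) isOpen_univ (isCompact_closedBall _ _) ?_ ?_ ?_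
  · rw [univ_prod_univ, contDiffOn_univ] at key
    have hp : ContDiff ℝ ∞ fun z : E3 => (z, (0 : ℝ)) := contDiff_id.prodMk contDiff_const
    have hcomp : ∀ F : E3 × ℝ → ℂ, ContDiff ℝ ∞ F → ContDiff ℝ ∞ fun z : E3 => F (z, 0) :=
      fun F hF => hF.comp hp
    have h2 : ContDiff ℝ ∞ fun z : E3 => convolution f (g z) L volume 0 := hcomp _ key
    have h3 : (fun z : E3 => convolution f (g z) L volume 0)
        = fun z => ∫ t in uIoc a b, G z t := by
      ext z
      rw [← integral_indicator measurableSet_uIoc]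
      refine integral_congr_ae (ae_of_all _ fun t => ?_)
      by_cases ht : t ∈ uIoc a b
      · simp [f, g, L, ht, hχ t ht]
      · simp [f, g, L, ht]
    rw [h3] at h2
    simp only [intervalIntegral.intervalIntegral_eq_integral_uIoc]
    exact contDiff_const.smul h2
  · intro z t _ ht
    have : χ (-t) = 0 := χ.zero_of_le_dist (by
      simpa using (not_le.1 (by simpa [mem_closedBall_zero_iff] using ht)).le)
    simp [g, this]
  · exact ((integrable_indicator_iff measurableSet_uIoc).2
      (integrableOn_const (by simp [uIoc]))).locallyIntegrable
  · refine ContDiff.contDiffOn ?_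
    change ContDiff ℝ ∞ fun p : E3 × ℝ => (χ (-p.2) : ℂ) * G p.1 (-p.2)
    exact (Complex.ofRealCLM.contDiff.comp (χ.contDiff.comp contDiff_snd.neg)).mul
      (hG.comp (contDiff_fst.prodMk contDiff_snd.neg))

theorem fderiv_intervalIntegral {G : E3 → ℝ → ℂ} (hG : ContDiff ℝ ∞ (fun p : E3 × ℝ => G p.1 p.2))
    (a b : ℝ) (z v : E3) :
    fderiv ℝ (fun z => ∫ t in a..b, G z t) z v = ∫ t in a..b, fderiv ℝ (fun z => G z t) z v := by
  set F' : E3 → ℝ → E3 →L[ℝ] ℂ := fun z t => fderiv ℝ (fun z => G z t) z with hF'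
  have hdiff : ∀ z t, HasFDerivAt (fun z => G z t) (F' z t) z := by
    intro z t
    have : ContDiff ℝ ∞ fun z => G z t := hG.comp (contDiff_id.prodMk contDiff_const)
    exact (this.differentiable (by simp) z).hasFDerivAt
  have hcont : Continuous fun p : E3 × ℝ => F' p.1 p.2 := by
    have h : ContDiff ℝ ∞ (Function.uncurry fun (p : E3 × ℝ) (y : E3) => G y p.2) :=
      hG.comp (contDiff_snd.prodMk (contDiff_snd.comp contDiff_fst))
    exact (ContDiff.fderiv (m := 1) (n := 0) (h.of_le (by simp)) contDiff_fst (by simp)).continuous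
  have hcz : ∀ z, Continuous fun t => F' z t := fun z => hcont.comp (Continuous.prodMk_right z)
  obtain ⟨M, hM⟩ : ∃ M, ∀ p ∈ Metric.closedBall z 1 ×ˢ uIcc a b, ‖F' p.1 p.2‖ ≤ M := by
    obtain ⟨M, hM⟩ := ((isCompact_closedBall z 1).prod isCompact_uIcc).exists_bound_of_continuousOn
      hcont.continuousOn
    exact ⟨M, hM⟩
  have h := intervalIntegral.hasFDerivAt_integral_of_dominated_of_fderiv_le (𝕜 := ℝ)
    (μ := volume) (a := a) (b := b) (F := G) (F' := F') (x₀ := z) (bound := fun _ => M)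
    (Metric.closedBall_mem_nhds z one_pos)
    (Eventually.of_forall fun y => (hG.continuous.comp
      (Continuous.prodMk_right y)).aestronglyMeasurable)
    ((hG.continuous.comp (Continuous.prodMk_right z)).intervalIntegrable _ _)
    (hcz z).aestronglyMeasurable
    (ae_of_all _ fun t ht y hy => hM (y, t) ⟨hy, uIoc_subset_uIcc ht⟩)
    intervalIntegrable_const (ae_of_all _ fun t _ y _ => hdiff y t)
  rw [h.fderiv, ContinuousLinearMap.intervalIntegral_apply]
  exact (hcz z).intervalIntegrable _ _

/-! ### A potential for the difference of two dilations -/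

theorem contDiff_dil_uncurry {k : E3 → ℂ} (hk : ContDiff ℝ ∞ k) :
    ContDiff ℝ ∞ fun p : E3 × ℝ => dil p.2 k p.1 := by
  have h1 : ContDiff ℝ ∞ fun p : E3 × ℝ => Real.exp (-p.2) :=
    Real.contDiff_exp.comp contDiff_snd.neg
  exact (Complex.ofRealCLM.contDiff.comp (h1.pow 3)).mul (hk.comp (h1.smul contDiff_fst))

/-- `∫_{a}^{b} e^{-3s} k(e^{-s} z) ds`. -/
def dilIntegral (a b : ℝ) (k : E3 → ℂ) (z : E3) : ℂ := ∫ s in a..b, dil s k z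

/-- The `l`-th component of the field `z ∫_{a}^{b} e^{-3s} k(e^{-s} z) ds`, whose divergence is
`dil a k - dil b k`. -/
def potential (a b : ℝ) (k : E3 → ℂ) (l : Fin 3) (z : E3) : ℂ := (z l : ℂ) * dilIntegral a b k z

theorem contDiff_coord (l : Fin 3) : ContDiff ℝ ∞ fun z : E3 => (z l : ℂ) :=
  Complex.ofRealCLM.contDiff.comp (EuclideanSpace.proj (𝕜 := ℝ) l).contDiff

theorem contDiff_dilIntegral {k : E3 → ℂ} (hk : ContDiff ℝ ∞ k) (a b : ℝ) :
    ContDiff ℝ ∞ (dilIntegral a b k) :=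
  contDiff_intervalIntegral (G := fun z s => dil s k z) (contDiff_dil_uncurry hk) a b

theorem contDiff_potential {k : E3 → ℂ} (hk : ContDiff ℝ ∞ k) (a b : ℝ) (l : Fin 3) :
    ContDiff ℝ ∞ (potential a b k l) :=
  (contDiff_coord l).mul (contDiff_dilIntegral hk a b)

theorem tsupport_dil_subset {k : E3 → ℂ} (s : ℝ) :
    tsupport (dil s k) ⊆ (fun w => Real.exp s • w) '' tsupport k := by
  have hcl : IsClosed ((fun w : E3 => Real.exp s • w) '' tsupport k) :=
    (Homeomorph.smulOfNeZero (Real.exp s) (Real.exp_pos s).ne').isClosedMap _ (isClosed_tsupport k)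
  refine closure_minimal (fun z hz => ?_) hcl
  refine ⟨Real.exp (-s) • z, subset_tsupport _ (right_ne_zero_of_mul hz), ?_⟩
  simp [smul_smul, ← Real.exp_add]

/-- The support meets only dilates of `tsupport k` with parameter in `[a, b]`; hence a kernel inward
up to scale `b` has a potential that is inward as well, whatever `a` is. -/
theorem tsupport_potential_subset {k : E3 → ℂ} (hk : HasCompactSupport k) {a b : ℝ} (hab : a ≤ b)
    (l : Fin 3) : tsupport (potential a b k l)
      ⊆ (fun p : ℝ × E3 => Real.exp p.1 • p.2) '' (Icc a b ×ˢ tsupport k) := by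
  have hcp : IsCompact ((fun p : ℝ × E3 => Real.exp p.1 • p.2) '' (Icc a b ×ˢ tsupport k)) :=
    (isCompact_Icc.prod hk.isCompact).image (by fun_prop)
  refine closure_minimal (fun z hz => ?_) hcp.isClosed
  by_contra hcon
  refine right_ne_zero_of_mul hz ?_
  rw [dilIntegral]
  refine (intervalIntegral.integral_congr fun s hs => ?_).trans intervalIntegral.integral_zero
  rw [uIcc_of_le hab] at hs
  by_contra hne
  refine hcon ⟨(s, Real.exp (-s) • z), ⟨hs, subset_tsupport _ (right_ne_zero_of_mul hne)⟩, ?_⟩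
  simp [smul_smul, ← Real.exp_add]

theorem hasCompactSupport_potential {k : E3 → ℂ} (hk : HasCompactSupport k) {a b : ℝ}
    (hab : a ≤ b) (l : Fin 3) : HasCompactSupport (potential a b k l) :=
  ((isCompact_Icc.prod hk.isCompact).image (by fun_prop)).of_isClosed_subset
    (isClosed_tsupport _) (tsupport_potential_subset hk hab l)

theorem fderiv_dil {k : E3 → ℂ} (hk : ContDiff ℝ ∞ k) (s : ℝ) (z v : E3) :
    fderiv ℝ (dil s k) z v
      = (Real.exp (-s) ^ 3 : ℝ) * fderiv ℝ k (Real.exp (-s) • z) (Real.exp (-s) • v) := by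
  have h1 : HasFDerivAt k (fderiv ℝ k (Real.exp (-s) • z)) (Real.exp (-s) • z) :=
    (hk.differentiable (by simp) _).hasFDerivAt
  have h2 : HasFDerivAt (fun z : E3 => Real.exp (-s) • z)
      (Real.exp (-s) • ContinuousLinearMap.id ℝ E3) z :=
    (Real.exp (-s) • ContinuousLinearMap.id ℝ E3).hasFDerivAt
  have h3 := (h1.comp z h2).const_mul ((Real.exp (-s) ^ 3 : ℝ) : ℂ)
  have h4 : HasFDerivAt (dil s k) _ z := h3
  rw [h4.fderiv]
  simp

/-- The `s`-derivative is minus the divergence of the field `z ↦ z k_s(z)`, where `k_s = dil s k`;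
integrating it in `s` produces the potential. -/
theorem hasDerivAt_dil {k : E3 → ℂ} (hk : ContDiff ℝ ∞ k) (z : E3) (s : ℝ) :
    HasDerivAt (fun s => dil s k z) (-(3 * dil s k z + fderiv ℝ (dil s k) z z)) s := by
  have h1 : HasFDerivAt k (fderiv ℝ k (Real.exp (-s) • z)) (Real.exp (-s) • z) :=
    (hk.differentiable (by simp) _).hasFDerivAt
  have he : HasDerivAt (fun s => Real.exp (-s)) (-Real.exp (-s)) s := by
    simpa using (hasDerivAt_neg s).exp
  have h2 := h1.comp_hasDerivAt s (he.smul_const z)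
  have h3 := ((he.pow 3).ofReal_comp).mul h2
  convert! h3 using 1
  rw [fderiv_dil hk]
  simp [dil]
  ring

theorem sum_coord_smul (z : E3) : ∑ l, z l • EuclideanSpace.single l (1 : ℝ) = z := by
  ext i
  simp [Pi.single_apply]

/-- For `F = ∫ k_s ds` one has `div (z F) = 3 F + z · ∇F`. By `hasDerivAt_dil` this is the integral
of `-∂_s k_s`, and the fundamental theorem of calculus applies. -/
theorem sum_pd_potential {k : E3 → ℂ} (hk : ContDiff ℝ ∞ k) (a b : ℝ) (z : E3) :
    ∑ l, pd l (potential a b k l) z = dil a k z - dil b k z := by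
  have h1 : ∀ l, pd l (potential a b k l) z
      = dilIntegral a b k z
        + fderiv ℝ (dilIntegral a b k) z (z l • EuclideanSpace.single l (1 : ℝ)) := by
    intro l
    have hc : HasFDerivAt (fun z : E3 => (z l : ℂ))
        (Complex.ofRealCLM.comp (EuclideanSpace.proj (𝕜 := ℝ) l)) z :=
      Complex.ofRealCLM.hasFDerivAt.comp z (EuclideanSpace.proj (𝕜 := ℝ) l).hasFDerivAt
    have hd : HasFDerivAt (dilIntegral a b k) (fderiv ℝ (dilIntegral a b k) z) z :=
      ((contDiff_dilIntegral hk a b).differentiable (by simp) _).hasFDerivAt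
    have hp : HasFDerivAt (potential a b k l) _ z := hc.mul hd
    rw [pd, hp.fderiv]
    simp
    ring
  rw [Finset.sum_congr rfl fun l _ => h1 l, Finset.sum_add_distrib, ← map_sum, sum_coord_smul]
  have h2 : fderiv ℝ (dilIntegral a b k) z z = ∫ s in a..b, fderiv ℝ (dil s k) z z :=
    fderiv_intervalIntegral (G := fun z s => dil s k z) (contDiff_dil_uncurry hk) a b z z
  have c1 : Continuous fun s => dil s k z :=
    (contDiff_dil_uncurry hk).continuous.comp (Continuous.prodMk_right z)
  have c2 : Continuous fun s => fderiv ℝ (dil s k) z z := by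
    simp only [fderiv_dil hk]
    have := hk.continuous_fderiv (by simp)
    fun_prop
  have h3 := intervalIntegral.integral_eq_sub_of_hasDerivAt (a := a) (b := b)
    (fun s _ => hasDerivAt_dil hk z s)
    (((continuous_const.mul c1).add c2).neg.intervalIntegrable _ _)
  rw [h2, dilIntegral]
  have i1 : IntervalIntegrable (fun s => 3 * dil s k z) volume a b :=
    (continuous_const.mul c1).intervalIntegrable _ _
  rw [intervalIntegral.integral_neg, intervalIntegral.integral_add i1 (c2.intervalIntegrable _ _),
    intervalIntegral.integral_const_mul] at h3
  simp only [Finset.sum_const, Finset.card_univ, Fintype.card_fin, nsmul_eq_mul]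
  push_cast
  linear_combination -h3

/-! ### Uniform Fourier bounds -/

/-- The dilation preserves integrals, so it only rescales the frequency; the factor `e^s` comes from
the coordinate `z_l`. -/
theorem fourier_coord_mul_dil (k : E3 → ℂ) (l : Fin 3) (s : ℝ) (ξ : E3) :
    𝓕 (fun z : E3 => (z l : ℂ) * dil s k z) ξ
      = Real.exp s * 𝓕 (fun z : E3 => (z l : ℂ) * k z) (Real.exp s • ξ) := by
  rw [Real.fourier_eq, Real.fourier_eq]
  have h : (0 : ℝ) < Real.exp (-s) ^ 3 := by positivity
  have e : ∀ v : E3, Real.fourierChar (-inner ℝ v ξ) • ((v l : ℂ) * dil s k v)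
      = ((Real.exp s * Real.exp (-s) ^ 3 : ℝ) : ℂ) * (fun w : E3 =>
        Real.fourierChar (-inner ℝ w (Real.exp s • ξ)) • ((w l : ℂ) * k w)) (Real.exp (-s) • v) := by
    intro v
    have e1 : inner ℝ (Real.exp (-s) • v) (Real.exp s • ξ) = inner ℝ v ξ := by
      rw [real_inner_smul_left, real_inner_smul_right, ← mul_assoc, ← Real.exp_add]
      simp
    have e2 : ((Real.exp s : ℝ) : ℂ) * (Real.exp (-s) : ℝ) = 1 := by
      rw [← Complex.ofReal_mul, ← Real.exp_add]
      simp
    simp only [e1, dil, Circle.smul_def, smul_eq_mul, PiLp.smul_apply, Complex.ofReal_mul]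
    linear_combination (-(((Real.exp (-s) ^ 3 : ℝ) : ℂ) * ↑(Real.fourierChar (-inner ℝ v ξ))
      * (v l : ℂ) * k (Real.exp (-s) • v))) * e2
  simp only [e]
  rw [integral_const_mul, Measure.integral_comp_smul volume (fun w : E3 =>
    Real.fourierChar (-inner ℝ w (Real.exp s • ξ)) • ((w l : ℂ) * k w))]
  simp only [finrank_euclideanSpace, Fintype.card_fin]
  rw [abs_of_pos (inv_pos.2 h), Complex.real_smul, ← mul_assoc, ← Complex.ofReal_mul, mul_assoc,
    mul_inv_cancel₀ h.ne', mul_one]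

theorem fourier_potential {k : E3 → ℂ} (hk : ContDiff ℝ ∞ k) (hc : HasCompactSupport k) {a b : ℝ}
    (hab : a ≤ b) (l : Fin 3) (ξ : E3) : 𝓕 (potential a b k l) ξ
      = ∫ s in a..b, Real.exp s * 𝓕 (fun z : E3 => (z l : ℂ) * k z) (Real.exp s • ξ) := by
  simp only [← fourier_coord_mul_dil]
  have e : ∀ s, 𝓕 (fun z : E3 => (z l : ℂ) * dil s k z) ξ
      = ∫ v, Real.fourierChar (-inner ℝ v ξ) • ((v l : ℂ) * dil s k v) :=
    fun s => Real.fourier_eq _ _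
  simp only [e]
  rw [intervalIntegral_integral_swap, Real.fourier_eq]
  · refine integral_congr_ae (ae_of_all _ fun v => ?_)
    simp only [potential, dilIntegral, Circle.smul_def, smul_eq_mul]
    rw [intervalIntegral.integral_const_mul, intervalIntegral.integral_const_mul]
  · obtain ⟨R, hR0, hR⟩ : ∃ R, 0 < R ∧ ∀ z, k z ≠ 0 → ‖z‖ ≤ R := by
      obtain ⟨R, hR, h⟩ := hc.isCompact.isBounded.exists_pos_norm_le
      exact ⟨R, hR, fun z hz => h z (subset_tsupport _ hz)⟩
    have hcont : Continuous (Function.uncurry fun (s : ℝ) (v : E3) =>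
        Real.fourierChar (-inner ℝ v ξ) • ((v l : ℂ) * dil s k v)) := by
      have h1 : Continuous fun p : ℝ × E3 => dil p.1 k p.2 :=
        (contDiff_dil_uncurry hk).continuous.comp continuous_swap
      have h2 : Continuous fun p : ℝ × E3 => (Real.fourierChar (-inner ℝ p.2 ξ) : ℂ) :=
        continuous_subtype_val.comp (Real.continuous_fourierChar.comp (by fun_prop))
      have h3 : Continuous fun p : ℝ × E3 => ((p.2 l : ℝ) : ℂ) :=
        (contDiff_coord l).continuous.comp continuous_snd
      exact h2.mul (h3.mul h1)
    have hprod : (volume.restrict (uIoc a b)).prod (volume : Measure E3)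
        = (volume : Measure (ℝ × E3)).restrict (uIoc a b ×ˢ univ) := by
      rw [Measure.volume_eq_prod, ← Measure.prod_restrict, Measure.restrict_univ]
    rw [hprod]
    have hcomp : IsCompact (uIcc a b ×ˢ Metric.closedBall (0 : E3) (Real.exp b * R)) :=
      isCompact_uIcc.prod (isCompact_closedBall _ _)
    refine (hcont.continuousOn.integrableOn_compact hcomp).of_forall_sdiff_eq_zero
      (measurableSet_uIoc.prod MeasurableSet.univ) ?_
    rintro ⟨s, v⟩ ⟨⟨hs, -⟩, hsv⟩
    have hs' := uIoc_subset_uIcc hs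
    have hv : ¬ ‖v‖ ≤ Real.exp b * R := fun hv => hsv ⟨hs', by simpa using hv⟩
    have : dil s k v = 0 := by
      by_contra hne
      refine hv ((norm_le_of_dil_ne_zero hR s v hne).trans ?_)
      rw [uIcc_of_le hab] at hs'
      exact mul_le_mul_of_nonneg_right (Real.exp_le_exp.2 hs'.2) hR0.le
    simp [this]

/-- The primitive is `arctan(e^s ρ) / ρ`, whose total variation is at most `π / ρ` on every
interval. This is the source of uniformity in the scales. -/
theorem integral_exp_div_le {a b ρ : ℝ} (hρ : 0 < ρ) :
    ∫ s in a..b, Real.exp s / (1 + (Real.exp s * ρ) ^ 2) ≤ Real.pi / ρ := by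
  have hd : ∀ s, HasDerivAt (fun s => Real.arctan (Real.exp s * ρ) / ρ)
      (Real.exp s / (1 + (Real.exp s * ρ) ^ 2)) s := by
    intro s
    have h1 := (((Real.hasDerivAt_exp s).mul_const ρ).arctan).div_const ρ
    convert! h1 using 1
    field_simp
  have hc : Continuous fun s => Real.exp s / (1 + (Real.exp s * ρ) ^ 2) :=
    Real.continuous_exp.div (by fun_prop) fun s => by positivity
  rw [intervalIntegral.integral_eq_sub_of_hasDerivAt (fun s _ => hd s)
    (hc.intervalIntegrable _ _), ← sub_div]
  refine div_le_div_of_nonneg_right ?_ hρ.le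
  have h1 := Real.arctan_lt_pi_div_two (Real.exp b * ρ)
  have h2 := Real.neg_pi_div_two_lt_arctan (Real.exp a * ρ)
  linarith

/-- The transform of `z_l k` is Schwartz, hence at most `M / (1 + |η|²)`. Superposing its dilates
and using `integral_exp_div_le` costs exactly one factor `1 / |ξ|`, so the potential's derivatives
have bounded symbols independently of `a` and `b`. -/
theorem exists_norm_fourier_potential_le {k : E3 → ℂ} (hk : ContDiff ℝ ∞ k)
    (hc : HasCompactSupport k) : ∃ M : ℝ, 0 ≤ M ∧ ∀ (l : Fin 3) (a b : ℝ), a ≤ b → ∀ ξ,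
      ‖ξ‖ * ‖𝓕 (potential a b k l) ξ‖ ≤ M := by
  have h1 : ∀ l : Fin 3, ∃ M : ℝ, 0 ≤ M ∧ ∀ η,
      ‖𝓕 (fun z : E3 => (z l : ℂ) * k z) η‖ ≤ M / (1 + ‖η‖ ^ 2) := by
    intro l
    have hs : ContDiff ℝ ∞ fun z : E3 => (z l : ℂ) * k z := (contDiff_coord l).mul hk
    have hcs : HasCompactSupport fun z : E3 => (z l : ℂ) * k z := hc.mul_left
    obtain ⟨C0, hC0, h0⟩ := (𝓕 (hcs.toSchwartzMap hs)).decay 0 0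
    obtain ⟨C2, hC2, h2⟩ := (𝓕 (hcs.toSchwartzMap hs)).decay 2 0
    refine ⟨C0 + C2, by positivity, fun η => ?_⟩
    rw [le_div_iff₀ (by positivity)]
    have e0 := h0 η
    have e2 := h2 η
    simp only [norm_iteratedFDeriv_zero, pow_zero, one_mul] at e0 e2
    rw [SchwartzMap.fourier_coe] at e0 e2
    change ‖𝓕 (fun z : E3 => (z l : ℂ) * k z) η‖ ≤ _ at e0
    change _ * ‖𝓕 (fun z : E3 => (z l : ℂ) * k z) η‖ ≤ _ at e2
    linarith
  choose M hM0 hM using h1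
  refine ⟨(∑ l, M l) * Real.pi, mul_nonneg (Finset.sum_nonneg fun l _ => hM0 l) Real.pi_pos.le,
    fun l a b hab ξ => ?_⟩
  have hMl : M l ≤ ∑ l, M l := Finset.single_le_sum (fun l _ => hM0 l) (Finset.mem_univ l)
  rcases eq_or_ne ξ 0 with rfl | hξ
  · simp only [norm_zero, zero_mul]
    exact mul_nonneg (Finset.sum_nonneg fun l _ => hM0 l) Real.pi_pos.le
  have hρ : 0 < ‖ξ‖ := norm_pos_iff.2 hξ
  rw [fourier_potential hk hc hab]
  have hc2 : Continuous fun s => Real.exp s / (1 + (Real.exp s * ‖ξ‖) ^ 2) :=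
    Real.continuous_exp.div (by fun_prop) fun s => by positivity
  have h2 : ‖∫ s in a..b, (Real.exp s : ℂ) * 𝓕 (fun z : E3 => (z l : ℂ) * k z) (Real.exp s • ξ)‖
      ≤ ∫ s in a..b, M l * (Real.exp s / (1 + (Real.exp s * ‖ξ‖) ^ 2)) := by
    refine intervalIntegral.norm_integral_le_of_norm_le hab (ae_of_all _ fun s _ => ?_)
      ((continuous_const.mul hc2).intervalIntegrable _ _)
    rw [norm_mul, Complex.norm_real, Real.norm_of_nonneg (Real.exp_pos s).le]
    have := hM l (Real.exp s • ξ)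
    rw [norm_smul, Real.norm_of_nonneg (Real.exp_pos s).le] at this
    calc _ ≤ Real.exp s * (M l / (1 + (Real.exp s * ‖ξ‖) ^ 2)) :=
          mul_le_mul_of_nonneg_left this (Real.exp_pos s).le
      _ = _ := by ring
  rw [intervalIntegral.integral_const_mul] at h2
  calc _ ≤ ‖ξ‖ * (M l * (Real.pi / ‖ξ‖)) := by
        refine mul_le_mul_of_nonneg_left (h2.trans ?_) hρ.le
        exact mul_le_mul_of_nonneg_left (integral_exp_div_le hρ) (hM0 l)
    _ = M l * Real.pi := by field_simp
    _ ≤ _ := mul_le_mul_of_nonneg_right hMl Real.pi_pos.le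

/-- Convolution with the derivatives of the potential is bounded on `L²(ℝ³)`, uniformly in the
interval of integration. -/
theorem exists_eLpNorm_conv_pd_potential_le {k : E3 → ℂ} (hk : ContDiff ℝ ∞ k)
    (hc : HasCompactSupport k) : ∃ M : ℝ, 0 ≤ M ∧ ∀ (l m : Fin 3) (a b : ℝ), a ≤ b →
      ∀ g, MemLp g 2 volume → eLpNorm (conv g (pd m (potential a b k l))) 2 volume
        ≤ ENNReal.ofReal M * eLpNorm g 2 volume := by
  obtain ⟨M, hM0, hM⟩ := exists_norm_fourier_potential_le hk hc
  refine ⟨2 * Real.pi * M, by positivity, fun l m a b hab g hg => ?_⟩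
  set K := (hasCompactSupport_potential hc hab l).toSchwartzMap (contDiff_potential hk a b l)
    with hK
  refine eLpNorm_conv_le hg (LineDeriv.lineDerivOp (EuclideanSpace.single m (1 : ℝ)) K) fun ξ => ?_
  have ht : (fun x : E3 => inner ℝ x (EuclideanSpace.single m (1 : ℝ))).HasTemperateGrowth := by
    fun_prop
  rw [SchwartzMap.fourier_lineDerivOp_eq, smul_apply,
    SchwartzMap.smulLeftCLM_apply_apply ht, norm_smul, norm_smul]
  -- Differentiation in direction `m` multiplies the transform by `2πi ξ_m`, and `|ξ_m| ≤ |ξ|`.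
  have h1 : ‖(2 * Real.pi * Complex.I : ℂ)‖ = 2 * Real.pi := by
    simp [abs_of_pos Real.pi_pos]
  have h2 : ‖(inner ℝ ξ (EuclideanSpace.single m (1 : ℝ)) : ℝ)‖ ≤ ‖ξ‖ := by
    refine (norm_inner_le_norm _ _).trans ?_
    simp
  rw [h1]
  refine mul_le_mul_of_nonneg_left ?_ (by positivity)
  refine (mul_le_mul_of_nonneg_right h2 (norm_nonneg _)).trans ?_
  rw [SchwartzMap.fourier_coe]
  exact hM l a b hab ξ

/-! ### The local cone property of Lipschitz domains -/

/-- Moving by `s` straight down from the graph, with an error of size `s ‖η‖`, changes the height by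
at most `-s + s ‖η‖`, while the graph drops by at most `K s ‖η‖`. The point stays below the graph
once `(K + 1) ‖η‖ < 1`. -/
theorem HasLipschitzBoundary.exists_cone {Ω : Set E3} (h : HasLipschitzBoundary Ω) {x₀ : E3}
    (hx : x₀ ∈ frontier Ω) : ∃ (e : E3) (c r : ℝ), 0 < c ∧ 0 < r ∧
      ∀ y ∈ Ω ∩ Metric.ball x₀ r, ∀ s ∈ Ioo 0 r, ∀ η : E3, ‖η‖ < c → y + s • (e + η) ∈ Ω := by
  obtain ⟨U, hU, A, ζ, K, hζ, hiff⟩ := h x₀ hx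
  obtain ⟨R, hR, hball⟩ := Metric.mem_nhds_iff.1 hU
  have hK : (0 : ℝ) < K + 1 := by positivity
  -- With `s < R / 3` and `‖e + η‖ ≤ 2`, a point within `R / 3` of `x₀` stays in the ball of radius
  -- `R` where the graph description is valid.
  refine ⟨A.symm (-EuclideanSpace.single 2 1), 1 / (K + 1), R / 3, by positivity, by positivity, ?_⟩
  rintro y ⟨hyΩ, hy⟩ s ⟨hs0, hs⟩ η hη
  have hη1 : ‖η‖ < 1 := hη.trans_le (by rw [div_le_one hK]; linarith [K.2])
  have hne : ‖A.symm (-EuclideanSpace.single 2 1)‖ = 1 := by simp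
  have hyU : y ∈ U := hball (Metric.ball_subset_ball (by linarith) hy)
  have hzU : y + s • (A.symm (-EuclideanSpace.single 2 1) + η) ∈ U := by
    refine hball ?_
    rw [Metric.mem_ball, dist_eq_norm] at hy ⊢
    have e1 : y + s • (A.symm (-EuclideanSpace.single 2 1) + η) - x₀
        = (y - x₀) + s • (A.symm (-EuclideanSpace.single 2 1) + η) := by abel
    have e2 : ‖s • (A.symm (-EuclideanSpace.single 2 1) + η)‖ ≤ s * 2 := by
      rw [norm_smul, Real.norm_of_nonneg hs0.le]
      refine mul_le_mul_of_nonneg_left ((norm_add_le _ _).trans ?_) hs0.le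
      linarith
    rw [e1]
    refine (norm_add_le _ _).trans_lt ?_
    linarith
  rw [hiff _ hzU]
  have hlt := (hiff y hyU).1 hyΩ
  set z : E3 := A (y + s • (A.symm (-EuclideanSpace.single 2 1) + η)) with hzdef
  have hA : z = A y + s • (-EuclideanSpace.single 2 1 + A η) := by simp [hzdef]
  have hnA : ‖A η‖ = ‖η‖ := A.norm_map η
  have hc2 : |(A η) 2| ≤ ‖η‖ := hnA ▸ PiLp.norm_apply_le (A η) 2
  have hd : dist (!₂[A y 0, A y 1] : EuclideanSpace ℝ (Fin 2))
      !₂[z 0, z 1] ≤ s * ‖η‖ := by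
    rw [hA, ← hnA, EuclideanSpace.dist_eq, EuclideanSpace.norm_eq, Real.sqrt_le_left (by positivity),
      mul_pow, Real.sq_sqrt (by positivity)]
    simp [Fin.sum_univ_two, Fin.sum_univ_three, Real.dist_eq]
    nlinarith [mul_nonneg (sq_nonneg s) (sq_nonneg ((A η) 2))]
  have hz := (hζ.dist_le_mul _ _).trans (mul_le_mul_of_nonneg_left hd K.2)
  rw [Real.dist_eq] at hz
  have hz' := (abs_le.1 hz).2
  have h3 : z 2 = A y 2 - s + s * (A η) 2 := by
    rw [hA]
    simp
    ring
  rw [h3]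
  have h4 : s * (A η) 2 ≤ s * ‖η‖ := mul_le_mul_of_nonneg_left (le_of_abs_le hc2) hs0.le
  have h5 : s * (‖η‖ * (K + 1)) < s * 1 :=
    mul_lt_mul_of_pos_left ((lt_div_iff₀ hK).1 hη) hs0
  have h6 : (K : ℝ) * (s * ‖η‖) + s * ‖η‖ < s := by linarith
  change _ ≤ (K : ℝ) * (s * ‖η‖) at hz'
  linarith

/-- The kernel `k` and its contractions, shifted to points of `D`, are supported in `Ω`. -/
def IsInward (Ω D : Set E3) (k : E3 → ℂ) (b : ℝ) : Prop :=
  ∀ y ∈ D, ∀ s ≤ b, ∀ w ∈ tsupport k, y - Real.exp s • w ∈ Ω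

/-- Convolution evaluates at `y - e^s w`, so a kernel concentrated near `-e`, with `e` the cone
axis, looks along the cone into `Ω`. Interior points are covered by the degenerate axis `e = 0`. -/
theorem IsBoundedLipschitzDomain.exists_isInward {Ω : Set E3} (h : IsBoundedLipschitzDomain Ω)
    {x₀ : E3} (hx : x₀ ∈ closure Ω) : ∃ k, IsMollifier k ∧ ∃ r > 0, ∃ b,
      IsInward Ω (Ω ∩ Metric.ball x₀ r) k b := by
  obtain ⟨e, c, r, hc, hr, hcone⟩ : ∃ (e : E3) (c r : ℝ), 0 < c ∧ 0 < r ∧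
      ∀ y ∈ Ω ∩ Metric.ball x₀ r, ∀ s ∈ Ioo 0 r, ∀ η : E3, ‖η‖ < c → y + s • (e + η) ∈ Ω := by
    by_cases hxΩ : x₀ ∈ Ω
    · obtain ⟨R, hR, hball⟩ := Metric.mem_nhds_iff.1 (h.isOpen.mem_nhds hxΩ)
      refine ⟨0, 1, R / 2, one_pos, by positivity, ?_⟩
      rintro y ⟨-, hy⟩ s ⟨hs0, hs⟩ η hη
      refine hball ?_
      rw [Metric.mem_ball, dist_eq_norm] at hy ⊢
      rw [zero_add, add_sub_right_comm]
      refine (norm_add_le _ _).trans_lt ?_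
      rw [norm_smul, Real.norm_of_nonneg hs0.le]
      have := mul_le_mul_of_nonneg_left hη.le hs0.le
      linarith
    · exact h.lipschitz.exists_cone ⟨hx, by rwa [h.isOpen.interior_eq]⟩
  obtain ⟨k, hk, hsupp⟩ := exists_isMollifier (-e) (half_pos hc)
  -- With `b = log (r / 2)`, every `s ≤ b` has `e^s ≤ r / 2`, inside the open range of scales `(0,
  -- r)` of the cone condition.
  refine ⟨k, hk, r, hr, Real.log (r / 2), fun y hy s hs w hw => ?_⟩
  have hs' : Real.exp s < r := by
    have := Real.exp_le_exp.2 hs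
    rw [Real.exp_log (by positivity)] at this
    linarith
  have hw' := hsupp hw
  rw [mem_closedBall_iff_norm, sub_neg_eq_add] at hw'
  have := hcone y hy (Real.exp s) ⟨Real.exp_pos s, hs'⟩ (-(w + e)) (by rw [norm_neg]; linarith)
  convert! this using 1
  rw [show e + -(w + e) = -w by abel, smul_neg, sub_eq_add_neg]

/-! ### Shifted kernels as test functions -/

theorem isTest_comp_sub {Ω : Set E3} {q : E3 → ℂ} (hq : ContDiff ℝ ∞ q) (hc : HasCompactSupport q)
    {x : E3} (hx : ∀ w ∈ tsupport q, x - w ∈ Ω) : IsTest Ω fun y => q (x - y) where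
  smooth := hq.comp (contDiff_const.sub contDiff_id)
  compact := hc.comp_homeomorph (Homeomorph.subLeft x)
  support := by
    intro y hy
    have h1 : y ∈ (fun y => x - y) ⁻¹' tsupport q :=
      tsupport_comp_subset_preimage q (f := fun y => x - y) (by fun_prop) hy
    simpa using hx _ h1

theorem pd_comp_sub {q : E3 → ℂ} (hq : ContDiff ℝ ∞ q) (x : E3) (j : Fin 3) (y : E3) :
    pd j (fun y => q (x - y)) y = -pd j q (x - y) := by
  have h1 : HasFDerivAt q (fderiv ℝ q (x - y)) (x - y) :=
    (hq.differentiable (by simp) _).hasFDerivAt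
  have h2 : HasFDerivAt (fun y => x - y) (-ContinuousLinearMap.id ℝ E3) y :=
    (hasFDerivAt_id y).const_sub x
  have h3 := h1.comp y h2
  have h4 : HasFDerivAt (fun y => q (x - y)) _ y := h3
  rw [pd, h4.fderiv]
  simp [pd]

theorem contDiff_pd {q : E3 → ℂ} (hq : ContDiff ℝ ∞ q) (j : Fin 3) : ContDiff ℝ ∞ (pd j q) :=
  (hq.fderiv_right (m := ∞) (by simp)).clm_apply contDiff_const

theorem hasCompactSupport_pd {q : E3 → ℂ} (hq : HasCompactSupport q) (j : Fin 3) :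
    HasCompactSupport (pd j q) := hq.fderiv_apply (𝕜 := ℝ) _

theorem tsupport_pd_subset (q : E3 → ℂ) (j : Fin 3) : tsupport (pd j q) ⊆ tsupport q :=
  tsupport_fderiv_apply_subset ℝ _

theorem pd_pd_comm {q : E3 → ℂ} (hq : ContDiff ℝ ∞ q) (i j : Fin 3) :
    pd i (pd j q) = pd j (pd i q) := by
  ext x
  have hd : DifferentiableAt ℝ (fderiv ℝ q) x :=
    (hq.fderiv_right (m := ∞) (by simp)).differentiable (by simp) x
  have key : ∀ a b : Fin 3, pd a (pd b q) x
      = fderiv ℝ (fderiv ℝ q) x (EuclideanSpace.single a 1) (EuclideanSpace.single b 1) := by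
    intro a b
    have h := hd.hasFDerivAt.clm_apply (hasFDerivAt_const (EuclideanSpace.single b (1 : ℝ)) x)
    have h' : HasFDerivAt (pd b q) _ x := h
    rw [pd, h'.fderiv]
    simp
  rw [key, key]
  exact (hq.contDiffAt (x := x)).isSymmSndFDerivAt
    (by simpa using WithTop.coe_le_coe.2 (le_top : (2 : ℕ∞) ≤ ⊤)) _ _

/-- Extension of `f ∈ L²(Ω)` by zero. -/
def extZero {Ω : Set E3} (f : L2 Ω) : E3 → ℂ := Ω.indicator f

theorem memLp_extZero {Ω : Set E3} (hΩ : MeasurableSet Ω) (f : L2 Ω) :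
    MemLp (extZero f) 2 volume :=
  (memLp_indicator_iff_restrict hΩ).2 (Lp.memLp f)

theorem eLpNorm_extZero {Ω : Set E3} (hΩ : MeasurableSet Ω) (f : L2 Ω) :
    eLpNorm (extZero f) 2 volume = ‖f‖ₑ := by
  rw [extZero, eLpNorm_indicator_eq_eLpNorm_restrict hΩ, Lp.enorm_def]

theorem conv_extZero {Ω : Set E3} (hΩ : MeasurableSet Ω) (f : L2 Ω) (q : E3 → ℂ) (x : E3) :
    conv (extZero f) q x = ∫ y in Ω, f y * q (x - y) := by
  rw [conv, ← integral_indicator hΩ]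
  congr 1 with y
  by_cases hy : y ∈ Ω <;> simp [extZero, hy]

theorem conv_extZero_add {Ω : Set E3} (hΩ : MeasurableSet Ω) (f g : L2 Ω) {q : E3 → ℂ}
    (hq : ContDiff ℝ ∞ q) (hc : HasCompactSupport q) (x : E3) :
    conv (extZero (f + g)) q x = conv (extZero f) q x + conv (extZero g) q x := by
  rw [conv, conv, conv, ← integral_add
    (integrable_mul_sub_left (memLp_extZero hΩ f) hq.continuous hc x)
    (integrable_mul_sub_left (memLp_extZero hΩ g) hq.continuous hc x)]
  refine integral_congr_ae ?_
  have h := (ae_restrict_iff' hΩ).1 (Lp.coeFn_add f g)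
  filter_upwards [h] with y hy
  by_cases hyΩ : y ∈ Ω
  · simp only [extZero, indicator_of_mem hyΩ, hy hyΩ, Pi.add_apply, add_mul]
  · simp [extZero, hyΩ]

/-- The reflected translate `y ↦ q (x - y)` is an admissible test function under the support
hypothesis. The minus sign of the weak derivative cancels that of the reflection. -/
theorem HasWeakPartial.conv_eq {Ω : Set E3} (hΩ : MeasurableSet Ω) {f g : L2 Ω} {j : Fin 3}
    (h : HasWeakPartial Ω j f g) {q : E3 → ℂ} (hq : ContDiff ℝ ∞ q) (hc : HasCompactSupport q)
    {x : E3} (hx : ∀ w ∈ tsupport q, x - w ∈ Ω) :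
    conv (extZero g) q x = conv (extZero f) (pd j q) x := by
  have := h _ (isTest_comp_sub hq hc hx)
  simp only [pd_comp_sub hq, mul_neg, integral_neg, neg_inj] at this
  rw [conv_extZero hΩ, conv_extZero hΩ, this]

/-- Both sides equal `u_i * ∂_a ∂_b q`: second derivatives are needed only on the smooth kernel,
where they commute. -/
theorem H1.conv_grad_comm {Ω : Set E3} (hΩ : MeasurableSet Ω) (u : H1 Ω) {q : E3 → ℂ}
    (hq : ContDiff ℝ ∞ q) (hc : HasCompactSupport q) {x : E3} (hx : ∀ w ∈ tsupport q, x - w ∈ Ω)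
    (i a b : Fin 3) : conv (extZero (H1.grad u i a)) (pd b q) x
      = conv (extZero (H1.grad u i b)) (pd a q) x := by
  have key : ∀ a b, conv (extZero (H1.grad u i a)) (pd b q) x
      = conv (extZero (H1.field u i)) (pd a (pd b q)) x := fun a b =>
    (show HasWeakPartial Ω a (H1.field u i) (H1.grad u i a) from u.2 i a).conv_eq hΩ
      (contDiff_pd hq b) (hasCompactSupport_pd hc b) fun w hw => hx w (tsupport_pd_subset q b hw)
  rw [key, key, pd_pd_comm hq]

/-! ### Korn's inequality -/

/-- Twice the strain, `∂u_i/∂x_j + ∂u_j/∂x_i`. -/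
def strain {Ω : Set E3} (u : H1 Ω) (i j : Fin 3) : L2 Ω := H1.grad u i j + H1.grad u j i

theorem conv_sub_kernel {g q q' : E3 → ℂ} (hg : MemLp g 2 volume) (hq : ContDiff ℝ ∞ q)
    (hc : HasCompactSupport q) (hq' : ContDiff ℝ ∞ q') (hc' : HasCompactSupport q') (x : E3) :
    conv g (fun z => q z - q' z) x = conv g q x - conv g q' x := by
  rw [conv, conv, conv, ← integral_sub (integrable_mul_sub_left hg hq.continuous hc x)
    (integrable_mul_sub_left hg hq'.continuous hc' x)]
  simp only [mul_sub]

theorem conv_sum_kernel {g : E3 → ℂ} {q : Fin 3 → E3 → ℂ} (hg : MemLp g 2 volume)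
    (hq : ∀ l, ContDiff ℝ ∞ (q l)) (hc : ∀ l, HasCompactSupport (q l)) (x : E3) :
    conv g (fun z => ∑ l, q l z) x = ∑ l, conv g (q l) x := by
  simp only [conv, Finset.mul_sum]
  exact integral_finsetSum _ fun l _ => integrable_mul_sub_left hg (hq l).continuous (hc l) x

/-- A mollified gradient is expressed by the field and its strain. -/
theorem conv_grad_eq {Ω D : Set E3} (hΩ : MeasurableSet Ω) {k : E3 → ℂ} (hk : ContDiff ℝ ∞ k)
    (hc : HasCompactSupport k) {a b : ℝ} (hab : a ≤ b) (hin : IsInward Ω D k b) (u : H1 Ω)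
    (i j : Fin 3) {x : E3} (hx : x ∈ D) :
    conv (extZero (H1.grad u i j)) (dil a k) x
      = conv (extZero (H1.field u i)) (pd j (dil b k)) x
        + ∑ l, (1 / 2 : ℂ) * (conv (extZero (strain u i j)) (pd l (potential a b k l)) x
          + conv (extZero (strain u l i)) (pd j (potential a b k l)) x
          - conv (extZero (strain u l j)) (pd i (potential a b k l)) x) := by
  have hb : ∀ w ∈ tsupport (dil b k), x - w ∈ Ω := by
    intro w hw
    obtain ⟨w', hw', rfl⟩ := tsupport_dil_subset b hw
    exact hin x hx b le_rfl w' hw'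
  have hp : ∀ l, ∀ w ∈ tsupport (potential a b k l), x - w ∈ Ω := by
    intro l w hw
    obtain ⟨⟨s, w'⟩, ⟨hs, hw'⟩, rfl⟩ := tsupport_potential_subset hc hab l hw
    exact hin x hx s hs.2 w' hw'
  have hsm := fun l => contDiff_potential hk a b l
  have hcs := fun l => hasCompactSupport_potential hc hab l
  have e1 : conv (extZero (H1.grad u i j)) (dil b k) x
      = conv (extZero (H1.field u i)) (pd j (dil b k)) x :=
    (show HasWeakPartial Ω j (H1.field u i) (H1.grad u i j) from u.2 i j).conv_eq hΩ
      (contDiff_dil hk b) (hasCompactSupport_dil hc b) hb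
  have e2 : conv (extZero (H1.grad u i j)) (dil a k) x
      - conv (extZero (H1.grad u i j)) (dil b k) x
      = ∑ l, conv (extZero (H1.grad u i j)) (pd l (potential a b k l)) x := by
    rw [← conv_sub_kernel (memLp_extZero hΩ _) (contDiff_dil hk a) (hasCompactSupport_dil hc a)
      (contDiff_dil hk b) (hasCompactSupport_dil hc b)]
    simp only [← sum_pd_potential hk a b]
    exact conv_sum_kernel (memLp_extZero hΩ _) (fun l => contDiff_pd (hsm l) l)
      (fun l => hasCompactSupport_pd (hcs l) l) x
  rw [← e1, ← sub_eq_iff_eq_add', e2]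
  refine Finset.sum_congr rfl fun l _ => ?_
  simp only [strain, conv_extZero_add hΩ _ _ (contDiff_pd (hsm l) _)
    (hasCompactSupport_pd (hcs l) _)]
  -- Of the six gradient terms, those containing `∂_i u_j` and `∂_j u_i` differentiated in `l` are
  -- matched by swapping derivative indices with the four others; four of them cancel and two copies
  -- of `∂_j u_i * ∂_l Φ_l` are left, which explains the factor `1 / 2`.
  have s1 := H1.conv_grad_comm hΩ u (hsm l) (hcs l) (hp l) i j l
  have s2 := H1.conv_grad_comm hΩ u (hsm l) (hcs l) (hp l) j i l
  have s3 := H1.conv_grad_comm hΩ u (hsm l) (hcs l) (hp l) l i j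
  rw [s2, s3, s1]
  ring

/-- The sum of the norms of the components of a field and of its strain. -/
def kornSum {Ω : Set E3} (u : H1 Ω) : ℝ≥0∞ :=
  (∑ i, ‖H1.field u i‖ₑ) + ∑ i, ∑ j, ‖strain u i j‖ₑ

theorem enorm_field_le_kornSum {Ω : Set E3} (u : H1 Ω) (i : Fin 3) :
    ‖H1.field u i‖ₑ ≤ kornSum u :=
  (Finset.single_le_sum (f := fun i => ‖H1.field u i‖ₑ) (fun _ _ => zero_le)
    (Finset.mem_univ i)).trans le_self_add

theorem enorm_strain_le_kornSum {Ω : Set E3} (u : H1 Ω) (i j : Fin 3) :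
    ‖strain u i j‖ₑ ≤ kornSum u :=
  ((Finset.single_le_sum (f := fun j => ‖strain u i j‖ₑ) (fun _ _ => zero_le)
    (Finset.mem_univ j)).trans (Finset.single_le_sum (f := fun i => ∑ j, ‖strain u i j‖ₑ)
      (fun _ _ => zero_le) (Finset.mem_univ i))).trans le_add_self

/-- In `conv_grad_eq` the field term is a convolution at the fixed scale `b`, bounded by Young's
inequality, and the strain terms have multiplier bounds uniform in `a`. Independence of the constant
from `a` is what permits the limit of vanishing scale. -/
theorem exists_eLpNorm_conv_grad_le {Ω D : Set E3} (hΩ : MeasurableSet Ω) (hD : MeasurableSet D)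
    {k : E3 → ℂ} (hk : IsMollifier k) {b : ℝ} (hin : IsInward Ω D k b) :
    ∃ C : ℝ≥0, ∀ (u : H1 Ω) (i j : Fin 3), ∀ a ≤ b,
      eLpNorm (conv (extZero (H1.grad u i j)) (dil a k)) 2 (volume.restrict D)
        ≤ C * kornSum u := by
  obtain ⟨M, hM0, hM⟩ := exists_eLpNorm_conv_pd_potential_le hk.smooth hk.compact
  set N : ℝ := ∑ j, ∫ x, ‖pd j (dil b k) x‖ with hN
  have hNj : ∀ j, ∫ x, ‖pd j (dil b k) x‖ ≤ N := fun j =>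
    Finset.single_le_sum (f := fun j => ∫ x, ‖pd j (dil b k) x‖)
      (fun _ _ => integral_nonneg fun _ => norm_nonneg _) (Finset.mem_univ j)
  -- The nine counts three values of `l` with three strain convolutions each.
  refine ⟨N.toNNReal + 9 * M.toNNReal, fun u i j a hab => ?_⟩
  have hkb := hk.dil b
  have hsm := fun l => contDiff_potential hk.smooth a b l
  have hcs := fun l => hasCompactSupport_potential hk.compact hab l
  have hmeas : ∀ (f : L2 Ω) (m l : Fin 3), AEStronglyMeasurable
      (conv (extZero f) (pd m (potential a b k l))) volume := fun f m l =>
    (contDiff_conv (memLp_extZero hΩ f) (contDiff_pd (hsm l) m)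
      (hasCompactSupport_pd (hcs l) m)).continuous.aestronglyMeasurable
  have hbd : ∀ (f : L2 Ω) (m l : Fin 3), ‖f‖ₑ ≤ kornSum u →
      eLpNorm (conv (extZero f) (pd m (potential a b k l))) 2 volume
        ≤ ENNReal.ofReal M * kornSum u := by
    intro f m l hf
    refine (hM l m a b hab _ (memLp_extZero hΩ f)).trans ?_
    rw [eLpNorm_extZero hΩ]
    gcongr
  set F₁ : E3 → ℂ := conv (extZero (H1.field u i)) (pd j (dil b k)) with hF₁
  set F₂ : Fin 3 → E3 → ℂ := fun l => (1 / 2 : ℂ) •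
    (conv (extZero (strain u i j)) (pd l (potential a b k l))
      + conv (extZero (strain u l i)) (pd j (potential a b k l))
      - conv (extZero (strain u l j)) (pd i (potential a b k l))) with hF₂
  have mF₂ : ∀ l, AEStronglyMeasurable (F₂ l) volume := fun l =>
    (((hmeas _ _ _).add (hmeas _ _ _)).sub (hmeas _ _ _)).const_smul _
  have bF₂ : ∀ l, eLpNorm (F₂ l) 2 volume ≤ 3 * (ENNReal.ofReal M * kornSum u) := by
    intro l
    rw [hF₂]
    simp only
    rw [eLpNorm_const_smul]
    have h1 : ‖(1 / 2 : ℂ)‖ₑ ≤ 1 := by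
      rw [← ofReal_norm, ENNReal.ofReal_le_one]
      norm_num
    refine (mul_le_of_le_one_left' h1).trans ?_
    refine (eLpNorm_sub_le ((hmeas _ _ _).add (hmeas _ _ _)) (hmeas _ _ _) (by norm_num)).trans ?_
    refine (add_le_add_left (eLpNorm_add_le (hmeas _ _ _) (hmeas _ _ _) (by norm_num)) _).trans ?_
    refine (add_le_add (add_le_add (hbd _ _ _ (enorm_strain_le_kornSum u _ _))
      (hbd _ _ _ (enorm_strain_le_kornSum u _ _)))
      (hbd _ _ _ (enorm_strain_le_kornSum u _ _))).trans (le_of_eq ?_)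
    ring
  have mF₁ : AEStronglyMeasurable F₁ volume :=
    (contDiff_conv (memLp_extZero hΩ _) (contDiff_pd hkb.smooth j)
      (hasCompactSupport_pd hkb.compact j)).continuous.aestronglyMeasurable
  have bF₁ : eLpNorm F₁ 2 volume ≤ ENNReal.ofReal N * kornSum u := by
    refine (eLpNorm_conv_le_integral (memLp_extZero hΩ _) (contDiff_pd hkb.smooth j)
      (hasCompactSupport_pd hkb.compact j)).trans ?_
    rw [eLpNorm_extZero hΩ]
    exact mul_le_mul' (ENNReal.ofReal_le_ofReal (hNj j)) (enorm_field_le_kornSum u i)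
  have heq : conv (extZero (H1.grad u i j)) (dil a k) =ᵐ[volume.restrict D] F₁ + ∑ l, F₂ l := by
    refine (ae_restrict_iff' hD).2 (ae_of_all _ fun x hx => ?_)
    rw [conv_grad_eq hΩ hk.smooth hk.compact hab hin u i j hx]
    simp [hF₁, hF₂]
  rw [eLpNorm_congr_ae heq]
  refine (eLpNorm_mono_measure _ Measure.restrict_le_self).trans ?_
  refine (eLpNorm_add_le mF₁ (Finset.aestronglyMeasurable_sum _ fun l _ => mF₂ l)
    (by norm_num)).trans ?_
  refine (add_le_add bF₁ ((eLpNorm_sum_le (fun l _ => mF₂ l) (by norm_num)).trans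
    (Finset.sum_le_card_nsmul _ _ _ fun l _ => bF₂ l))).trans (le_of_eq ?_)
  simp only [Finset.card_univ, Fintype.card_fin, ENNReal.ofReal, nsmul_eq_mul]
  push_cast
  ring

/-- Korn's inequality near a point of the closure. -/
theorem exists_eLpNorm_grad_le {Ω D : Set E3} (hΩ : MeasurableSet Ω) (hD : MeasurableSet D)
    (hDΩ : D ⊆ Ω) {k : E3 → ℂ} (hk : IsMollifier k) {b : ℝ} (hin : IsInward Ω D k b) :
    ∃ C : ℝ≥0, ∀ (u : H1 Ω) (i j : Fin 3),
      eLpNorm (H1.grad u i j) 2 (volume.restrict D) ≤ C * kornSum u := by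
  obtain ⟨C, hC⟩ := exists_eLpNorm_conv_grad_le hΩ hD hk hin
  refine ⟨C, fun u i j => ?_⟩
  have hmem := memLp_extZero hΩ (H1.grad u i j)
  have hlim := (tendsto_conv_dil hk hmem).add_const (C * kornSum u)
  rw [zero_add] at hlim
  -- For each small scale the gradient is its mollification minus the mollification error. The
  -- former is bounded uniformly, and the latter tends to zero as the scale does.
  refine ge_of_tendsto hlim ?_
  filter_upwards [eventually_le_atBot b] with a ha
  set g := extZero (H1.grad u i j) with hg
  have hga : H1.grad u i j =ᵐ[volume.restrict D]
      conv g (dil a k) - fun x => conv g (dil a k) x - g x := by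
    refine (ae_restrict_iff' hD).2 (ae_of_all _ fun x hx => ?_)
    simp [hg, extZero, hDΩ hx]
  have m1 : AEStronglyMeasurable (conv g (dil a k)) volume :=
    (contDiff_conv hmem (hk.dil a).smooth (hk.dil a).compact).continuous.aestronglyMeasurable
  have m2 : AEStronglyMeasurable (fun x => conv g (dil a k) x - g x) volume := m1.sub hmem.1
  rw [eLpNorm_congr_ae hga, add_comm]
  refine (eLpNorm_sub_le m1.restrict m2.restrict (by norm_num)).trans ?_
  exact add_le_add (hC u i j a ha) (eLpNorm_mono_measure _ Measure.restrict_le_self)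

theorem eLpNorm_restrict_union_le {f : E3 → ℂ} {A B : Set E3} (hA : MeasurableSet A)
    (hB : MeasurableSet B) (hf : AEStronglyMeasurable f (volume.restrict (A ∪ B))) :
    eLpNorm f 2 (volume.restrict (A ∪ B))
      ≤ eLpNorm f 2 (volume.restrict A) + eLpNorm f 2 (volume.restrict B) := by
  rw [← eLpNorm_indicator_eq_eLpNorm_restrict (hA.union hB), ← union_sdiff_self,
    indicator_union_of_disjoint disjoint_sdiff_right]
  refine (eLpNorm_add_le ?_ ?_ (by norm_num)).trans ?_
  · exact (aestronglyMeasurable_indicator_iff hA).2 (hf.mono_set subset_union_left)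
  · exact (aestronglyMeasurable_indicator_iff (hB.diff hA)).2
      (hf.mono_set (sdiff_subset.trans subset_union_right))
  · rw [eLpNorm_indicator_eq_eLpNorm_restrict hA,
      eLpNorm_indicator_eq_eLpNorm_restrict (hB.diff hA)]
    gcongr
    exact sdiff_subset

theorem IsBoundedLipschitzDomain.isCompact_closure {Ω : Set E3} (h : IsBoundedLipschitzDomain Ω) :
    IsCompact (closure Ω) :=
  h.isBounded.isCompact_closure

/-- Every point of the compact closure has a ball where the local estimate holds, and constants add
over a finite cover. -/
theorem IsBoundedLipschitzDomain.exists_enorm_grad_le {Ω : Set E3}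
    (h : IsBoundedLipschitzDomain Ω) :
    ∃ C : ℝ≥0, ∀ (u : H1 Ω) (i j : Fin 3), ‖H1.grad u i j‖ₑ ≤ C * kornSum u := by
  have hΩ := h.isOpen.measurableSet
  have key : ∃ C : ℝ≥0, ∃ A : Set E3, MeasurableSet A ∧ closure Ω ⊆ A ∧
      ∀ (u : H1 Ω) (i j : Fin 3),
        eLpNorm (H1.grad u i j) 2 (volume.restrict (Ω ∩ A)) ≤ C * kornSum u := by
    -- Compactness induction runs over arbitrary sets, so the predicate carries a measurable
    -- superset on which the norm can be restricted.
    refine h.isCompact_closure.induction_on (p := fun s => ∃ C : ℝ≥0, ∃ A : Set E3,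
      MeasurableSet A ∧ s ⊆ A ∧ ∀ (u : H1 Ω) (i j : Fin 3),
        eLpNorm (H1.grad u i j) 2 (volume.restrict (Ω ∩ A)) ≤ C * kornSum u) ?_ ?_ ?_ ?_
    · exact ⟨0, ∅, MeasurableSet.empty, subset_rfl, by simp⟩
    · rintro s t hst ⟨C, A, hA, htA, hC⟩
      exact ⟨C, A, hA, hst.trans htA, hC⟩
    · rintro s t ⟨C, A, hA, hsA, hC⟩ ⟨C', A', hA', htA', hC'⟩
      refine ⟨C + C', A ∪ A', hA.union hA', union_subset_union hsA htA', fun u i j => ?_⟩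
      rw [inter_union_distrib_left]
      refine (eLpNorm_restrict_union_le (hΩ.inter hA) (hΩ.inter hA') ?_).trans ?_
      · exact (Lp.aestronglyMeasurable _).mono_set (union_subset inter_subset_left inter_subset_left)
      · rw [ENNReal.coe_add, add_mul]
        exact add_le_add (hC u i j) (hC' u i j)
    · intro x hx
      obtain ⟨k, hk, r, hr, b, hin⟩ := h.exists_isInward hx
      obtain ⟨C, hC⟩ := exists_eLpNorm_grad_le hΩ (hΩ.inter measurableSet_ball) inter_subset_left
        hk hin
      exact ⟨_, mem_nhdsWithin_of_mem_nhds (Metric.ball_mem_nhds x hr), C, _, measurableSet_ball,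
        subset_rfl, hC⟩
  obtain ⟨C, A, -, hA, hC⟩ := key
  refine ⟨C, fun u i j => ?_⟩
  have := hC u i j
  rwa [inter_eq_left.2 (subset_closure.trans hA), ← Lp.enorm_def] at this

theorem H1.norm_sq_eq {Ω : Set E3} (u : H1 Ω) :
    ‖u‖ ^ 2 = ‖H1.field u‖ ^ 2 + ∑ i, ∑ j, ‖H1.grad u i j‖ ^ 2 := by
  rw [← Submodule.norm_coe, WithLp.prod_norm_sq_eq_of_L2]
  congr 1
  rw [PiLp.norm_sq_eq_of_L2]
  exact Finset.sum_congr rfl fun i _ => PiLp.norm_sq_eq_of_L2 _ _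

/-- Korn's second inequality on a bounded Lipschitz domain. -/
theorem IsBoundedLipschitzDomain.korn {Ω : Set E3} (h : IsBoundedLipschitzDomain Ω) :
    ∃ C : ℝ, 0 < C ∧ ∀ u : H1 Ω,
      ‖u‖ ^ 2 ≤ C * (‖H1.field u‖ ^ 2 + ∑ i, ∑ j, ‖strain u i j‖ ^ 2) := by
  obtain ⟨C, hC⟩ := h.exists_enorm_grad_le
  -- Twelve is the number of summands in `kornSum` (three components, nine strains), each at most
  -- `√Q`; nine is the number of gradient entries.
  refine ⟨1 + 9 * (C * 12) ^ 2, by positivity, fun u => ?_⟩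
  set Q := ‖H1.field u‖ ^ 2 + ∑ i, ∑ j, ‖strain u i j‖ ^ 2 with hQ
  have hQ0 : 0 ≤ Q := by positivity
  have h1 : ∀ i, ‖H1.field u i‖ ≤ √Q := by
    intro i
    refine Real.le_sqrt_of_sq_le ?_
    have h2 : ‖H1.field u i‖ ^ 2 ≤ ‖H1.field u‖ ^ 2 :=
      pow_le_pow_left₀ (norm_nonneg _) (PiLp.norm_apply_le _ i) 2
    exact h2.trans (le_add_of_nonneg_right (by positivity))
  have h2 : ∀ i j, ‖strain u i j‖ ≤ √Q := by
    intro i j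
    refine Real.le_sqrt_of_sq_le ?_
    refine ((Finset.single_le_sum (f := fun j => ‖strain u i j‖ ^ 2) (fun _ _ => by positivity)
      (Finset.mem_univ j)).trans (Finset.single_le_sum (f := fun i => ∑ j, ‖strain u i j‖ ^ 2)
      (fun _ _ => by positivity) (Finset.mem_univ i))).trans (le_add_of_nonneg_left (by positivity))
  have h3 : kornSum u ≤ ENNReal.ofReal (12 * √Q) := by
    have e1 : ∀ f : L2 Ω, ‖f‖ ≤ √Q → ‖f‖ₑ ≤ ENNReal.ofReal √Q := by
      intro f hf
      rw [← ofReal_norm]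
      exact ENNReal.ofReal_le_ofReal hf
    refine (add_le_add (Finset.sum_le_card_nsmul _ _ _ fun i _ => e1 _ (h1 i))
      (Finset.sum_le_card_nsmul _ _ _ fun i _ =>
        Finset.sum_le_card_nsmul _ _ _ fun j _ => e1 _ (h2 i j))).trans (le_of_eq ?_)
    rw [ENNReal.ofReal_mul (by norm_num)]
    simp only [Finset.card_univ, Fintype.card_fin, nsmul_eq_mul, ENNReal.ofReal_ofNat]
    push_cast
    ring
  have h4 : ∀ i j, ‖H1.grad u i j‖ ≤ C * 12 * √Q := by
    intro i j
    have h5 := (hC u i j).trans (mul_le_mul_right h3 _)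
    rw [← ofReal_norm, ← ENNReal.ofReal_coe_nnreal, ← ENNReal.ofReal_mul (NNReal.coe_nonneg C),
      ENNReal.ofReal_le_ofReal_iff (by positivity)] at h5
    linarith
  have h5 : ∀ i j, ‖H1.grad u i j‖ ^ 2 ≤ (C * 12) ^ 2 * Q := by
    intro i j
    refine (pow_le_pow_left₀ (norm_nonneg _) (h4 i j) 2).trans (le_of_eq ?_)
    rw [mul_pow, Real.sq_sqrt hQ0]
  rw [H1.norm_sq_eq]
  have h6 : ∑ i, ∑ j, ‖H1.grad u i j‖ ^ 2 ≤ 9 * ((C * 12) ^ 2 * Q) := by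
    refine (Finset.sum_le_card_nsmul _ _ _ fun i _ =>
      Finset.sum_le_card_nsmul _ _ _ fun j _ => h5 i j).trans (le_of_eq ?_)
    simp only [Finset.card_univ, Fintype.card_fin, nsmul_eq_mul]
    push_cast
    ring
  have h7 : ‖H1.field u‖ ^ 2 ≤ Q := le_add_of_nonneg_right (by positivity)
  linarith

/-! ### Smooth fields as elements of `𝐇¹(Ω)` -/

theorem memLp_of_continuous {Ω : Set E3} (hb : Bornology.IsBounded Ω) {v : E3 → ℂ}
    (hv : Continuous v) : MemLp v 2 (volume.restrict Ω) := by
  obtain ⟨M, hM⟩ := hb.isCompact_closure.exists_bound_of_continuousOn hv.continuousOn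
  refine MemLp.mono_measure (Measure.restrict_mono subset_closure le_rfl) ?_
  have : IsFiniteMeasure (volume.restrict (closure Ω)) :=
    ⟨by simpa using hb.isCompact_closure.measure_lt_top⟩
  exact MemLp.of_bound hv.aestronglyMeasurable M
    ((ae_restrict_iff' isClosed_closure.measurableSet).2 (ae_of_all _ hM))

theorem setIntegral_eq_integral_test {Ω : Set E3} {φ : E3 → ℂ} (hφ : IsTest Ω φ) (f : E3 → ℂ) :
    ∫ x in Ω, f x * φ x = ∫ x, f x * φ x := by
  refine setIntegral_eq_integral_of_forall_compl_eq_zero fun x hx => ?_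
  rw [image_eq_zero_of_notMem_tsupport fun h => hx (hφ.support h), mul_zero]

/-- The test function vanishes outside `Ω`, so this is integration by parts on the whole space and
involves no boundary of `Ω`. -/
theorem integral_mul_pd_eq_neg {Ω : Set E3} {v φ : E3 → ℂ} (hv : ContDiff ℝ ∞ v)
    (hφ : IsTest Ω φ) (j : Fin 3) :
    ∫ x in Ω, v x * pd j φ x = -∫ x in Ω, pd j v x * φ x := by
  rw [setIntegral_eq_integral_test (hφ.pd j), setIntegral_eq_integral_test hφ]
  have hi : ∀ {f g : E3 → ℂ}, Continuous f → Continuous g → HasCompactSupport g →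
      Integrable fun x => f x * g x := fun hf hg hc =>
    (hf.mul hg).integrable_of_hasCompactSupport hc.mul_left
  exact integral_mul_fderiv_eq_neg_fderiv_mul_of_integrable
    (hi (contDiff_pd hv j).continuous hφ.smooth.continuous hφ.compact)
    (hi hv.continuous (hφ.pd j).smooth.continuous (hφ.pd j).compact)
    (hi hv.continuous hφ.smooth.continuous hφ.compact)
    (fun x _ => hv.differentiable (by simp) x) fun x _ => hφ.smooth.differentiable (by simp) x

theorem exists_H1_of_contDiff {Ω : Set E3} (hb : Bornology.IsBounded Ω) {v : Fin 3 → E3 → ℂ}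
    (hv : ∀ i, ContDiff ℝ ∞ (v i)) : ∃ V : H1 Ω,
      (∀ i, H1.field V i =ᵐ[volume.restrict Ω] v i) ∧
      ∀ i j, H1.grad V i j =ᵐ[volume.restrict Ω] pd j (v i) := by
  have h1 : ∀ i, MemLp (v i) 2 (volume.restrict Ω) := fun i =>
    memLp_of_continuous hb (hv i).continuous
  have h2 : ∀ i j, MemLp (pd j (v i)) 2 (volume.restrict Ω) := fun i j =>
    memLp_of_continuous hb (contDiff_pd (hv i) j).continuous
  refine ⟨⟨WithLp.toLp 2 (WithLp.toLp 2 fun i => (h1 i).toLp,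
    WithLp.toLp 2 fun i => WithLp.toLp 2 fun j => (h2 i j).toLp), ?_⟩,
    fun i => (h1 i).coeFn_toLp, fun i j => (h2 i j).coeFn_toLp⟩
  intro i j φ hφ
  have e1 : ∫ x in Ω, (h1 i).toLp (v i) x * pd j φ x = ∫ x in Ω, v i x * pd j φ x := by
    refine integral_congr_ae ?_
    filter_upwards [(h1 i).coeFn_toLp] with x hx
    rw [hx]
  have e2 : ∫ x in Ω, (h2 i j).toLp (pd j (v i)) x * φ x = ∫ x in Ω, pd j (v i) x * φ x := by
    refine integral_congr_ae ?_
    filter_upwards [(h2 i j).coeFn_toLp] with x hx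
    rw [hx]
  exact e1.trans ((integral_mul_pd_eq_neg (hv i) hφ j).trans (congrArg _ e2.symm))

/-! ### Multiplication by smooth functions -/

theorem IsTest.memLp_top {χ : E3 → ℂ} (hχ : IsTest univ χ) (μ : Measure E3) : MemLp χ ⊤ μ := by
  obtain ⟨M, hM⟩ := hχ.compact.exists_bound_of_continuous hχ.smooth.continuous
  exact memLp_top_of_bound hχ.smooth.continuous.aestronglyMeasurable M (ae_of_all _ hM)

/-- The product of a smooth compactly supported function and a function in `L²(Ω)`. -/
def mulL2 {Ω : Set E3} {χ : E3 → ℂ} (hχ : IsTest univ χ) (f : L2 Ω) : L2 Ω :=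
  ((Lp.memLp f).mul (r := 2) (hχ.memLp_top _)).toLp (χ * ⇑f)

theorem coeFn_mulL2 {Ω : Set E3} {χ : E3 → ℂ} (hχ : IsTest univ χ) (f : L2 Ω) :
    mulL2 hχ f =ᵐ[volume.restrict Ω] fun x => χ x * f x := MemLp.coeFn_toLp _

theorem IsTest.mul_left {Ω : Set E3} {χ φ : E3 → ℂ} (hχ : IsTest univ χ) (hφ : IsTest Ω φ) :
    IsTest Ω fun x => χ x * φ x where
  smooth := hχ.smooth.mul hφ.smooth
  compact := hφ.compact.mul_left
  support := (tsupport_mul_subset_right (f := χ) (g := φ)).trans hφ.support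

theorem integral_mulL2 {Ω : Set E3} {χ : E3 → ℂ} (hχ : IsTest univ χ) (f : L2 Ω) (φ : E3 → ℂ) :
    ∫ x in Ω, mulL2 hχ f x * φ x = ∫ x in Ω, f x * (χ x * φ x) := by
  refine integral_congr_ae ?_
  filter_upwards [coeFn_mulL2 hχ f] with x hx
  rw [hx]
  ring

theorem pd_mul {χ φ : E3 → ℂ} (hχ : ContDiff ℝ ∞ χ) (hφ : ContDiff ℝ ∞ φ) (j : Fin 3) (x : E3) :
    pd j (fun x => χ x * φ x) x = χ x * pd j φ x + pd j χ x * φ x := by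
  have h := ((hχ.differentiable (by simp) x).hasFDerivAt).mul
    ((hφ.differentiable (by simp) x).hasFDerivAt)
  have h' : HasFDerivAt (fun x => χ x * φ x) _ x := h
  rw [pd, h'.fderiv]
  simp [pd]
  ring

theorem integrable_L2_mul_test {Ω Ω' : Set E3} (f : L2 Ω) {φ : E3 → ℂ} (hφ : IsTest Ω' φ) :
    Integrable (fun x => f x * φ x) (volume.restrict Ω) :=
  (Lp.memLp f).integrable_mul
    ((hφ.smooth.continuous.memLp_of_hasCompactSupport (p := 2) hφ.compact).restrict Ω)

/-- The weak curl of the product of a smooth function and a field in `H(curl, Ω)`. -/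
theorem HasWeakCurl.mulL2 {Ω : Set E3} {w c : L2V Ω} (h : HasWeakCurl Ω w c) {χ : E3 → ℂ}
    (hχ : IsTest univ χ) :
    HasWeakCurl Ω (WithLp.toLp 2 fun i => mulL2 hχ (w i)) (WithLp.toLp 2 fun i =>
      MaxwellNavier.mulL2 hχ (c i) + (MaxwellNavier.mulL2 (hχ.pd (i + 1)) (w (i + 2))
        - MaxwellNavier.mulL2 (hχ.pd (i + 2)) (w (i + 1)))) := by
  intro Φ hΦ
  have h1 := h (fun i x => χ x * Φ i x) fun i => hχ.mul_left (hΦ i)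
  have hT : ∀ i j, IsTest Ω fun x => pd j χ x * Φ i x := fun i j => (hχ.pd j).mul_left (hΦ i)
  -- Expand `curl (χΦ) = χ curl Φ + ∇χ × Φ`. After summation over `i`, shifting `∇χ ×` from `Φ` to
  -- `w` reverses its sign.
  have e1 : ∀ i, ∫ x in Ω, w i x * curlFun (fun i x => χ x * Φ i x) i x
      = (∫ x in Ω, w i x * (χ x * curlFun Φ i x))
        + ((∫ x in Ω, w i x * (pd (i + 1) χ x * Φ (i + 2) x))
          - ∫ x in Ω, w i x * (pd (i + 2) χ x * Φ (i + 1) x)) := by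
    intro i
    have i1 := integrable_L2_mul_test (w i) (hT (i + 2) (i + 1))
    have i2 := integrable_L2_mul_test (w i) (hT (i + 1) (i + 2))
    have i3 := i1.sub i2
    have i4 := integrable_L2_mul_test (w i) (hχ.mul_left (isTest_curlFun hΦ i))
    rw [← integral_sub i1 i2]
    refine Eq.trans ?_ (integral_add i4 i3)
    congr 1 with x
    simp only [curlFun, pd_mul hχ.smooth (hΦ _).smooth]
    ring
  have e2 : ∀ i, ∫ x in Ω, (MaxwellNavier.mulL2 hχ (c i)
      + (MaxwellNavier.mulL2 (hχ.pd (i + 1)) (w (i + 2))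
        - MaxwellNavier.mulL2 (hχ.pd (i + 2)) (w (i + 1)))) x * Φ i x
      = (∫ x in Ω, c i x * (χ x * Φ i x)) + ((∫ x in Ω, w (i + 2) x * (pd (i + 1) χ x * Φ i x))
        - ∫ x in Ω, w (i + 1) x * (pd (i + 2) χ x * Φ i x)) := by
    intro i
    rw [integral_add_test _ _ (hΦ i), integral_sub_test _ _ (hΦ i), integral_mulL2, integral_mulL2,
      integral_mulL2]
  simp only [e2, integral_mulL2]
  simp only [e1] at h1
  simp only [Fin.sum_univ_three, Fin.isValue, show (0 : Fin 3) + 1 = 1 from rfl,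
    show (0 : Fin 3) + 2 = 2 from rfl, show (1 : Fin 3) + 1 = 2 from rfl,
    show (1 : Fin 3) + 2 = 0 from rfl, show (2 : Fin 3) + 1 = 0 from rfl,
    show (2 : Fin 3) + 2 = 1 from rfl] at h1 ⊢
  linear_combination h1

/-- The product of a smooth function and a field in `H(curl, Ω)`. -/
def mulHCurl {Ω : Set E3} {χ : E3 → ℂ} (hχ : IsTest univ χ) (w : HCurl Ω) : HCurl Ω :=
  ⟨WithLp.toLp 2 (WithLp.toLp 2 fun i => mulL2 hχ (HCurl.field w i), WithLp.toLp 2 fun i =>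
      mulL2 hχ (HCurl.curl w i) + (mulL2 (hχ.pd (i + 1)) (HCurl.field w (i + 2))
        - mulL2 (hχ.pd (i + 2)) (HCurl.field w (i + 1)))),
    HasWeakCurl.mulL2 w.2 hχ⟩

theorem field_mulHCurl {Ω : Set E3} {χ : E3 → ℂ} (hχ : IsTest univ χ) (w : HCurl Ω) (i : Fin 3) :
    HCurl.field (mulHCurl hχ w) i =ᵐ[volume.restrict Ω] fun x => χ x * HCurl.field w i x :=
  coeFn_mulL2 hχ _

theorem curl_mulHCurl {Ω : Set E3} {χ : E3 → ℂ} (hχ : IsTest univ χ) (w : HCurl Ω) (i : Fin 3) :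
    HCurl.curl (mulHCurl hχ w) i =ᵐ[volume.restrict Ω] fun x => χ x * HCurl.curl w i x
      + (pd (i + 1) χ x * HCurl.field w (i + 2) x - pd (i + 2) χ x * HCurl.field w (i + 1) x) := by
  have h1 : HCurl.curl (mulHCurl hχ w) i =ᵐ[volume.restrict Ω] _ := Lp.coeFn_add _ _
  filter_upwards [h1, coeFn_mulL2 hχ (HCurl.curl w i), coeFn_mulL2 (hχ.pd (i + 1))
    (HCurl.field w (i + 2)), coeFn_mulL2 (hχ.pd (i + 2)) (HCurl.field w (i + 1)),
    Lp.coeFn_sub (mulL2 (hχ.pd (i + 1)) (HCurl.field w (i + 2)))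
      (mulL2 (hχ.pd (i + 2)) (HCurl.field w (i + 1)))] with x h1 h2 h3 h4 h5
  rw [h1, Pi.add_apply, h2, h5, Pi.sub_apply, h3, h4]

/-! ### Density of `𝐇¹(Ω)` in `H(curl, Ω)` -/

/-- The test field has the reflected kernel as its only nonzero component, in position `i`; the
reflection reverses the sign of its derivatives. -/
theorem HasWeakCurl.conv_eq {Ω : Set E3} (hΩ : MeasurableSet Ω) {w c : L2V Ω}
    (h : HasWeakCurl Ω w c) {q : E3 → ℂ} (hq : ContDiff ℝ ∞ q) (hc : HasCompactSupport q)
    {x : E3} (hx : ∀ z ∈ tsupport q, x - z ∈ Ω) (i : Fin 3) :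
    conv (extZero (w (i + 2))) (pd (i + 1) q) x - conv (extZero (w (i + 1))) (pd (i + 2) q) x
      = conv (extZero (c i)) q x := by
  have hT := isTest_comp_sub hq hc hx
  have h0 : IsTest Ω fun _ => (0 : ℂ) := ⟨contDiff_const, HasCompactSupport.zero, by
    rw [show (fun _ : E3 => (0 : ℂ)) = 0 from rfl, tsupport_zero]
    exact empty_subset _⟩
  have hΦ := h (Pi.single i fun y => q (x - y)) fun j => by
    rcases eq_or_ne j i with rfl | hj
    · simpa using hT
    · simpa [hj] using! h0
  have hz : ∀ a y, pd a (0 : E3 → ℂ) y = 0 := by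
    intro a y
    simp [pd]
  have e : ∀ g : L2 Ω, ∀ a, ∫ y in Ω, g y * pd a (fun y => q (x - y)) y
      = -conv (extZero g) (pd a q) x := by
    intro g a
    simp only [pd_comp_sub hq, mul_neg, integral_neg]
    rw [conv_extZero hΩ]
  rw [conv_extZero hΩ (c i)]
  fin_cases i <;>
  · simp [Fin.sum_univ_three, curlFun, hz, e, show (0 : Fin 3) + 1 = 1 from rfl,
      show (0 : Fin 3) + 2 = 2 from rfl, show (1 : Fin 3) + 1 = 2 from rfl,
      show (1 : Fin 3) + 2 = 0 from rfl, show (2 : Fin 3) + 1 = 0 from rfl,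
      show (2 : Fin 3) + 2 = 1 from rfl, integral_neg] at hΦ ⊢
    linear_combination hΦ

theorem tendsto_of_ae_eq_conv {Ω : Set E3} (hΩ : MeasurableSet Ω) {k : E3 → ℂ} (hk : IsMollifier k)
    (f : L2 Ω) {F : ℝ → L2 Ω}
    (hF : ∀ᶠ s in atBot, F s =ᵐ[volume.restrict Ω] conv (extZero f) (dil s k)) :
    Tendsto F atBot (𝓝 f) := by
  rw [Lp.tendsto_Lp_iff_tendsto_eLpNorm']
  refine tendsto_of_tendsto_of_tendsto_of_le_of_le' tendsto_const_nhds
    (tendsto_conv_dil hk (memLp_extZero hΩ f)) (Eventually.of_forall fun _ => zero_le) ?_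
  filter_upwards [hF] with s hs
  have h : ⇑(F s) - ⇑f =ᵐ[volume.restrict Ω]
      fun x => conv (extZero f) (dil s k) x - extZero f x := by
    filter_upwards [hs, ae_restrict_mem hΩ] with x hx hxΩ
    simp [hx, extZero, hxΩ]
  rw [eLpNorm_congr_ae h]
  exact eLpNorm_mono_measure _ Measure.restrict_le_self

theorem HCurl.tendsto_of_components {Ω : Set E3} {F : ℝ → HCurl Ω} {w : HCurl Ω} {l : Filter ℝ}
    (h1 : ∀ i, Tendsto (fun s => HCurl.field (F s) i) l (𝓝 (HCurl.field w i)))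
    (h2 : ∀ i, Tendsto (fun s => HCurl.curl (F s) i) l (𝓝 (HCurl.curl w i))) :
    Tendsto F l (𝓝 w) := by
  rw [tendsto_subtype_rng]
  have key : ∀ {G : ℝ → L2V Ω} {g : L2V Ω}, (∀ i, Tendsto (fun s => G s i) l (𝓝 (g i))) →
      Tendsto G l (𝓝 g) := fun h =>
    ((PiLp.continuous_toLp 2 _).tendsto _).comp (tendsto_pi_nhds.2 h)
  exact ((WithLp.prod_continuous_toLp 2 (L2V Ω) (L2V Ω)).tendsto _).comp
    ((key h1).prodMk_nhds (key h2))

theorem conv_eq_zero_of_dist {Ω : Set E3} (hΩ : MeasurableSet Ω) {f : L2 Ω} {q : E3 → ℂ}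
    {x₀ x : E3} {r : ℝ} (hf : ∀ᵐ y ∂(volume.restrict Ω), f y ≠ 0 → y ∈ Metric.ball x₀ (r / 2))
    (hq : ∀ z ∈ tsupport q, ‖z‖ < r / 2) (hx : x ∉ Metric.ball x₀ r) :
    conv (extZero f) q x = 0 := by
  rw [conv_extZero hΩ]
  refine integral_eq_zero_of_ae ?_
  filter_upwards [hf] with y hy
  by_contra hne
  have h1 := Metric.mem_ball.1 (hy (left_ne_zero_of_mul hne))
  have h2 := hq _ (subset_tsupport _ (right_ne_zero_of_mul hne))
  rw [← dist_eq_norm] at h2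
  refine hx (Metric.mem_ball.2 ?_)
  linarith [dist_triangle x y x₀]

/-- Fields in `H(curl, Ω)` supported near a point of the closure are limits of smooth fields. -/
theorem mulHCurl_mem_closure {Ω : Set E3} (hΩ : MeasurableSet Ω) (hb : Bornology.IsBounded Ω)
    {k : E3 → ℂ} (hk : IsMollifier k) {x₀ : E3} {r b : ℝ} (hr : 0 < r)
    (hin : IsInward Ω (Ω ∩ Metric.ball x₀ r) k b) {χ : E3 → ℂ} (hχ : IsTest univ χ)
    (hsupp : tsupport χ ⊆ Metric.ball x₀ (r / 2)) (w : HCurl Ω) :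
    mulHCurl hχ w ∈ closure (range (H1.toHCurl (Ω := Ω))) := by
  set z := mulHCurl hχ w with hz
  have hχ0 : ∀ y, y ∉ Metric.ball x₀ (r / 2) → χ y = 0 := fun y hy =>
    image_eq_zero_of_notMem_tsupport fun h => hy (hsupp h)
  have hpd0 : ∀ j y, y ∉ Metric.ball x₀ (r / 2) → pd j χ y = 0 := fun j y hy =>
    image_eq_zero_of_notMem_tsupport fun h => hy (hsupp (tsupport_pd_subset χ j h))
  have hzf : ∀ i, ∀ᵐ y ∂(volume.restrict Ω),
      HCurl.field z i y ≠ 0 → y ∈ Metric.ball x₀ (r / 2) := by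
    intro i
    filter_upwards [field_mulHCurl hχ w i] with y hy hne
    by_contra hcon
    exact hne (by rw [hz, hy, hχ0 y hcon, zero_mul])
  have hzc : ∀ i, ∀ᵐ y ∂(volume.restrict Ω),
      HCurl.curl z i y ≠ 0 → y ∈ Metric.ball x₀ (r / 2) := by
    intro i
    filter_upwards [curl_mulHCurl hχ w i] with y hy hne
    by_contra hcon
    exact hne (by rw [hz, hy, hχ0 y hcon, hpd0 _ y hcon, hpd0 _ y hcon]; ring)
  have hV : ∀ s, ∃ V : H1 Ω,
      (∀ i, H1.field V i =ᵐ[volume.restrict Ω] conv (extZero (HCurl.field z i)) (dil s k)) ∧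
      ∀ i j, H1.grad V i j =ᵐ[volume.restrict Ω]
        pd j (conv (extZero (HCurl.field z i)) (dil s k)) := fun s =>
    exists_H1_of_contDiff hb fun i =>
      contDiff_conv (memLp_extZero hΩ _) (hk.dil s).smooth (hk.dil s).compact
  choose V hVf hVg using hV
  obtain ⟨R, hR0, hR⟩ := hk.compact.isCompact.isBounded.exists_pos_norm_le
  have hlim : Tendsto (fun s => Real.exp s * R) atBot (𝓝 0) := by
    simpa using Real.tendsto_exp_atBot.mul_const R
  have hconv : Tendsto (fun s => H1.toHCurl (V s)) atBot (𝓝 z) := by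
    refine HCurl.tendsto_of_components (fun i => ?_) fun i => ?_
    · exact tendsto_of_ae_eq_conv hΩ hk _ (Eventually.of_forall fun s => hVf s i)
    · refine tendsto_of_ae_eq_conv hΩ hk _ ?_
      filter_upwards [eventually_le_atBot b, hlim.eventually_lt_const (half_pos hr)] with s hs hsr
      have hks := hk.dil s
      have hc : HCurl.curl (H1.toHCurl (V s)) i =ᵐ[volume.restrict Ω]
        ⇑(H1.grad (V s) (i + 2) (i + 1)) - ⇑(H1.grad (V s) (i + 1) (i + 2)) := Lp.coeFn_sub _ _
      filter_upwards [hc, hVg s (i + 2) (i + 1), hVg s (i + 1) (i + 2), ae_restrict_mem hΩ]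
        with x h1 h2 h3 hxΩ
      rw [h1, Pi.sub_apply, h2, h3, pd_conv (memLp_extZero hΩ _) hks.smooth hks.compact,
        pd_conv (memLp_extZero hΩ _) hks.smooth hks.compact]
      have hsm : ∀ y ∈ tsupport (dil s k), ‖y‖ < r / 2 := by
        intro y hy
        obtain ⟨y', hy', rfl⟩ := tsupport_dil_subset s hy
        simp only [norm_smul, Real.norm_of_nonneg (Real.exp_pos s).le]
        exact (mul_le_mul_of_nonneg_left (hR y' hy') (Real.exp_pos s).le).trans_lt hsr
      -- Inside the ball the kernel is inward, so mollification commutes with the weak curl. Outside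
      -- it everything vanishes: the field lives in the ball of radius `r / 2` and the kernel has
      -- radius less than `r / 2`.
      by_cases hxb : x ∈ Metric.ball x₀ r
      · refine HasWeakCurl.conv_eq hΩ z.2 hks.smooth hks.compact ?_ i
        intro y hy
        obtain ⟨y', hy', rfl⟩ := tsupport_dil_subset s hy
        exact hin x ⟨hxΩ, hxb⟩ s hs y' hy'
      · rw [conv_eq_zero_of_dist hΩ (hzc i) hsm hxb,
          conv_eq_zero_of_dist hΩ (hzf _) (fun y hy => hsm y (tsupport_pd_subset _ _ hy)) hxb,
          conv_eq_zero_of_dist hΩ (hzf _) (fun y hy => hsm y (tsupport_pd_subset _ _ hy)) hxb,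
          sub_zero]
  exact mem_closure_of_tendsto hconv (Eventually.of_forall fun s => mem_range_self _)

theorem exists_partition {Ω : Set E3} (hb : Bornology.IsBounded Ω) {U : E3 → Set E3}
    (hU : ∀ x, IsOpen (U x)) (hUb : ∀ x, Bornology.IsBounded (U x))
    (hx : ∀ x ∈ closure Ω, x ∈ U x) :
    ∃ (t : Finset E3) (χ : t → E3 → ℂ), (∀ i : t, (i : E3) ∈ closure Ω) ∧
      (∀ i, IsTest univ (χ i)) ∧ (∀ i : t, tsupport (χ i) ⊆ U i) ∧
      ∀ x ∈ closure Ω, ∑ i, χ i x = 1 := by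
  obtain ⟨t, ht, hcov⟩ := hb.isCompact_closure.elim_nhds_subcover U
    fun x hxc => (hU x).mem_nhds (hx x hxc)
  have hcov' : closure Ω ⊆ ⋃ i : t, U i := by
    intro x hxc
    obtain ⟨i, hi, hxi⟩ := mem_iUnion₂.1 (hcov hxc)
    exact mem_iUnion.2 ⟨⟨i, hi⟩, hxi⟩
  obtain ⟨f, hf⟩ := SmoothPartitionOfUnity.exists_isSubordinate (modelWithCornersSelf ℝ E3)
    (isClosed_closure (s := Ω)) (fun i : t => U i) (fun i => hU i) hcov'
  have hsub : ∀ i : t, tsupport (fun x => (f i x : ℂ)) ⊆ U i := by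
    intro i
    refine (closure_mono ?_).trans (hf i)
    intro x hx
    simpa using hx
  refine ⟨t, fun i x => (f i x : ℂ), fun i => ht i i.2, fun i => ⟨?_, ?_, subset_univ _⟩, hsub,
    fun x hx => ?_⟩
  · exact Complex.ofRealCLM.contDiff.comp (contMDiff_iff_contDiff.1 (f i).contMDiff)
  · exact Metric.isCompact_of_isClosed_isBounded (isClosed_tsupport _) ((hUb i).subset (hsub i))
  · have := f.sum_eq_one hx
    rw [finsum_eq_sum_of_fintype] at this
    rw [← Complex.ofReal_sum, this, Complex.ofReal_one]

theorem coeFn_sum_ae {Ω : Set E3} {ι : Type*} (t : Finset ι) (f : ι → L2 Ω) :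
    ⇑(∑ i ∈ t, f i) =ᵐ[volume.restrict Ω] fun x => ∑ i ∈ t, f i x := by
  classical
  induction t using Finset.induction_on with
  | empty =>
    simp only [Finset.sum_empty]
    exact Lp.coeFn_zero ℂ 2 (volume.restrict Ω)
  | insert a s ha ih =>
    rw [Finset.sum_insert ha]
    filter_upwards [Lp.coeFn_add (f a) (∑ i ∈ s, f i), ih] with x h1 h2
    rw [h1, Pi.add_apply, h2, Finset.sum_insert ha]

/-- `w ↦ w_i` as a continuous linear map on `H(curl, Ω)`. -/
def HCurl.fieldL (Ω : Set E3) (i : Fin 3) : HCurl Ω →L[ℂ] L2 Ω :=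
  (PiLp.proj 2 (fun _ : Fin 3 => L2 Ω) i).comp
    ((WithLp.fstL 2 ℂ (L2V Ω) (L2V Ω)).comp (HCurl Ω).subtypeL)

/-- `w ↦ (curl w)_i` as a continuous linear map on `H(curl, Ω)`. -/
def HCurl.curlL (Ω : Set E3) (i : Fin 3) : HCurl Ω →L[ℂ] L2 Ω :=
  (PiLp.proj 2 (fun _ : Fin 3 => L2 Ω) i).comp
    ((WithLp.sndL 2 ℂ (L2V Ω) (L2V Ω)).comp (HCurl Ω).subtypeL)

theorem HCurl.ext {Ω : Set E3} {v w : HCurl Ω} (h1 : ∀ i, HCurl.field v i = HCurl.field w i)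
    (h2 : ∀ i, HCurl.curl v i = HCurl.curl w i) : v = w := by
  have e1 : v.1.fst = w.1.fst := PiLp.ext h1
  have e2 : v.1.snd = w.1.snd := PiLp.ext h2
  exact Subtype.ext (WithLp.ofLp_injective 2 (Prod.ext e1 e2))

/-- The terms `∇χ_n × w` in the curls add up to zero, since the `χ_n` sum to one on the open set `Ω`
and their gradients therefore sum to zero there. -/
theorem sum_mulHCurl {Ω : Set E3} (hΩ : IsOpen Ω) {ι : Type*} [Fintype ι] {χ : ι → E3 → ℂ}
    (hχ : ∀ n, IsTest univ (χ n)) (h1 : ∀ x ∈ Ω, ∑ n, χ n x = 1) (w : HCurl Ω) :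
    ∑ n, mulHCurl (hχ n) w = w := by
  have hpd : ∀ j, ∀ x ∈ Ω, ∑ n, pd j (χ n) x = 0 := by
    intro j x hx
    have e1 : (fun y => ∑ n, χ n y) =ᶠ[𝓝 x] fun _ => (1 : ℂ) := by
      filter_upwards [hΩ.mem_nhds hx] with y hy using h1 y hy
    have e2 := e1.fderiv_eq (𝕜 := ℝ)
    rw [fderiv_fun_sum fun n _ => (hχ n).smooth.differentiable (by simp) x] at e2
    have e3 := congrArg (fun L => L (EuclideanSpace.single j (1 : ℝ))) e2
    simpa [pd] using e3
  refine HCurl.ext (fun i => ?_) fun i => ?_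
  · have e : HCurl.field (∑ n, mulHCurl (hχ n) w) i
        = ∑ n, HCurl.field (mulHCurl (hχ n) w) i := map_sum (HCurl.fieldL Ω i) _ _
    rw [e]
    refine Lp.ext ?_
    filter_upwards [coeFn_sum_ae Finset.univ fun n => HCurl.field (mulHCurl (hχ n) w) i,
      ae_all_iff.2 fun n => field_mulHCurl (hχ n) w i, ae_restrict_mem hΩ.measurableSet]
      with x e1 e2 hx
    rw [e1, Finset.sum_congr rfl fun n _ => e2 n, ← Finset.sum_mul, h1 x hx, one_mul]
  · have e : HCurl.curl (∑ n, mulHCurl (hχ n) w) i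
        = ∑ n, HCurl.curl (mulHCurl (hχ n) w) i := map_sum (HCurl.curlL Ω i) _ _
    rw [e]
    refine Lp.ext ?_
    filter_upwards [coeFn_sum_ae Finset.univ fun n => HCurl.curl (mulHCurl (hχ n) w) i,
      ae_all_iff.2 fun n => curl_mulHCurl (hχ n) w i, ae_restrict_mem hΩ.measurableSet]
      with x e1 e2 hx
    rw [e1, Finset.sum_congr rfl fun n _ => e2 n, Finset.sum_add_distrib, Finset.sum_sub_distrib,
      ← Finset.sum_mul, ← Finset.sum_mul, ← Finset.sum_mul, h1 x hx, hpd _ x hx, hpd _ x hx]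
    ring

/-- The inclusion `𝐇¹(Ω) ⊆ H(curl, Ω)` as a linear map. -/
def toHCurlL (Ω : Set E3) : H1 Ω →ₗ[ℂ] HCurl Ω where
  toFun := H1.toHCurl
  map_add' u v := HCurl.ext (fun _ => rfl) fun i => map_add (curlL Ω i) u v
  map_smul' c u := HCurl.ext (fun _ => rfl) fun i => map_smul (curlL Ω i) c u

/-- `𝐇¹(Ω)` is dense in `H(curl, Ω)`. -/
theorem IsBoundedLipschitzDomain.denseRange_toHCurl {Ω : Set E3}
    (h : IsBoundedLipschitzDomain Ω) : DenseRange (H1.toHCurl (Ω := Ω)) := by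
  have hk := fun x (hx : x ∈ closure Ω) => h.exists_isInward hx
  choose! k hk r hr b hin using hk
  have hr' : ∀ x ∈ closure Ω, 0 < r x := hr
  obtain ⟨t, χ, ht, hχ, hsupp, hsum⟩ := exists_partition h.isBounded
    (U := fun x => Metric.ball x (r x / 2)) (fun x => Metric.isOpen_ball)
    (fun x => Metric.isBounded_ball) fun x hx => Metric.mem_ball_self (half_pos (hr' x hx))
  intro w
  rw [← sum_mulHCurl h.isOpen hχ (fun x hx => hsum x (subset_closure hx)) w]
  have hcl : closure (range (H1.toHCurl (Ω := Ω)))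
      = ((LinearMap.range (toHCurlL Ω)).topologicalClosure : Set (HCurl Ω)) := by
    rw [Submodule.topologicalClosure_coe, LinearMap.coe_range]
    rfl
  rw [hcl]
  refine Submodule.sum_mem _ fun n _ => ?_
  have := mulHCurl_mem_closure h.isOpen.measurableSet h.isBounded (hk n (ht n)) (hr' n (ht n))
    (hin n (ht n)) (hχ n) (hsupp n) w
  rwa [hcl] at this

/-! ### A Lax–Milgram theorem -/

section LaxMilgram

variable {V : Type*} [NormedAddCommGroup V] [InnerProductSpace ℂ V]

/-- Testing with `J v`, which has the norm of `v`, bounds `‖B v‖` from below. This one inequality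
gives closed range, uniqueness and the stability estimate. -/
theorem mul_norm_le_of_coercive (B : V →L[ℂ] V →L[ℂ] ℂ) {J : V → V} (hJ : ∀ v, ‖J v‖ = ‖v‖)
    {c : ℝ} (hB : ∀ v, c * ‖v‖ ^ 2 ≤ ‖B v (J v)‖) (v : V) : c * ‖v‖ ≤ ‖B v‖ := by
  rcases eq_or_ne v 0 with rfl | hv
  · simp
  have hpos : 0 < ‖v‖ := norm_pos_iff.2 hv
  have h1 := (hB v).trans ((B v).le_opNorm (J v))
  rw [hJ] at h1
  refine le_of_mul_le_mul_right ?_ hpos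
  linarith

/-- A bilinear form which is coercive up to an isometric involution represents every functional. -/
theorem exists_eq_of_coercive [CompleteSpace V] (B : V →L[ℂ] V →L[ℂ] ℂ) {J : V → V}
    (hJ : ∀ v, ‖J v‖ = ‖v‖) (hJJ : ∀ v, J (J v) = v) {c : ℝ} (hc : 0 < c)
    (hB : ∀ v, c * ‖v‖ ^ 2 ≤ ‖B v (J v)‖) (ℓ : V →L[ℂ] ℂ) : ∃ v, B v = ℓ := by
  -- The Riesz isomorphism is conjugate linear, so the operator representing a bilinear form is
  -- conjugate linear too.
  let T : V →ₛₗ[starRingEnd ℂ] V :=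
    ((InnerProductSpace.toDual ℂ V).symm.toLinearEquiv.toLinearMap).comp B.toLinearMap
  have hT : ∀ v w, inner ℂ (T v) w = B v w := fun v w =>
    InnerProductSpace.toDual_symm_apply
  have hTn : ∀ v, ‖T v‖ = ‖B v‖ := fun v => (InnerProductSpace.toDual ℂ V).symm.norm_map (B v)
  have hanti : AntilipschitzWith (c⁻¹).toNNReal T := by
    refine AddMonoidHomClass.antilipschitz_of_bound T fun v => ?_
    rw [hTn, Real.coe_toNNReal _ (inv_nonneg.2 hc.le), ← div_eq_inv_mul, le_div_iff₀ hc, mul_comm]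
    exact mul_norm_le_of_coercive B hJ hB v
  have huc : UniformContinuous T := by
    refine AddMonoidHomClass.uniformContinuous_of_bound T ‖B‖ fun v => ?_
    rw [hTn]
    exact B.le_opNorm v
  have hclosed : IsClosed (LinearMap.range T : Set V) := by
    rw [LinearMap.coe_range]
    exact hanti.isClosed_range huc
  have : CompleteSpace (LinearMap.range T) := hclosed.completeSpace_coe
  have htop : LinearMap.range T = ⊤ := by
    rw [← Submodule.orthogonal_eq_bot_iff, Submodule.eq_bot_iff]
    intro w hw
    -- As `J` is an involution, coercivity at `J w` tests exactly against `w`, so a vector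
    -- orthogonal to the range must vanish.
    have h0 : B (J w) w = 0 := by
      rw [← hT]
      exact (Submodule.mem_orthogonal _ _).1 hw _ ⟨J w, rfl⟩
    have h1 := hB (J w)
    rw [hJJ, h0, norm_zero, hJ] at h1
    have h2 : ‖w‖ ^ 2 = 0 := le_antisymm (by nlinarith [sq_nonneg ‖w‖]) (sq_nonneg _)
    simpa using h2
  obtain ⟨v, hv⟩ : (InnerProductSpace.toDual ℂ V).symm ℓ ∈ LinearMap.range T := htop ▸ trivial
  exact ⟨v, (InnerProductSpace.toDual ℂ V).symm.injective hv⟩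

end LaxMilgram

/-! ### Complex conjugation -/

theorem norm_star_L2 {Ω : Set E3} (f : L2 Ω) : ‖star f‖ = ‖f‖ := by
  rw [Lp.norm_def, Lp.norm_def]
  congr 1
  refine eLpNorm_congr_norm_ae ?_
  filter_upwards [Lp.coeFn_star f] with x hx
  rw [hx, Pi.star_apply, norm_star]

theorem star_sub_L2 {Ω : Set E3} (f g : L2 Ω) : star (f - g) = star f - star g := by
  refine Lp.ext ?_
  filter_upwards [Lp.coeFn_star (f - g), Lp.coeFn_sub f g, Lp.coeFn_sub (star f) (star g),
    Lp.coeFn_star f, Lp.coeFn_star g] with x h1 h2 h3 h4 h5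
  rw [h1, h3, Pi.star_apply, h2, Pi.sub_apply, Pi.sub_apply, h4, h5, star_sub, Pi.star_apply,
    Pi.star_apply]

/-- Conjugating the test field turns the bilinear pairing into the Hilbert space inner product; this
is why conjugation serves as the involution in Lax–Milgram. -/
theorem pairing_star {Ω : Set E3} (f g : L2 Ω) : pairing Ω f (star g) = inner ℂ g f := by
  rw [pairing_eq, L2.inner_def]
  refine integral_congr_ae ?_
  filter_upwards [Lp.coeFn_star g] with x hx
  rw [hx, RCLike.inner_apply, Pi.star_apply]
  rfl

theorem pairing_star_conj {Ω : Set E3} (f g : L2 Ω) :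
    pairing Ω f (star g) = conj (pairing Ω g (star f)) := by
  rw [pairing_star, pairing_star, inner_conj_symm]

theorem pairing_star_self {Ω : Set E3} (f : L2 Ω) : pairing Ω f (star f) = (‖f‖ ^ 2 : ℝ) := by
  rw [pairing_star, inner_self_eq_norm_sq_to_K]
  push_cast
  rfl

theorem norm_pairing_le {Ω : Set E3} (f g : L2 Ω) : ‖pairing Ω f g‖ ≤ ‖f‖ * ‖g‖ := by
  rw [← star_star g, pairing_star, norm_star_L2 (star g), mul_comm]
  exact norm_inner_le_norm _ _

theorem integral_star_mul {Ω : Set E3} (f : L2 Ω) (φ : E3 → ℂ) :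
    ∫ x in Ω, (star f) x * φ x = conj (∫ x in Ω, f x * conj (φ x)) := by
  rw [← integral_conj]
  refine integral_congr_ae ?_
  filter_upwards [Lp.coeFn_star f] with x hx
  rw [hx, Pi.star_apply, map_mul, Complex.conj_conj]
  rfl

theorem pd_conj {φ : E3 → ℂ} (hφ : ContDiff ℝ ∞ φ) (j : Fin 3) (x : E3) :
    pd j (fun x => conj (φ x)) x = conj (pd j φ x) := by
  have h := (Complex.conjCLE.toContinuousLinearMap.hasFDerivAt (x := φ x)).comp x
    (hφ.differentiable (by simp) x).hasFDerivAt
  have h' : HasFDerivAt (fun x => conj (φ x)) _ x := h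
  rw [pd, h'.fderiv]
  simp [pd]

theorem IsTest.conj {Ω : Set E3} {φ : E3 → ℂ} (hφ : IsTest Ω φ) :
    IsTest Ω fun x => conj (φ x) where
  smooth := Complex.conjCLE.toContinuousLinearMap.contDiff.comp hφ.smooth
  compact := hφ.compact.comp_left (map_zero _)
  support := (tsupport_comp_subset (map_zero _) φ).trans hφ.support

/-- Complex conjugation on `𝐋²(Ω)`. -/
def conjV {Ω : Set E3} (f : L2V Ω) : L2V Ω := WithLp.toLp 2 fun i => star (f i)

theorem norm_conjV {Ω : Set E3} (f : L2V Ω) : ‖conjV f‖ = ‖f‖ := by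
  rw [PiLp.norm_eq_of_L2, PiLp.norm_eq_of_L2]
  simp only [conjV, norm_star_L2]

/-- Complex conjugation on `𝐇¹(Ω)`. -/
def H1.conj {Ω : Set E3} (u : H1 Ω) : H1 Ω :=
  ⟨WithLp.toLp 2 (conjV (H1.field u), WithLp.toLp 2 fun i => conjV (H1.grad u i)), by
    intro i j φ hφ
    change ∫ x in Ω, (star (H1.field u i)) x * MaxwellNavier.pd j φ x
      = -∫ x in Ω, (star (H1.grad u i j)) x * φ x
    rw [integral_star_mul, integral_star_mul, ← map_neg]
    congr 1
    simp only [← pd_conj hφ.smooth]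
    exact u.2 i j _ hφ.conj⟩

/-- Complex conjugation on `H(curl, Ω)`. -/
def HCurl.conj {Ω : Set E3} (w : HCurl Ω) : HCurl Ω :=
  ⟨WithLp.toLp 2 (conjV (HCurl.field w), conjV (HCurl.curl w)), by
    intro Φ hΦ
    change ∑ i, ∫ x in Ω, (star (HCurl.field w i)) x * curlFun Φ i x
      = ∑ i, ∫ x in Ω, (star (HCurl.curl w i)) x * Φ i x
    simp only [integral_star_mul, ← map_sum]
    congr 1
    have h := w.2 (fun i x => starRingEnd ℂ (Φ i x)) fun i => (hΦ i).conj
    simpa only [curlFun, pd_conj (hΦ _).smooth, ← map_sub] using! h⟩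

theorem H1.norm_conj {Ω : Set E3} (u : H1 Ω) : ‖H1.conj u‖ = ‖u‖ := by
  rw [← sq_eq_sq₀ (norm_nonneg _) (norm_nonneg _), H1.norm_sq_eq, H1.norm_sq_eq]
  congr 1
  · exact congrArg (· ^ 2) (norm_conjV _)
  · exact Finset.sum_congr rfl fun i _ => Finset.sum_congr rfl fun j _ =>
      congrArg (· ^ 2) (norm_star_L2 _)

theorem HCurl.norm_conj {Ω : Set E3} (w : HCurl Ω) : ‖HCurl.conj w‖ = ‖w‖ := by
  rw [← Submodule.norm_coe, ← Submodule.norm_coe, WithLp.prod_norm_eq_of_L2,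
    WithLp.prod_norm_eq_of_L2]
  simp only [HCurl.conj, norm_conjV, WithLp.toLp_fst, WithLp.toLp_snd, HCurl.field, HCurl.curl]

theorem conjV_conjV {Ω : Set E3} (f : L2V Ω) : conjV (conjV f) = f :=
  PiLp.ext fun i => star_star (f i)

theorem H1.conj_conj {Ω : Set E3} (u : H1 Ω) : H1.conj (H1.conj u) = u :=
  Subtype.ext (WithLp.ofLp_injective 2 (Prod.ext (conjV_conjV _)
    (PiLp.ext fun i => conjV_conjV (u.1.snd i))))

theorem HCurl.conj_conj {Ω : Set E3} (w : HCurl Ω) : HCurl.conj (HCurl.conj w) = w :=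
  Subtype.ext (WithLp.ofLp_injective 2 (Prod.ext (conjV_conjV _) (conjV_conjV _)))

/-! ### Completeness -/

theorem isClosed_H1 (Ω : Set E3) : IsClosed (H1 Ω : Set (WithLp 2 (L2V Ω × L2M Ω))) := by
  have h : (H1 Ω : Set (WithLp 2 (L2V Ω × L2M Ω))) = ⋂ (i) (j) (φ) (hφ : IsTest Ω φ),
      {p | pairing Ω (p.fst i) (hφ.pd j).memLp.toLp = -pairing Ω (p.snd i j) hφ.memLp.toLp} := by
    ext p
    simp only [mem_iInter, mem_ofPred_eq]
    refine forall_congr' fun i => forall_congr' fun j => forall_congr' fun φ =>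
      forall_congr' fun hφ => ?_
    rw [pairing_toLp _ hφ, pairing_toLp _ (hφ.pd j)]
  rw [h]
  refine isClosed_iInter fun i => isClosed_iInter fun j => isClosed_iInter fun φ =>
    isClosed_iInter fun hφ => isClosed_eq ?_ ?_
  · exact ((pairing Ω).flip _).continuous.comp ((PiLp.continuous_apply 2 _ i).comp
      (WithLp.fstL 2 ℂ (L2V Ω) (L2M Ω)).continuous)
  · exact (((pairing Ω).flip _).continuous.comp ((PiLp.continuous_apply 2 _ j).comp
      ((PiLp.continuous_apply 2 _ i).comp (WithLp.sndL 2 ℂ (L2V Ω) (L2M Ω)).continuous))).neg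

theorem isClosed_HCurl (Ω : Set E3) : IsClosed (HCurl Ω : Set (WithLp 2 (L2V Ω × L2V Ω))) := by
  have h : (HCurl Ω : Set (WithLp 2 (L2V Ω × L2V Ω))) = ⋂ (Φ : Fin 3 → E3 → ℂ) (hΦ : ∀ i, IsTest Ω (Φ i)),
      {p | ∑ i, pairing Ω (p.fst i) (isTest_curlFun hΦ i).memLp.toLp
        = ∑ i, pairing Ω (p.snd i) (hΦ i).memLp.toLp} := by
    ext p
    simp only [mem_iInter, mem_ofPred_eq]
    refine forall_congr' fun Φ => forall_congr' fun hΦ => ?_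
    rw [Finset.sum_congr rfl fun i _ => pairing_toLp _ (isTest_curlFun hΦ i),
      Finset.sum_congr rfl fun i _ => pairing_toLp _ (hΦ i)]
  rw [h]
  refine isClosed_iInter fun Φ => isClosed_iInter fun hΦ => isClosed_eq ?_ ?_
  · exact continuous_finsetSum _ fun i _ => ((pairing Ω).flip _).continuous.comp
      ((PiLp.continuous_apply 2 _ i).comp (WithLp.fstL 2 ℂ (L2V Ω) (L2V Ω)).continuous)
  · exact continuous_finsetSum _ fun i _ => ((pairing Ω).flip _).continuous.comp
      ((PiLp.continuous_apply 2 _ i).comp (WithLp.sndL 2 ℂ (L2V Ω) (L2V Ω)).continuous)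

instance (Ω : Set E3) : CompleteSpace (H1 Ω) := (isClosed_H1 Ω).completeSpace_coe

instance (Ω : Set E3) : CompleteSpace (HCurl Ω) := (isClosed_HCurl Ω).completeSpace_coe

/-! ### Ellipticity of the elastic form -/

/-- The minor symmetries make the quadratic form blind to the antisymmetric part of `a`, so
ellipticity on symmetric matrices bounds the form at any matrix. -/
theorem quadratic_symmetrize {c : Fin 3 → Fin 3 → Fin 3 → Fin 3 → ℝ}
    (h1 : ∀ i j k l, c i j k l = c j i k l) (h2 : ∀ i j k l, c i j k l = c i j l k)
    (a : Fin 3 → Fin 3 → ℝ) :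
    ∑ i, ∑ j, ∑ k, ∑ l, c i j k l * ((a i j + a j i) / 2) * ((a k l + a l k) / 2)
      = ∑ i, ∑ j, ∑ k, ∑ l, c i j k l * a i j * a k l := by
  have e1 : ∀ b d : Fin 3 → Fin 3 → ℝ, ∑ i, ∑ j, ∑ k, ∑ l, c i j k l * b j i * d k l
      = ∑ i, ∑ j, ∑ k, ∑ l, c i j k l * b i j * d k l := by
    intro b d
    rw [Finset.sum_comm]
    refine Finset.sum_congr rfl fun i _ => Finset.sum_congr rfl fun j _ =>
      Finset.sum_congr rfl fun k _ => Finset.sum_congr rfl fun l _ => ?_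
    rw [h1 j i]
  have e2 : ∀ b d : Fin 3 → Fin 3 → ℝ, ∑ i, ∑ j, ∑ k, ∑ l, c i j k l * b i j * d l k
      = ∑ i, ∑ j, ∑ k, ∑ l, c i j k l * b i j * d k l := by
    intro b d
    refine Finset.sum_congr rfl fun i _ => Finset.sum_congr rfl fun j _ => ?_
    rw [Finset.sum_comm]
    refine Finset.sum_congr rfl fun k _ => Finset.sum_congr rfl fun l _ => ?_
    rw [h2 i j l k]
  have e3 : ∀ i j k l, c i j k l * ((a i j + a j i) / 2) * ((a k l + a l k) / 2)
      = 1 / 4 * (c i j k l * a i j * a k l) + 1 / 4 * (c i j k l * a j i * a k l)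
        + (1 / 4 * (c i j k l * a i j * a l k) + 1 / 4 * (c i j k l * a j i * a l k)) := by
    intro i j k l
    ring
  have e4 := e1 a fun k l => a l k
  simp only [e3, Finset.sum_add_distrib, ← Finset.mul_sum]
  rw [e4, e1 a a, e2 a a]
  ring

/-- With real coefficients the real part splits into the quadratic forms of the real and imaginary
parts of `z`. The quarter comes from `z i j + z j i` being twice the symmetric part. -/
theorem elliptic_complex {c : Fin 3 → Fin 3 → Fin 3 → Fin 3 → ℝ}
    (h1 : ∀ i j k l, c i j k l = c j i k l) (h2 : ∀ i j k l, c i j k l = c i j l k) {c₀ : ℝ}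
    (hc : ∀ a : Fin 3 → Fin 3 → ℝ, (∀ i j, a i j = a j i) →
      c₀ * ∑ i, ∑ j, |a i j| ^ 2 ≤ ∑ i, ∑ j, ∑ k, ∑ l, c i j k l * a i j * a k l)
    (z : Fin 3 → Fin 3 → ℂ) :
    c₀ / 4 * ∑ i, ∑ j, ‖z i j + z j i‖ ^ 2
      ≤ ∑ i, ∑ j, ((∑ k, ∑ l, (c i j k l : ℂ) * z k l) * conj (z i j)).re := by
  have key : ∀ a : Fin 3 → Fin 3 → ℝ, c₀ / 4 * ∑ i, ∑ j, (a i j + a j i) ^ 2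
      ≤ ∑ i, ∑ j, ∑ k, ∑ l, c i j k l * a i j * a k l := by
    intro a
    have h := hc (fun i j => (a i j + a j i) / 2) fun i j => by ring
    rw [quadratic_symmetrize h1 h2] at h
    refine le_trans (le_of_eq ?_) h
    simp only [sq_abs, div_pow, ← Finset.sum_div]
    ring
  have e1 : ∀ i j, ((∑ k, ∑ l, (c i j k l : ℂ) * z k l) * conj (z i j)).re
      = (∑ k, ∑ l, c i j k l * (z i j).re * (z k l).re)
        + ∑ k, ∑ l, c i j k l * (z i j).im * (z k l).im := by
    intro i j
    simp only [Finset.sum_mul, Complex.re_sum, ← Finset.sum_add_distrib]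
    refine Finset.sum_congr rfl fun k _ => Finset.sum_congr rfl fun l _ => ?_
    rw [mul_assoc, Complex.re_ofReal_mul, Complex.mul_re, Complex.conj_re, Complex.conj_im]
    ring
  have e2 : ∀ i j, ‖z i j + z j i‖ ^ 2
      = ((z i j).re + (z j i).re) ^ 2 + ((z i j).im + (z j i).im) ^ 2 := by
    intro i j
    rw [Complex.sq_norm, Complex.normSq_apply, Complex.add_re, Complex.add_im]
    ring
  simp only [e1, e2, Finset.sum_add_distrib, mul_add]
  exact add_le_add (key fun i j => (z i j).re) (key fun i j => (z i j).im)

/-- Multiplication by a real function in `L^∞(Ω)`. -/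
def smulL {Ω : Set E3} (c : Lp ℝ ∞ (volume.restrict Ω)) : L2 Ω →L[ℂ] L2 Ω :=
  LinearMap.mkContinuous
    { toFun := fun f => c • f
      map_add' := fun f g => by
        refine Lp.ext ?_
        filter_upwards [Lp.coeFn_lpSMul (r := 2) c (f + g), Lp.coeFn_lpSMul (r := 2) c f,
          Lp.coeFn_lpSMul (r := 2) c g, Lp.coeFn_add f g,
          Lp.coeFn_add (c • f : L2 Ω) (c • g : L2 Ω)] with x h1 h2 h3 h4 h5
        simp only [h1, h5, Pi.smul_apply', Pi.add_apply, h2, h3, h4, smul_add]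
      map_smul' := fun a f => by
        refine Lp.ext ?_
        filter_upwards [Lp.coeFn_lpSMul (r := 2) c (a • f), Lp.coeFn_lpSMul (r := 2) c f,
          Lp.coeFn_smul a f, Lp.coeFn_smul a (c • f : L2 Ω)] with x h1 h2 h3 h4
        simp only [RingHom.id_apply, h1, h4, Pi.smul_apply', Pi.smul_apply, h2, h3]
        exact smul_comm _ _ _ } ‖c‖ fun f => Lp.norm_smul_le c f

/-- `u ↦ (C : ∇u)_ij` as a continuous linear map. -/
def stressL {Ω : Set E3} (C : Tensor4 Ω) (i j : Fin 3) : H1 Ω →L[ℂ] L2 Ω :=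
  ∑ k, ∑ l, (smulL (C i j k l)).comp (gradL Ω k l)

theorem stressL_apply {Ω : Set E3} (C : Tensor4 Ω) (i j : Fin 3) (u : H1 Ω) :
    stressL C i j u = stress C u i j := by
  simp only [stressL, sum_apply]
  rfl

theorem coeFn_stress {Ω : Set E3} (C : Tensor4 Ω) (u : H1 Ω) (i j : Fin 3) :
    stress C u i j =ᵐ[volume.restrict Ω]
      fun x => ∑ k, ∑ l, (C i j k l x : ℂ) * H1.grad u k l x := by
  have h : stress C u i j = ∑ k, ∑ l, (C i j k l • H1.grad u k l : L2 Ω) := rfl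
  rw [h]
  have h1 := coeFn_sum_ae Finset.univ fun k => ∑ l, (C i j k l • H1.grad u k l : L2 Ω)
  have h2 := ae_all_iff.2 fun k => coeFn_sum_ae Finset.univ
    fun l => (C i j k l • H1.grad u k l : L2 Ω)
  have h3 := ae_all_iff.2 fun k => ae_all_iff.2 fun l =>
    Lp.coeFn_lpSMul (r := 2) (C i j k l) (H1.grad u k l)
  filter_upwards [h1, h2, h3] with x h1 h2 h3
  rw [h1]
  refine Finset.sum_congr rfl fun k _ => (h2 k).trans (Finset.sum_congr rfl fun l _ => ?_)
  rw [h3 k l, Pi.smul_apply', Complex.real_smul]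

theorem coeFn_strain {Ω : Set E3} (u : H1 Ω) (i j : Fin 3) :
    strain u i j =ᵐ[volume.restrict Ω] fun x => H1.grad u i j x + H1.grad u j i x :=
  Lp.coeFn_add _ _

theorem integrable_mul_star {Ω : Set E3} (f g : L2 Ω) :
    Integrable (fun x => f x * (star g) x) (volume.restrict Ω) :=
  (Lp.memLp f).integrable_mul (Lp.memLp (star g))

theorem re_pairing_star {Ω : Set E3} (f g : L2 Ω) :
    (pairing Ω f (star g)).re = ∫ x in Ω, (f x * (star g) x).re := by
  rw [pairing_eq]
  exact (integral_re (integrable_mul_star f g)).symm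

/-- The elastic form controls the strain. -/
theorem strain_le_re_elastic {Ω : Set E3} {C : Tensor4 Ω} (hsymm : IsSymmetric C)
    {c₀ : ℝ} (hc : ∀ᵐ x ∂(volume.restrict Ω), ∀ a : Fin 3 → Fin 3 → ℝ,
      (∀ i j, a i j = a j i) →
        c₀ * ∑ i, ∑ j, |a i j| ^ 2 ≤ ∑ i, ∑ j, ∑ k, ∑ l, C i j k l x * a i j * a k l) (u : H1 Ω) :
    c₀ / 4 * ∑ i, ∑ j, ‖strain u i j‖ ^ 2
      ≤ (∑ i, ∑ j, pairing Ω (stress C u i j) (star (H1.grad u i j))).re := by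
  have e1 : ∀ i j, ‖strain u i j‖ ^ 2
      = ∫ x in Ω, (strain u i j x * (star (strain u i j)) x).re := by
    intro i j
    rw [← re_pairing_star, pairing_star_self, Complex.ofReal_re]
  have i1 : ∀ i j, Integrable (fun x => (strain u i j x * (star (strain u i j)) x).re)
      (volume.restrict Ω) := fun i j => (integrable_mul_star _ _).re
  have i2 : ∀ i j, Integrable (fun x => (stress C u i j x * (star (H1.grad u i j)) x).re)
      (volume.restrict Ω) := fun i j => (integrable_mul_star _ _).re
  simp only [Complex.re_sum, re_pairing_star, e1]
  have s1 : ∀ {F : Fin 3 → Fin 3 → E3 → ℝ}, (∀ i j, Integrable (F i j) (volume.restrict Ω)) →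
      ∑ i, ∑ j, ∫ x in Ω, F i j x = ∫ x in Ω, ∑ i, ∑ j, F i j x := by
    intro F hF
    rw [integral_finsetSum _ fun i _ => integrable_finsetSum _ fun j _ => hF i j]
    exact Finset.sum_congr rfl fun i _ => (integral_finsetSum _ fun j _ => hF i j).symm
  rw [s1 i1, s1 i2, ← integral_const_mul]
  refine integral_mono_ae
    ((integrable_finsetSum _ fun i _ => integrable_finsetSum _ fun j _ => i1 i j).const_mul _)
    (integrable_finsetSum _ fun i _ => integrable_finsetSum _ fun j _ => i2 i j) ?_
  filter_upwards [hc, ae_all_iff.2 fun i => ae_all_iff.2 fun j => coeFn_stress C u i j,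
    ae_all_iff.2 fun i => ae_all_iff.2 fun j => coeFn_strain u i j,
    ae_all_iff.2 fun i => ae_all_iff.2 fun j => Lp.coeFn_star (strain u i j),
    ae_all_iff.2 fun i => ae_all_iff.2 fun j => Lp.coeFn_star (H1.grad u i j)]
    with x hx h1 h2 h3 h4
  have h := elliptic_complex (c := fun i j k l => C i j k l x)
    (fun i j k l => by rw [(hsymm i j k l).2.1]) (fun i j k l => by rw [(hsymm i j k l).2.2]) hx
    fun i j => H1.grad u i j x
  have e5 : ∀ i j, (strain u i j x * (star (strain u i j)) x).re
      = ‖H1.grad u i j x + H1.grad u j i x‖ ^ 2 := by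
    intro i j
    rw [h3, Pi.star_apply, h2]
    change Complex.re (_ * conj (_ : ℂ)) = _
    rw [Complex.mul_conj, Complex.ofReal_re, Complex.sq_norm]
  have e6 : ∀ i j, (stress C u i j x * (star (H1.grad u i j)) x).re
      = ((∑ k, ∑ l, (C i j k l x : ℂ) * H1.grad u k l x) * conj (H1.grad u i j x)).re := by
    intro i j
    rw [h4, Pi.star_apply, h1]
    rfl
  simpa only [e5, e6] using h

/-! ### The variational formulation -/

section Variational

variable {Ω : Set E3}

/-- The magnetic form `∫ (curl H · curl v + H · v) - β ⟨ν × u, v⟩` as a functional of `v`. -/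
def magneticForm (β : ℂ) (H : HCurl Ω) (u : H1 Ω) : HCurl Ω →L[ℂ] ℂ :=
  ∑ i, ((pairing Ω (HCurl.curl H i)).comp (HCurl.curlL Ω i)
    + (pairing Ω (HCurl.field H i)).comp (HCurl.fieldL Ω i)
    - β • ((pairing Ω (H1.curl u i)).comp (HCurl.fieldL Ω i)
      - (pairing Ω (H1.field u i)).comp (HCurl.curlL Ω i)))

theorem magneticForm_apply (β : ℂ) (H : HCurl Ω) (u : H1 Ω) (v : HCurl Ω) :
    magneticForm β H u v = (∑ i, pairing Ω (HCurl.curl H i) (HCurl.curl v i))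
      + (∑ i, pairing Ω (HCurl.field H i) (HCurl.field v i))
      - β * ((∑ i, pairing Ω (H1.curl u i) (HCurl.field v i))
        - ∑ i, pairing Ω (H1.field u i) (HCurl.curl v i)) := by
  simp only [magneticForm, sum_apply, ← Finset.sum_add_distrib, ← Finset.sum_sub_distrib,
    Finset.mul_sum]
  rfl

/-- The elastic form `∫ ((C : ∇u) : ∇p + u · p) - b ⟨ν × H, p⟩` as a functional of `p`. -/
def elasticForm (C : Tensor4 Ω) (b : ℂ) (H : HCurl Ω) (u : H1 Ω) : H1 Ω →L[ℂ] ℂ :=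
  (∑ i, ∑ j, (pairing Ω (stress C u i j)).comp (gradL Ω i j))
    + ∑ i, ((pairing Ω (H1.field u i)).comp (fieldL Ω i)
      - b • ((pairing Ω (HCurl.curl H i)).comp (fieldL Ω i)
        - (pairing Ω (HCurl.field H i)).comp (curlL Ω i)))

theorem elasticForm_apply (C : Tensor4 Ω) (b : ℂ) (H : HCurl Ω) (u p : H1 Ω) :
    elasticForm C b H u p = (∑ i, ∑ j, pairing Ω (stress C u i j) (H1.grad p i j))
      + (∑ i, pairing Ω (H1.field u i) (H1.field p i))
      - b * ((∑ i, pairing Ω (HCurl.curl H i) (H1.field p i))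
        - ∑ i, pairing Ω (HCurl.field H i) (H1.curl p i)) := by
  simp only [elasticForm, add_apply, sum_apply, ← Finset.sum_sub_distrib, Finset.mul_sum,
    add_sub_assoc]
  rfl

/-- The data `∫ ξ · v - ⟨ν × w, v⟩` of the magnetic equation. -/
def magneticData (ξ : L2V Ω) (w : HCurl Ω) : HCurl Ω →L[ℂ] ℂ :=
  ∑ i, ((pairing Ω (ξ i)).comp (HCurl.fieldL Ω i)
    - ((pairing Ω (HCurl.curl w i)).comp (HCurl.fieldL Ω i)
      - (pairing Ω (HCurl.field w i)).comp (HCurl.curlL Ω i)))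

theorem magneticData_apply (ξ : L2V Ω) (w v : HCurl Ω) :
    magneticData ξ w v = (∑ i, pairing Ω (ξ i) (HCurl.field v i))
      - ((∑ i, pairing Ω (HCurl.curl w i) (HCurl.field v i))
        - ∑ i, pairing Ω (HCurl.field w i) (HCurl.curl v i)) := by
  simp only [magneticData, sum_apply, ← Finset.sum_sub_distrib]
  rfl

/-- The data `⟨h, p⟩ - ∫ ξ · p` of the elastic equation. -/
def elasticData (ξ : L2V Ω) (h : HNegHalf Ω) : H1 Ω →L[ℂ] ℂ :=
  h.comp (trace Ω) - ∑ i, (pairing Ω (ξ i)).comp (fieldL Ω i)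

theorem elasticData_apply (ξ : L2V Ω) (h : HNegHalf Ω) (p : H1 Ω) :
    elasticData ξ h p = h (trace Ω p) - ∑ i, pairing Ω (ξ i) (H1.field p i) := by
  simp only [elasticData, sub_apply, sum_apply]
  rfl

/-- Realizes a test field in `𝐇¹(Ω)` with zero trace, so that the variational identities can be read
as the weak differential equations. -/
theorem exists_H1_test (hb : Bornology.IsBounded Ω) {Φ : Fin 3 → E3 → ℂ}
    (hΦ : ∀ i, IsTest Ω (Φ i)) : ∃ V ∈ H10 Ω, ∀ f : L2 Ω,
      (∀ i, pairing Ω f (H1.field V i) = ∫ x in Ω, f x * Φ i x) ∧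
      (∀ i, pairing Ω f (H1.curl V i) = ∫ x in Ω, f x * curlFun Φ i x) ∧
      ∀ i j, pairing Ω f (H1.grad V i j) = ∫ x in Ω, f x * pd j (Φ i) x := by
  obtain ⟨V, h1, h2⟩ := exists_H1_of_contDiff hb fun i => (hΦ i).smooth
  have key : ∀ {f g : L2 Ω} {φ : E3 → ℂ}, g =ᵐ[volume.restrict Ω] φ →
      pairing Ω f g = ∫ x in Ω, f x * φ x := by
    intro f g φ hg
    rw [pairing_eq]
    refine integral_congr_ae ?_
    filter_upwards [hg] with x hx
    rw [hx]
  refine ⟨V, subset_closure (Submodule.subset_span ⟨Φ, hΦ, h1, h2⟩),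
    fun f => ⟨fun i => key (h1 i), fun i => key ?_, fun i j => key (h2 i j)⟩⟩
  have h3 : H1.curl V i =ᵐ[volume.restrict Ω]
      ⇑(H1.grad V (i + 2) (i + 1)) - ⇑(H1.grad V (i + 1) (i + 2)) := Lp.coeFn_sub _ _
  filter_upwards [h3, h2 (i + 2) (i + 1), h2 (i + 1) (i + 2)] with x e1 e2 e3
  rw [e1, Pi.sub_apply, e2, e3, curlFun]

theorem tangentialTrace_trace (w : HCurl Ω) (v : H1 Ω) :
    tangentialTrace w (trace Ω v) = (∑ i, pairing Ω (HCurl.curl w i) (H1.field v i))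
      - ∑ i, pairing Ω (HCurl.field w i) (H1.curl v i) := by
  simp only [tangentialTrace_apply, ← pairing_eq, Finset.sum_sub_distrib]

theorem normalTrace_trace (S : HDiv Ω) (v : H1 Ω) :
    normalTrace S (trace Ω v) = (∑ i, ∑ j, pairing Ω (S.1.1 i j) (H1.grad v i j))
      + ∑ i, pairing Ω (S.1.2 i) (H1.field v i) := by
  simp only [normalTrace_apply, ← pairing_eq]

theorem HNegHalf.ext {g h : HNegHalf Ω} (H : ∀ v, g (trace Ω v) = h (trace Ω v)) : g = h := by
  refine ContinuousLinearMap.ext fun y => ?_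
  obtain ⟨v, rfl⟩ := Submodule.mkQ_surjective _ y
  exact H v

variable {C : Tensor4 Ω} {κ : ℝ} {b₁ b₂ : ℂ} {ξ₁ ξ₂ : L2V Ω} {h₁ : HNegHalf Ω} {w : HCurl Ω}

/-- Apply both boundary conditions to traces and eliminate `curl E` and the divergence by the
differential equations. The elastic identity is then immediate, while the magnetic one still has to
be extended to all of `H(curl, Ω)`. -/
theorem IsSolution.forms_eq (hΩ : IsBoundedLipschitzDomain Ω) {H : HCurl Ω} {u : H1 Ω}
    (h : IsSolution C κ b₁ b₂ ξ₁ ξ₂ h₁ (tangentialTrace w) H u) :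
    magneticForm (Complex.I * κ / b₂) H u = magneticData ξ₁ w ∧
      elasticForm C b₁ H u = elasticData ξ₂ h₁ := by
  obtain ⟨E, S, hE, hS, hE', hS', hbc₁, hbc₂⟩ := h
  constructor
  -- Both sides are continuous on `H(curl, Ω)` and agree on the dense subspace `𝐇¹(Ω)`.
  · refine ContinuousLinearMap.ext fun v => congrFun (hΩ.denseRange_toHCurl.equalizer
      (magneticForm (Complex.I * κ / b₂) H u).continuous (magneticData ξ₁ w).continuous
      (funext fun v => ?_)) v
    have hv := congrArg (fun g : HNegHalf Ω => g (trace Ω v)) hbc₂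
    simp only [add_apply, smul_apply, smul_eq_mul, tangentialTrace_trace, hE] at hv
    have hc : ∀ i, pairing Ω (HCurl.curl E i) (H1.field v i)
        = pairing Ω (ξ₁ i) (H1.field v i) - pairing Ω (HCurl.field H i) (H1.field v i) := by
      intro i
      rw [← hE', PiLp.add_apply, map_add, add_apply, add_sub_cancel_right]
    simp only [hc, Finset.sum_sub_distrib] at hv
    simp only [Function.comp_apply, magneticForm_apply, magneticData_apply]
    change (∑ i, pairing Ω (HCurl.curl H i) (H1.curl v i))
      + (∑ i, pairing Ω (HCurl.field H i) (H1.field v i))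
      - (Complex.I * κ / b₂) * ((∑ i, pairing Ω (H1.curl u i) (H1.field v i))
        - ∑ i, pairing Ω (H1.field u i) (H1.curl v i))
      = (∑ i, pairing Ω (ξ₁ i) (H1.field v i))
      - ((∑ i, pairing Ω (HCurl.curl w i) (H1.field v i))
        - ∑ i, pairing Ω (HCurl.field w i) (H1.curl v i))
    change _ + (Complex.I * κ / b₂) * ((∑ i, pairing Ω (H1.curl u i) (H1.field v i))
        - ∑ i, pairing Ω (H1.field u i) (H1.curl v i)) = _ at hv
    linear_combination -hv
  · refine ContinuousLinearMap.ext fun p => ?_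
    have hp := congrArg (fun g : HNegHalf Ω => g (trace Ω p)) hbc₁
    simp only [sub_apply, smul_apply, smul_eq_mul, tangentialTrace_trace, normalTrace_trace,
      hS] at hp
    have hc : ∀ i, pairing Ω (S.1.2 i) (H1.field p i)
        = pairing Ω (ξ₂ i) (H1.field p i) + pairing Ω (H1.field u i) (H1.field p i) := by
      intro i
      rw [← hS', PiLp.sub_apply, map_sub, sub_apply, sub_add_cancel]
    simp only [hc, Finset.sum_add_distrib] at hp
    rw [elasticForm_apply, elasticData_apply]
    linear_combination hp

/-- Compactly supported test fields recover the differential equations, which make `curl H` and the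
stress admissible for the traces; general fields in `𝐇¹(Ω)` then recover the boundary conditions. -/
theorem isSolution_of_forms_eq (hb : Bornology.IsBounded Ω) {H : HCurl Ω} {u : H1 Ω}
    (h₂ : magneticForm (Complex.I * κ / b₂) H u = magneticData ξ₁ w)
    (h₃ : elasticForm C b₁ H u = elasticData ξ₂ h₁) :
    IsSolution C κ b₁ b₂ ξ₁ ξ₂ h₁ (tangentialTrace w) H u := by
  set β := Complex.I * κ / b₂ with hβ
  have hmag : ∀ v : H1 Ω, (∑ i, pairing Ω (HCurl.curl H i) (H1.curl v i))
      + (∑ i, pairing Ω (HCurl.field H i) (H1.field v i))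
      - β * ((∑ i, pairing Ω (H1.curl u i) (H1.field v i))
        - ∑ i, pairing Ω (H1.field u i) (H1.curl v i))
      = (∑ i, pairing Ω (ξ₁ i) (H1.field v i))
      - ((∑ i, pairing Ω (HCurl.curl w i) (H1.field v i))
        - ∑ i, pairing Ω (HCurl.field w i) (H1.curl v i)) := by
    intro v
    have := congrArg (fun L : HCurl Ω →L[ℂ] ℂ => L (H1.toHCurl v)) h₂
    simp only [magneticForm_apply, magneticData_apply] at this
    exact this
  have hel : ∀ p : H1 Ω, _ := fun p => congrArg (fun L : H1 Ω →L[ℂ] ℂ => L p) h₃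
  simp only [elasticForm_apply, elasticData_apply] at hel
  have hE : HasWeakCurl Ω (HCurl.curl H) (ξ₁ - HCurl.field H) := by
    intro Φ hΦ
    obtain ⟨V, -, hV⟩ := exists_H1_test hb hΦ
    have h1 := hmag V
    simp only [fun f => (hV f).1, fun f => (hV f).2.1] at h1
    have hu := H1.hasWeakCurl u Φ hΦ
    have hw : ∑ i, ∫ x in Ω, HCurl.field w i x * curlFun Φ i x
      = ∑ i, ∫ x in Ω, HCurl.curl w i x * Φ i x := w.2 Φ hΦ
    simp only [PiLp.sub_apply, integral_sub_test _ _ (hΦ _), Finset.sum_sub_distrib]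
    -- The boundary terms of `u` and `w` drop out because their weak curls satisfy Green's formula
    -- without boundary term on test fields.
    linear_combination h1 - β * hu + hw
  have hS : HasWeakDiv Ω (stress C u) (ξ₂ + H1.field u) := by
    intro Φ hΦ
    obtain ⟨V, hV0, hV⟩ := exists_H1_test hb hΦ
    have h1 := hel V
    have htr : trace Ω V = 0 := (Submodule.Quotient.mk_eq_zero _).2 hV0
    have hw : ∑ i, ∫ x in Ω, HCurl.field H i x * curlFun Φ i x
      = ∑ i, ∫ x in Ω, HCurl.curl H i x * Φ i x := H.2 Φ hΦ
    rw [htr, map_zero] at h1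
    simp only [fun f => (hV f).1, fun f => (hV f).2.1, fun f => (hV f).2.2] at h1
    simp only [PiLp.add_apply, integral_add_test _ _ (hΦ _), Finset.sum_add_distrib]
    linear_combination h1 - b₁ * hw
  refine ⟨⟨WithLp.toLp 2 (HCurl.curl H, ξ₁ - HCurl.field H), hE⟩,
    ⟨(stress C u, ξ₂ + H1.field u), hS⟩, rfl, rfl, sub_add_cancel _ _, add_sub_cancel_right _ _,
    HNegHalf.ext fun p => ?_, HNegHalf.ext fun v => ?_⟩
  · have h1 := hel p
    simp only [sub_apply, smul_apply, smul_eq_mul, tangentialTrace_trace, normalTrace_trace,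
      PiLp.add_apply, map_add, add_apply, Finset.sum_add_distrib]
    linear_combination h1
  · have h1 := hmag v
    simp only [add_apply, smul_apply, smul_eq_mul, tangentialTrace_trace]
    change (∑ i, pairing Ω ((ξ₁ - HCurl.field H) i) (H1.field v i))
      - (∑ i, pairing Ω (HCurl.curl H i) (H1.curl v i))
      + β * ((∑ i, pairing Ω (H1.curl u i) (H1.field v i))
        - ∑ i, pairing Ω (H1.field u i) (H1.curl v i)) = _
    simp only [PiLp.sub_apply, map_sub, sub_apply, Finset.sum_sub_distrib]
    linear_combination -h1

end Variational

/-! ### The coupled bilinear form, its coercivity and its data -/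

/-- The Hilbert space `H(curl, Ω) × 𝐇¹(Ω)`. -/
def SolutionSpace (Ω : Set E3) : Type := WithLp 2 (HCurl Ω × H1 Ω)

namespace SolutionSpace

variable {Ω : Set E3}

instance : NormedAddCommGroup (SolutionSpace Ω) :=
  inferInstanceAs (NormedAddCommGroup (WithLp 2 (HCurl Ω × H1 Ω)))

instance : InnerProductSpace ℂ (SolutionSpace Ω) :=
  inferInstanceAs (InnerProductSpace ℂ (WithLp 2 (HCurl Ω × H1 Ω)))

instance : CompleteSpace (SolutionSpace Ω) :=
  inferInstanceAs (CompleteSpace (WithLp 2 (HCurl Ω × H1 Ω)))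

/-- The pair `(H, u)`. -/
def mk (H : HCurl Ω) (u : H1 Ω) : SolutionSpace Ω := WithLp.toLp 2 (H, u)

/-- The projection to `H(curl, Ω)`. -/
def fst : SolutionSpace Ω →L[ℂ] HCurl Ω := WithLp.fstL 2 ℂ (HCurl Ω) (H1 Ω)

/-- The projection to `𝐇¹(Ω)`. -/
def snd : SolutionSpace Ω →L[ℂ] H1 Ω := WithLp.sndL 2 ℂ (HCurl Ω) (H1 Ω)

theorem fst_mk (H : HCurl Ω) (u : H1 Ω) : fst (mk H u) = H := rfl

theorem snd_mk (H : HCurl Ω) (u : H1 Ω) : snd (mk H u) = u := rfl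

theorem mk_fst_snd (U : SolutionSpace Ω) : mk (fst U) (snd U) = U := rfl

theorem norm_sq_eq (U : SolutionSpace Ω) : ‖U‖ ^ 2 = ‖fst U‖ ^ 2 + ‖snd U‖ ^ 2 :=
  WithLp.prod_norm_sq_eq_of_L2 (α := HCurl Ω) (β := H1 Ω) U

theorem norm_fst_le (U : SolutionSpace Ω) : ‖fst U‖ ≤ ‖U‖ :=
  WithLp.norm_fst_le (p := 2) (HCurl Ω) (β := H1 Ω) U

theorem norm_snd_le (U : SolutionSpace Ω) : ‖snd U‖ ≤ ‖U‖ :=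
  WithLp.norm_snd_le (p := 2) (HCurl Ω) (β := H1 Ω) U

end SolutionSpace

section Coupled

open SolutionSpace

variable {Ω : Set E3}

/-- The bilinear form `∑ i, ∫ (S i x) (T i y)` given by families of continuous linear maps into
`L²(Ω)`. -/
def sumPairing {V ι : Type*} [NormedAddCommGroup V] [NormedSpace ℂ V] [Fintype ι]
    (S T : ι → V →L[ℂ] L2 Ω) : V →L[ℂ] V →L[ℂ] ℂ :=
  ∑ i, (pairing Ω).bilinearComp (S i) (T i)

theorem sumPairing_apply {V ι : Type*} [NormedAddCommGroup V] [NormedSpace ℂ V] [Fintype ι]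
    (S T : ι → V →L[ℂ] L2 Ω) (x y : V) :
    sumPairing S T x y = ∑ i, pairing Ω (S i x) (T i y) := by
  simp only [sumPairing, sum_apply, ContinuousLinearMap.bilinearComp_apply]

/-- The combination `a` times the magnetic form plus the elastic form, on a space that maps to
`H(curl, Ω)` and to `𝐇¹(Ω)`. -/
def coupledFormOn {V : Type*} [NormedAddCommGroup V] [NormedSpace ℂ V] (C : Tensor4 Ω) (a β b : ℂ)
    (P : V →L[ℂ] HCurl Ω) (Q : V →L[ℂ] H1 Ω) : V →L[ℂ] V →L[ℂ] ℂ :=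
  a • (sumPairing (fun i => (HCurl.curlL Ω i).comp P) (fun i => (HCurl.curlL Ω i).comp P)
      + sumPairing (fun i => (HCurl.fieldL Ω i).comp P) (fun i => (HCurl.fieldL Ω i).comp P)
      - β • (sumPairing (fun i => (curlL Ω i).comp Q) (fun i => (HCurl.fieldL Ω i).comp P)
        - sumPairing (fun i => (fieldL Ω i).comp Q) (fun i => (HCurl.curlL Ω i).comp P)))
    + (sumPairing (fun ij : Fin 3 × Fin 3 => (stressL C ij.1 ij.2).comp Q)
          (fun ij => (gradL Ω ij.1 ij.2).comp Q)
      + sumPairing (fun i => (fieldL Ω i).comp Q) (fun i => (fieldL Ω i).comp Q)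
      - b • (sumPairing (fun i => (HCurl.curlL Ω i).comp P) (fun i => (fieldL Ω i).comp Q)
        - sumPairing (fun i => (HCurl.fieldL Ω i).comp P) (fun i => (curlL Ω i).comp Q)))

theorem coupledFormOn_apply {V : Type*} [NormedAddCommGroup V] [NormedSpace ℂ V] (C : Tensor4 Ω)
    (a β b : ℂ) (P : V →L[ℂ] HCurl Ω) (Q : V →L[ℂ] H1 Ω) (x y : V) :
    coupledFormOn C a β b P Q x y
      = a * magneticForm β (P x) (Q x) (P y) + elasticForm C b (P x) (Q x) (Q y) := by
  simp only [coupledFormOn, magneticForm_apply, elasticForm_apply, add_apply, sub_apply,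
    smul_apply, sumPairing_apply, smul_eq_mul, Fintype.sum_prod_type,
    ContinuousLinearMap.comp_apply, stressL_apply]
  rfl

/-- The combination `a` times the magnetic form plus the elastic form. -/
def coupledForm (C : Tensor4 Ω) (a β b : ℂ) :
    SolutionSpace Ω →L[ℂ] SolutionSpace Ω →L[ℂ] ℂ :=
  coupledFormOn C a β b fst snd

theorem coupledForm_apply (C : Tensor4 Ω) (a β b : ℂ) (U W : SolutionSpace Ω) :
    coupledForm C a β b U W
      = a * magneticForm β (fst U) (snd U) (fst W) + elasticForm C b (fst U) (snd U) (snd W) :=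
  coupledFormOn_apply C a β b _ _ U W

/-- The data of the coupled problem. -/
def coupledData (a : ℂ) (ξ₁ ξ₂ : L2V Ω) (h₁ : HNegHalf Ω) (w : HCurl Ω) :
    SolutionSpace Ω →L[ℂ] ℂ :=
  a • (magneticData ξ₁ w).comp fst + (elasticData ξ₂ h₁).comp snd

theorem coupledData_apply (a : ℂ) (ξ₁ ξ₂ : L2V Ω) (h₁ : HNegHalf Ω) (w : HCurl Ω)
    (W : SolutionSpace Ω) : coupledData a ξ₁ ξ₂ h₁ w W
      = a * magneticData ξ₁ w (fst W) + elasticData ξ₂ h₁ (snd W) := rfl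

/-- The test pairs `(v, 0)` and `(0, p)` separate the two identities; the weight `a` can be
cancelled because it is nonzero. -/
theorem coupledForm_eq_iff (C : Tensor4 Ω) {a : ℂ} (ha : a ≠ 0) (β b : ℂ) (ξ₁ ξ₂ : L2V Ω)
    (h₁ : HNegHalf Ω) (w : HCurl Ω) (U : SolutionSpace Ω) :
    coupledForm C a β b U = coupledData a ξ₁ ξ₂ h₁ w ↔
      magneticForm β (fst U) (snd U) = magneticData ξ₁ w ∧
        elasticForm C b (fst U) (snd U) = elasticData ξ₂ h₁ := by
  constructor
  · intro h
    refine ⟨ContinuousLinearMap.ext fun v => ?_, ContinuousLinearMap.ext fun p => ?_⟩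
    · have := congrArg (fun L : SolutionSpace Ω →L[ℂ] ℂ => L (mk v 0)) h
      simp only [coupledForm_apply, coupledData_apply, fst_mk, snd_mk, map_zero,
        add_zero] at this
      exact mul_left_cancel₀ ha this
    · have := congrArg (fun L : SolutionSpace Ω →L[ℂ] ℂ => L (mk 0 p)) h
      simpa only [coupledForm_apply, coupledData_apply, fst_mk, snd_mk, map_zero,
        mul_zero, zero_add] using this
  · rintro ⟨h1, h2⟩
    refine ContinuousLinearMap.ext fun W => ?_
    rw [coupledForm_apply, coupledData_apply, h1, h2]

/-- Complex conjugation on the solution space. -/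
def conjSol (U : SolutionSpace Ω) : SolutionSpace Ω :=
  mk (HCurl.conj (fst U)) (H1.conj (snd U))

theorem norm_conjSol (U : SolutionSpace Ω) : ‖conjSol U‖ = ‖U‖ := by
  refine (sq_eq_sq₀ (norm_nonneg _) (norm_nonneg _)).1 ?_
  rw [norm_sq_eq, norm_sq_eq, conjSol, fst_mk, snd_mk, H1.norm_conj, HCurl.norm_conj]

theorem conjSol_conjSol (U : SolutionSpace Ω) : conjSol (conjSol U) = U := by
  simp only [conjSol, fst_mk, snd_mk, HCurl.conj_conj, H1.conj_conj, mk_fst_snd]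

theorem H1.curl_conj (u : H1 Ω) (i : Fin 3) : H1.curl (H1.conj u) i = star (H1.curl u i) :=
  (star_sub_L2 _ _).symm

theorem HCurl.norm_sq_eq (w : HCurl Ω) :
    ‖w‖ ^ 2 = (∑ i, ‖HCurl.field w i‖ ^ 2) + ∑ i, ‖HCurl.curl w i‖ ^ 2 := by
  rw [← Submodule.norm_coe, WithLp.prod_norm_sq_eq_of_L2, PiLp.norm_sq_eq_of_L2,
    PiLp.norm_sq_eq_of_L2]
  rfl

/-- On the diagonal the coupling terms cancel in the real part. -/
theorem re_coupledForm_conj (C : Tensor4 Ω) {a β b : ℂ} (hab : a * β = conj b)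
    (U : SolutionSpace Ω) : (coupledForm C a β b U (conjSol U)).re
      = a.re * ‖fst U‖ ^ 2
        + (∑ i, ∑ j, pairing Ω (stress C (snd U) i j) (star (H1.grad (snd U) i j))).re
        + ‖H1.field (snd U)‖ ^ 2 := by
  set H := fst U
  set u := snd U
  -- `X` is `⟨ν × H, conj u⟩`. The antisymmetry of Green's pairing makes the coupling term of the
  -- magnetic form `+β conj X`.
  set X := (∑ i, pairing Ω (HCurl.curl H i) (star (H1.field u i)))
    - ∑ i, pairing Ω (HCurl.field H i) (star (H1.curl u i)) with hX
  have e1 : magneticForm β H u (HCurl.conj H) = (‖H‖ ^ 2 : ℝ) + β * conj X := by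
    rw [magneticForm_apply]
    change (∑ i, pairing Ω (HCurl.curl H i) (star (HCurl.curl H i)))
      + (∑ i, pairing Ω (HCurl.field H i) (star (HCurl.field H i)))
      - β * ((∑ i, pairing Ω (H1.curl u i) (star (HCurl.field H i)))
        - ∑ i, pairing Ω (H1.field u i) (star (HCurl.curl H i))) = _
    rw [HCurl.norm_sq_eq, hX, map_sub, map_sum, map_sum]
    simp only [pairing_star_self, ← pairing_star_conj]
    push_cast
    ring
  have e2 : elasticForm C b H u (H1.conj u)
      = (∑ i, ∑ j, pairing Ω (stress C u i j) (star (H1.grad u i j)))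
        + (‖H1.field u‖ ^ 2 : ℝ) - b * X := by
    rw [elasticForm_apply]
    simp only [H1.curl_conj]
    change (∑ i, ∑ j, pairing Ω (stress C u i j) (star (H1.grad u i j)))
      + (∑ i, pairing Ω (H1.field u i) (star (H1.field u i))) - b * X = _
    rw [PiLp.norm_sq_eq_of_L2]
    simp only [pairing_star_self]
    push_cast
    ring
  have e3 : coupledForm C a β b U (conjSol U) = a * (‖H‖ ^ 2 : ℝ)
      + (∑ i, ∑ j, pairing Ω (stress C u i j) (star (H1.grad u i j)))
      + (‖H1.field u‖ ^ 2 : ℝ) + (conj (b * X) - b * X) := by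
    rw [coupledForm_apply]
    change a * magneticForm β H u (HCurl.conj H) + elasticForm C b H u (H1.conj u) = _
    rw [e1, e2, map_mul]
    linear_combination conj X * hab
  rw [e3]
  simp only [Complex.add_re, Complex.sub_re, Complex.conj_re, Complex.re_mul_ofReal,
    Complex.ofReal_re]
  ring

/-- The real part on the diagonal dominates `Re a ‖H‖²` and a multiple of `‖u‖²` plus the squared
strain; Korn's inequality upgrades the latter to the full `𝐇¹` norm. -/
theorem exists_coercive (hΩ : IsBoundedLipschitzDomain Ω) {C : Tensor4 Ω} (hsymm : IsSymmetric C)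
    (hell : IsLegendreElliptic C) {a β b : ℂ} (hab : a * β = conj b) (ha : 0 < a.re) :
    ∃ c : ℝ, 0 < c ∧ ∀ U : SolutionSpace Ω, c * ‖U‖ ^ 2 ≤ ‖coupledForm C a β b U (conjSol U)‖ := by
  obtain ⟨c₀, hc₀, hc⟩ := hell
  obtain ⟨K, hK, hkorn⟩ := hΩ.korn
  set m := min 1 (c₀ / 4) with hm
  have hm0 : 0 < m := lt_min one_pos (by positivity)
  refine ⟨min a.re (m / K), lt_min ha (by positivity), fun U => ?_⟩
  refine le_trans ?_ (Complex.re_le_norm _)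
  rw [re_coupledForm_conj C hab, SolutionSpace.norm_sq_eq]
  have h1 := strain_le_re_elastic hsymm hc (snd U)
  have h2 := hkorn (snd U)
  set Q := ∑ i, ∑ j, ‖strain (snd U) i j‖ ^ 2
  have hQ : 0 ≤ Q := by positivity
  have h3 : m / K * ‖snd U‖ ^ 2 ≤ m * (‖H1.field (snd U)‖ ^ 2 + Q) := by
    rw [div_mul_eq_mul_div, div_le_iff₀ hK]
    calc m * ‖snd U‖ ^ 2 ≤ m * (K * (‖H1.field (snd U)‖ ^ 2 + Q)) :=
          mul_le_mul_of_nonneg_left h2 hm0.le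
      _ = _ := by ring
  have h4 : m * Q ≤ c₀ / 4 * Q := mul_le_mul_of_nonneg_right (min_le_right _ _) hQ
  have h5 : m * ‖H1.field (snd U)‖ ^ 2 ≤ 1 * ‖H1.field (snd U)‖ ^ 2 :=
    mul_le_mul_of_nonneg_right (min_le_left _ _) (sq_nonneg _)
  have h6 : min a.re (m / K) * ‖fst U‖ ^ 2 ≤ a.re * ‖fst U‖ ^ 2 :=
    mul_le_mul_of_nonneg_right (min_le_left _ _) (sq_nonneg _)
  have h7 : min a.re (m / K) * ‖snd U‖ ^ 2 ≤ m / K * ‖snd U‖ ^ 2 :=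
    mul_le_mul_of_nonneg_right (min_le_right _ _) (sq_nonneg _)
  linarith

theorem HCurl.norm_field_le (w : HCurl Ω) (i : Fin 3) : ‖HCurl.field w i‖ ≤ ‖w‖ :=
  (PiLp.norm_apply_le _ i).trans (WithLp.norm_fst_le (p := 2) _ w.1)

theorem HCurl.norm_curl_le (w : HCurl Ω) (i : Fin 3) : ‖HCurl.curl w i‖ ≤ ‖w‖ :=
  (PiLp.norm_apply_le _ i).trans (WithLp.norm_snd_le (p := 2) _ w.1)

theorem H1.norm_field_le (u : H1 Ω) (i : Fin 3) : ‖H1.field u i‖ ≤ ‖u‖ :=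
  (PiLp.norm_apply_le _ i).trans (WithLp.norm_fst_le (p := 2) _ u.1)

theorem norm_sum_pairing_le {f g : Fin 3 → L2 Ω} {A B : ℝ} (hA : ∀ i, ‖f i‖ ≤ A)
    (hB : ∀ i, ‖g i‖ ≤ B) : ‖∑ i, pairing Ω (f i) (g i)‖ ≤ 3 * (A * B) := by
  refine (norm_sum_le_of_le _ fun i _ => (norm_pairing_le (f i) (g i)).trans
    (mul_le_mul (hA i) (hB i) (norm_nonneg _) ((norm_nonneg _).trans (hA i)))).trans (le_of_eq ?_)
  simp

theorem norm_apply_mkQL_le {M : Type*} [SeminormedAddCommGroup M] [NormedSpace ℂ M]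
    {S : Submodule ℂ M} (h : StrongDual ℂ (M ⧸ S)) (m : M) : ‖h (S.mkQL m)‖ ≤ ‖h‖ * ‖m‖ :=
  (h.le_opNorm _).trans
    (mul_le_mul_of_nonneg_left (Submodule.Quotient.norm_mk_le S m) (norm_nonneg _))

theorem norm_coupledData_le (a : ℂ) (ξ₁ ξ₂ : L2V Ω) (h₁ : HNegHalf Ω) (w : HCurl Ω) :
    ‖coupledData a ξ₁ ξ₂ h₁ w‖ ≤ (6 * ‖a‖ + 3) * (‖ξ₁‖ + ‖ξ₂‖ + ‖h₁‖ + ‖w‖) := by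
  refine ContinuousLinearMap.opNorm_le_bound _ (by positivity) fun W => ?_
  have hv : ‖fst W‖ ≤ ‖W‖ := norm_fst_le W
  have hp : ‖snd W‖ ≤ ‖W‖ := norm_snd_le W
  have m1 : ‖magneticData ξ₁ w (fst W)‖ ≤ (3 * ‖ξ₁‖ + 6 * ‖w‖) * ‖W‖ := by
    rw [magneticData_apply]
    have s1 := norm_sum_pairing_le (fun i => PiLp.norm_apply_le ξ₁ i)
      fun i => (HCurl.norm_field_le (fst W) i).trans hv
    have s2 := norm_sum_pairing_le (fun i => HCurl.norm_curl_le w i)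
      fun i => (HCurl.norm_field_le (fst W) i).trans hv
    have s3 := norm_sum_pairing_le (fun i => HCurl.norm_field_le w i)
      fun i => (HCurl.norm_curl_le (fst W) i).trans hv
    refine (norm_sub_le _ _).trans ((add_le_add s1 ((norm_sub_le _ _).trans
      (add_le_add s2 s3))).trans (le_of_eq ?_))
    ring
  have m2 : ‖elasticData ξ₂ h₁ (snd W)‖ ≤ (‖h₁‖ + 3 * ‖ξ₂‖) * ‖W‖ := by
    rw [elasticData_apply]
    have s1 := norm_sum_pairing_le (fun i => PiLp.norm_apply_le ξ₂ i)
      fun i => (H1.norm_field_le (snd W) i).trans hp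
    have s2 : ‖h₁ (trace Ω (snd W))‖ ≤ ‖h₁‖ * ‖W‖ :=
      (norm_apply_mkQL_le h₁ (snd W)).trans (mul_le_mul_of_nonneg_left hp (norm_nonneg h₁))
    refine (norm_sub_le _ _).trans ((add_le_add s2 s1).trans (le_of_eq ?_))
    ring
  rw [coupledData_apply]
  refine (norm_add_le _ _).trans ?_
  rw [norm_mul]
  refine (add_le_add (mul_le_mul_of_nonneg_left m1 (norm_nonneg a)) m2).trans ?_
  have hW := norm_nonneg W
  have e : ‖a‖ * ((3 * ‖ξ₁‖ + 6 * ‖w‖) * ‖W‖) + (‖h₁‖ + 3 * ‖ξ₂‖) * ‖W‖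
      = (‖a‖ * (3 * ‖ξ₁‖ + 6 * ‖w‖) + (‖h₁‖ + 3 * ‖ξ₂‖)) * ‖W‖ := by ring
  rw [e]
  refine mul_le_mul_of_nonneg_right ?_ hW
  have t1 : 0 ≤ ‖a‖ * ‖ξ₁‖ := by positivity
  have t2 : 0 ≤ ‖a‖ * ‖ξ₂‖ := by positivity
  have t3 : 0 ≤ ‖a‖ * ‖h₁‖ := by positivity
  have t4 : 0 ≤ ‖a‖ * ‖w‖ := by positivity
  linarith [norm_nonneg ξ₁, norm_nonneg ξ₂, norm_nonneg h₁, norm_nonneg w]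

end Coupled

end MaxwellNavier

end

/-! ### Existence, uniqueness and stability for the boundary value problem -/

theorem lemma4p1 (Ω : Set E3) (hΩ : IsBoundedLipschitzDomain Ω)
    (C : Tensor4 Ω) (hsymm : IsSymmetric C) (hell : IsLegendreElliptic C)
    (κ : ℝ) (hκ : 0 < κ) (b₁ b₂ : ℂ) (hb : (b₁ * starRingEnd ℂ b₂).im < 0) :
    ∃ K : ℝ, 0 < K ∧
      ∀ (ξ₁ ξ₂ : L2V Ω) (h₁ h₂ : HNegHalf Ω), h₂ ∈ HNegHalfDiv Ω →
        (∃! p : HCurl Ω × H1 Ω, IsSolution C κ b₁ b₂ ξ₁ ξ₂ h₁ h₂ p.1 p.2) ∧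
        ∀ (H : HCurl Ω) (u : H1 Ω), IsSolution C κ b₁ b₂ ξ₁ ξ₂ h₁ h₂ H u →
          ‖H‖ + ‖u‖ ≤ K * (‖ξ₁‖ + ‖ξ₂‖ + ‖h₁‖ + normDiv h₂) := by
  have hb₂ : b₂ ≠ 0 := by
    rintro rfl
    simp at hb
  have hκ' : (κ : ℂ) ≠ 0 := Complex.ofReal_ne_zero.2 hκ.ne'
  set β : ℂ := Complex.I * κ / b₂ with hβ
  -- The weight is forced by `a β = conj b₁`, which makes the coupling terms cancel in the real
  -- part.
  set a : ℂ := -Complex.I * starRingEnd ℂ b₁ * b₂ / κ with ha_def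
  have hab : a * β = starRingEnd ℂ b₁ := by
    rw [ha_def, hβ]
    field_simp
    linear_combination (-(starRingEnd ℂ b₁)) * Complex.I_sq
  have ha : 0 < a.re := by
    have h1 : a.re = -(b₁ * starRingEnd ℂ b₂).im / κ := by
      rw [ha_def, Complex.div_ofReal_re]
      congr 1
      simp only [Complex.mul_re, Complex.mul_im, Complex.neg_re, Complex.neg_im, Complex.I_re,
        Complex.I_im, Complex.conj_re, Complex.conj_im]
      ring
    rw [h1]
    exact div_pos (neg_pos.2 hb) hκ
  have ha0 : a ≠ 0 := by
    rintro h0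
    simp [h0] at ha
  obtain ⟨c, hc, hcoer⟩ := exists_coercive hΩ hsymm hell hab ha
  have hsol : ∀ {ξ₁ ξ₂ : L2V Ω} {h₁ : HNegHalf Ω} {w H : HCurl Ω} {u : H1 Ω},
      IsSolution C κ b₁ b₂ ξ₁ ξ₂ h₁ (tangentialTrace w) H u →
        coupledForm C a β b₁ (SolutionSpace.mk H u) = coupledData a ξ₁ ξ₂ h₁ w := fun h =>
    (coupledForm_eq_iff C ha0 β b₁ _ _ _ _ _).2 (h.forms_eq hΩ)
  -- `(6‖a‖ + 3) / c` bounds the norm of the pair; the factor two accounts for adding the norms of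
  -- its two components.
  refine ⟨2 * (6 * ‖a‖ + 3) / c, by positivity, fun ξ₁ ξ₂ h₁ h₂ hh₂ => ⟨?_, ?_⟩⟩
  · obtain ⟨w, rfl⟩ := hh₂
    obtain ⟨U, hU⟩ := exists_eq_of_coercive (coupledForm C a β b₁) norm_conjSol conjSol_conjSol hc
      hcoer (coupledData a ξ₁ ξ₂ h₁ w)
    obtain ⟨e1, e2⟩ := (coupledForm_eq_iff C ha0 β b₁ _ _ _ _ _).1 hU
    refine ⟨(SolutionSpace.fst U, SolutionSpace.snd U),
      isSolution_of_forms_eq hΩ.isBounded e1 e2, ?_⟩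
    rintro ⟨H, u⟩ hHu
    have h1 := mul_norm_le_of_coercive (coupledForm C a β b₁) norm_conjSol hcoer
      (SolutionSpace.mk H u - U)
    rw [map_sub, hsol hHu, hU, sub_self, norm_zero] at h1
    have h2 : SolutionSpace.mk H u - U = 0 :=
      norm_le_zero_iff.1 (le_of_mul_le_mul_left (by rwa [mul_zero]) hc)
    rw [← sub_eq_zero.1 h2, SolutionSpace.fst_mk, SolutionSpace.snd_mk]
  · intro H u hHu
    -- The estimate holds for every lift `w` of `h₂`. Isolating `‖w‖` gives a lower bound
    -- independent of the lift, which passes to the infimum `normDiv h₂`.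
    have key : ∀ w : HCurl Ω, tangentialTrace w = h₂ →
        (‖H‖ + ‖u‖) * (c / (2 * (6 * ‖a‖ + 3))) - (‖ξ₁‖ + ‖ξ₂‖ + ‖h₁‖) ≤ ‖w‖ := by
      rintro w rfl
      have h1 := mul_norm_le_of_coercive (coupledForm C a β b₁) norm_conjSol hcoer
        (SolutionSpace.mk H u)
      rw [hsol hHu] at h1
      have h2 := h1.trans (norm_coupledData_le a ξ₁ ξ₂ h₁ w)
      have h3 : ‖H‖ ≤ ‖SolutionSpace.mk H u‖ :=
        SolutionSpace.norm_fst_le (SolutionSpace.mk H u)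
      have h4 : ‖u‖ ≤ ‖SolutionSpace.mk H u‖ :=
        SolutionSpace.norm_snd_le (SolutionSpace.mk H u)
      have h5 : (‖H‖ + ‖u‖) * c ≤ (‖ξ₁‖ + ‖ξ₂‖ + ‖h₁‖ + ‖w‖) * (2 * (6 * ‖a‖ + 3)) := by
        have h6 := mul_le_mul_of_nonneg_left (add_le_add h3 h4) hc.le
        linarith
      have h7 := (div_le_iff₀ (by positivity)).2 h5
      rw [mul_div_assoc] at h7
      linarith
    have hinf : (‖H‖ + ‖u‖) * (c / (2 * (6 * ‖a‖ + 3))) - (‖ξ₁‖ + ‖ξ₂‖ + ‖h₁‖) ≤ normDiv h₂ := by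
      obtain ⟨w, hw⟩ := hh₂
      refine le_csInf ⟨‖w‖, w, hw, rfl⟩ ?_
      rintro r ⟨w', hw', rfl⟩
      exact key w' hw'
    have h8 : (‖H‖ + ‖u‖) * (c / (2 * (6 * ‖a‖ + 3))) ≤ ‖ξ₁‖ + ‖ξ₂‖ + ‖h₁‖ + normDiv h₂ := by
      linarith
    have hpos : 0 < 2 * (6 * ‖a‖ + 3) := by positivity
    rw [← mul_div_assoc, div_le_iff₀ hpos] at h8
    rw [div_mul_eq_mul_div, le_div_iff₀ hc]
    linarith
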